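/- **Setting.** Let $r_1\in[-\infty,\infty)$, $s_1\in(-\infty,\infty]$, $r_2,s_2\in\mathbb R$ with $r_1<s_2$, $r_2<s_1$, and let $D=\{(r,s): r_1<r<r_2,\ s_2<s<s_1,\ r<s\}$. Fix $\mathbf x_0=(r_0,s_0)\in D$ such that the segments $\{(r,s_0):r_1<r<r_2\}$ and $\{(r_0,s):s_2<s<s_1\}$ lie in $D$. For $(r,s)\in D$ put $z=(r+s)/2$, $\rho=(s-r)/2$, and let $z_0,\rho_0$ be the values at $\mathbf x_0$. Let $\mathcal I^{(3)}=(r_1,r_2)$, $\mathcal I^{(4)}=(s_2,s_1)$. For $\mathbf x=(r,s)\in D$ let $\mathcal I^{(3)}(\mathbf x)$, $\mathcal I^{(4)}(\mathbf x)$ be the open intervals with end points $r,r_0$ and $s,s_0$ respectively, $\bar{\mathcal I}^{(i)}(\mathbf x)$ their closures (empty if the interval is empty), $\mathcal I(\mathbf x)=\mathcal I^{(3)}(\mathbf x)\cup\mathcal I^{(4)}(\mathbf x)$ and $\bar{\mathcal I}(\mathbf x)=\bar{\mathcal I}^{(3)}(\mathbf x)\cup\bar{\mathcal I}^{(4)}(\mathbf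 x)$. Let $$J=\begin{pmatrix}0&1\\-1&0\end{pmatrix},\quad \Omega=iJ,\quad \nu(\mathbf x,\tau)=\Big(\frac{\tau-r_0}{\tau-r}\Big)^{1/2}\Big(\frac{\tau-s_0}{\tau-s}\Big)^{1/2},$$ the branch with cut $\bar{\mathcal I}(\mathbf x)$ and $\nu(\mathbf x,\infty)=1$, and $$\mathcal F^M(\mathbf x,\tau)=\begin{pmatrix}1&-i(\tau-z)\\0&1\end{pmatrix}\begin{pmatrix}1&0\\0&\nu(\mathbf x,\tau)\end{pmatrix}\begin{pmatrix}1&i(\tau-z_0)\\0&1\end{pmatrix}.$$ A function is $C^{0+}$ if on each closed subinterval of its domain it obeys a Hölder condition of some index in $(0,1]$ (depending on the subinterval), and $C^{1+}$ if it is differentiable with $C^{0+}$ derivative. $K^{1+}$ is the set of pairs $\mathbf v=(v^{(3)},v^{(4)})$ of complex $2\times2$ matrix functions such that, for $i=3,4$, $v^{(i)}$ has domain $\mathcal I^{(i)}$, is $C^{1+}$, and satisfies $\det v^{(i)}=1$ and $v^{(i)}(\sigma)^\dagger\mathcal A(\sigma)v^{(i)}(\sigma)=\mathcal A(\sigma)$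 with $\mathcal A(\sigma)=(\sigma-z_0)\Omega+\Omega\,\mathrm{diag}(\rho_0^2,1)\,\Omega$. For a function $f$ on $\mathbb C\setminus\bar{\mathcal I}(\mathbf x)$ and $\sigma\in\mathcal I(\mathbf x)$ let $f^\pm(\sigma)=\lim_{\zeta\to0,\ \mathrm{Im}\,\zeta>0}f(\sigma\pm\zeta)$. A $2\times2$ matrix function $\mathcal F$ on $(\mathbb C\cup\{\infty\})\setminus\bar{\mathcal I}(\mathbf x)$ *solves the HHP corresponding to $(\mathbf v,\mathcal F^M,\mathbf x)$* if 1. $\mathcal F$ is holomorphic (also at $\infty$); 2. $\mathcal F(\infty)=I$; 3. $\mathcal F^\pm$ exist on $\mathcal I(\mathbf x)$ and $Y(\sigma):=\mathcal F^+(\sigma)v^{(i)}(\sigma)[\mathcal F^{M+}(\sigma)]^{-1}=\mathcal F^-(\sigma)v^{(i)}(\sigma)[\mathcal F^{M-}(\sigma)]^{-1}$ for $i=3,4$ and $\sigma\in\mathcal I^{(i)}(\mathbf x)$; 4. $\mathcal F$ is bounded near $\{r_0,s_0\}$ (off the cut), $\nu^{-1}\mathcal F$ is bounded near $\{r,s\}$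 (off the cut), and $Y$ is bounded on $\mathcal I(\mathbf x)$ near $\{r_0,s_0\}$ and near $\{r,s\}$. Put $W(\sigma)=v^{(i)}(\sigma)\begin{pmatrix}1&-i(\sigma-z_0)\\0&1\end{pmatrix}$ for $\sigma\in\bar{\mathcal I}^{(i)}(\mathbf x)$, with columns $W_1,W_2$. **Theorem (HHP–Alekseev equivalence).** Let $\mathbf v\in K^{1+}$ and $\mathbf x\in D$. Let $\mathcal F$ be a $2\times2$ matrix function on $(\mathbb C\cup\{\infty\})\setminus\bar{\mathcal I}(\mathbf x)$ with $\mathcal F(\infty)=I$, and let $\mathcal Y_1$ be a $2\times1$ matrix function on $\bar{\mathcal I}(\mathbf x)$ that is $C^{0+}$. Then the following are equivalent. (i) $\mathcal F$ solves the HHP corresponding to $(\mathbf v,\mathcal F^M,\mathbf x)$, and $\mathcal Y_1$ is its associated column: for all $\sigma\in\mathcal I(\mathbf x)$, $$\tfrac12\{\mathcal F^+(\sigma)+\mathcal F^-(\sigma)\}W(\sigma)=\big(\mathcal Y_1(\sigma)\ \ 0\big).$$ (ii) For all $\sigma\in\mathcal I(\mathbf x)$ (the integral existing as a principal value), $$0=W_1(\sigma)-\frac1{\pi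 i}\int_{\bar{\mathcal I}(\mathbf x)}d\sigma'\,[\nu^+(\sigma')]^{-1}\,\mathcal Y_1(\sigma')\,\frac{W_2(\sigma')^TJ\,W_1(\sigma)}{\sigma'-\sigma},$$ and, for all $\tau\in\mathbb C\setminus\bar{\mathcal I}(\mathbf x)$ (the integral converging absolutely), $$\nu(\tau)^{-1}\mathcal F(\tau)=I-\frac1{\pi i}\int_{\bar{\mathcal I}(\mathbf x)}d\sigma'\,[\nu^+(\sigma')]^{-1}\,\mathcal Y_1(\sigma')\,\frac{W_2(\sigma')^TJ}{\sigma'-\tau}.$$ -/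

import Mathlib

open Filter Topology MeasureTheory
open scoped NNReal Matrix

noncomputable section

namespace GerochHHP

/-- Complex `2 × 2` matrices. -/
abbrev M2 := Matrix (Fin 2) (Fin 2) ℂ

/-! ### Geometry of the null-coordinate domain -/

/-- The domain `D = {(r, s) : r₁ < r < r₂, s₂ < s < s₁, r < s}` in null coordinates.
Here `r₁` may be `-∞` and `s₁` may be `+∞`. -/
def nullDomain (r₁ s₁ : EReal) (r₂ s₂ : ℝ) : Set (ℝ × ℝ) :=
  {x | r₁ < (x.1 : EReal) ∧ x.1 < r₂ ∧ s₂ < x.2 ∧ (x.2 : EReal) < s₁ ∧ x.1 < x.2}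

/-- Standing assumptions on `D` and on the base point `x₀ = (r₀, s₀)`: the lower left and the
upper right vertices satisfy `r < s`, `x₀ ∈ D`, and the two null segments through `x₀` lie
in `D`. -/
structure IsDomainData (r₁ s₁ : EReal) (r₂ s₂ : ℝ) (x₀ : ℝ × ℝ) : Prop where
  lowerLeft : r₁ < (s₂ : EReal)
  upperRight : (r₂ : EReal) < s₁
  base_mem : x₀ ∈ nullDomain r₁ s₁ r₂ s₂
  segment_r : ∀ r : ℝ, r₁ < (r : EReal) → r < r₂ → (r, x₀.2) ∈ nullDomain r₁ s₁ r₂ s₂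
  segment_s : ∀ s : ℝ, s₂ < s → (s : EReal) < s₁ → (x₀.1, s) ∈ nullDomain r₁ s₁ r₂ s₂

/-- The interval `𝓘⁽³⁾ = (r₁, r₂)`. -/
def interval3 (r₁ : EReal) (r₂ : ℝ) : Set ℝ := {σ | r₁ < (σ : EReal) ∧ σ < r₂}

/-- The interval `𝓘⁽⁴⁾ = (s₂, s₁)`. -/
def interval4 (s₁ : EReal) (s₂ : ℝ) : Set ℝ := {σ | s₂ < σ ∧ (σ : EReal) < s₁}

/-- `𝓘⁽³⁾(x)`: the open interval with end points `r, r₀`. -/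
def arc3 (x₀ x : ℝ × ℝ) : Set ℝ := Set.uIoo x.1 x₀.1

/-- `𝓘⁽⁴⁾(x)`: the open interval with end points `s, s₀`. -/
def arc4 (x₀ x : ℝ × ℝ) : Set ℝ := Set.uIoo x.2 x₀.2

/-- `𝓘(x) = 𝓘⁽³⁾(x) ∪ 𝓘⁽⁴⁾(x)`. -/
def arc (x₀ x : ℝ × ℝ) : Set ℝ := arc3 x₀ x ∪ arc4 x₀ x

/-- The closed cut: the union of the closures of the two open intervals (the closure of an empty
interval being empty). -/
def arcBar (x₀ x : ℝ × ℝ) : Set ℝ := closure (arc3 x₀ x) ∪ closure (arc4 x₀ x)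

/-- The closed cut as a subset of the complex plane. -/
def cut (x₀ x : ℝ × ℝ) : Set ℂ := (fun σ : ℝ => (σ : ℂ)) '' arcBar x₀ x

/-- Weyl coordinate `z = (r + s) / 2`. -/
def zc (x : ℝ × ℝ) : ℝ := (x.1 + x.2) / 2

/-- Weyl coordinate `ρ = (s - r) / 2`. -/
def rhoc (x : ℝ × ℝ) : ℝ := (x.2 - x.1) / 2

/-! ### Hölder classes -/

/-- `f` is `C^{0+}` on `S`: on each closed subinterval of `S` it obeys a Hölder condition of some
index in `(0, 1]`, which may depend on the subinterval. -/
def IsC0Plus (S : Set ℝ) (f : ℝ → ℂ) : Prop :=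
  ∀ a b : ℝ, a ≤ b → Set.Icc a b ⊆ S →
    ∃ C γ : ℝ≥0, 0 < γ ∧ γ ≤ 1 ∧ HolderOnWith C γ f (Set.Icc a b)

/-- `f` is `C^{1+}` on `S`: it is differentiable on `S`, with derivative of class `C^{0+}`. -/
def IsC1Plus (S : Set ℝ) (f : ℝ → ℂ) : Prop :=
  DifferentiableOn ℝ f S ∧ IsC0Plus S (derivWithin f S)

/-! ### The group `K^{1+}` -/

def OmegaM : M2 := !![0, Complex.I; -Complex.I, 0]

def JM : M2 := !![0, 1; -1, 0]

/-- `𝓐ᴹ(x₀, σ) = (σ - z₀) Ω + Ω hᴹ(x₀) Ω` with `hᴹ(x₀) = diag(ρ₀², 1)`. -/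
def AMink (x₀ : ℝ × ℝ) (σ : ℝ) : M2 :=
  ((σ - zc x₀ : ℝ) : ℂ) • OmegaM + OmegaM * !![((rhoc x₀ : ℝ) : ℂ) ^ 2, 0; 0, 1] * OmegaM

/-- The conditions on one component `v⁽ⁱ⁾`, on its domain `S = 𝓘⁽ⁱ⁾`. -/
structure IsK1PlusComponent (x₀ : ℝ × ℝ) (S : Set ℝ) (w : ℝ → M2) : Prop where
  smooth : ∀ j k, IsC1Plus S (fun σ => w σ j k)
  det_eq_one : ∀ σ ∈ S, (w σ).det = 1
  invariance : ∀ σ ∈ S, (w σ)ᴴ * AMink x₀ σ * w σ = AMink x₀ σ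

/-- Membership of the pair `v = (v⁽³⁾, v⁽⁴⁾)` in `K^{1+}`. -/
def MemK1Plus (r₁ s₁ : EReal) (r₂ s₂ : ℝ) (x₀ : ℝ × ℝ) (v : (ℝ → M2) × (ℝ → M2)) : Prop :=
  IsK1PlusComponent x₀ (interval3 r₁ r₂) v.1 ∧ IsK1PlusComponent x₀ (interval4 s₁ s₂) v.2

open Classical in
/-- `σ ↦ v⁽ⁱ⁾(σ)` for `σ` in the `i`-th closed arc (the two closed arcs are disjoint). -/
def onArcs (x₀ x : ℝ × ℝ) (v : (ℝ → M2) × (ℝ → M2)) (σ : ℝ) : M2 :=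
  if σ ∈ closure (arc3 x₀ x) then v.1 σ else v.2 σ

/-! ### The functions `ν` and `𝓕ᴹ` -/

open Classical in
/-- `((τ - a) / (τ - b))^{1/2}`, holomorphic off the segment joining `a` and `b`, with value `1`
at infinity; the principal branch has precisely this cut. It is identically `1` if `a = b`. -/
def nuFactor (a b : ℝ) (τ : ℂ) : ℂ :=
  if a = b then 1 else ((τ - a) / (τ - b)) ^ (1 / 2 : ℂ)

/-- `ν(x, τ) = ((τ - r₀)/(τ - r))^{1/2} ((τ - s₀)/(τ - s))^{1/2}`. -/
def nu (x₀ x : ℝ × ℝ) (τ : ℂ) : ℂ := nuFactor x₀.1 x.1 τ * nuFactor x₀.2 x.2 τ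

/-- The Minkowski-space potential `𝓕ᴹ(x, τ)`. -/
def FMink (x₀ x : ℝ × ℝ) (τ : ℂ) : M2 :=
  !![1, -Complex.I * (τ - zc x); 0, 1] * !![1, 0; 0, nu x₀ x τ] *
    !![1, Complex.I * (τ - zc x₀); 0, 1]

/-! ### Boundary values on the cut -/

/-- The limit `f⁺(σ) = lim f(σ + ζ)` as `ζ → 0`, `Im ζ > 0`, exists. -/
def HasPlus {E : Type*} [TopologicalSpace E] (f : ℂ → E) (σ : ℝ) : Prop :=
  ∃ A, Tendsto (fun ζ : ℂ => f (σ + ζ)) (𝓝[{ζ : ℂ | 0 < ζ.im}] 0) (𝓝 A)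

/-- The limit `f⁻(σ) = lim f(σ - ζ)` as `ζ → 0`, `Im ζ > 0`, exists. -/
def HasMinus {E : Type*} [TopologicalSpace E] (f : ℂ → E) (σ : ℝ) : Prop :=
  ∃ A, Tendsto (fun ζ : ℂ => f (σ - ζ)) (𝓝[{ζ : ℂ | 0 < ζ.im}] 0) (𝓝 A)

/-- The boundary value `f⁺(σ)`. -/
def plus {E : Type*} [TopologicalSpace E] [Nonempty E] (f : ℂ → E) (σ : ℝ) : E :=
  limUnder (𝓝[{ζ : ℂ | 0 < ζ.im}] 0) (fun ζ : ℂ => f (σ + ζ))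

/-- The boundary value `f⁻(σ)`. -/
def minus {E : Type*} [TopologicalSpace E] [Nonempty E] (f : ℂ → E) (σ : ℝ) : E :=
  limUnder (𝓝[{ζ : ℂ | 0 < ζ.im}] 0) (fun ζ : ℂ => f (σ - ζ))

/-! ### The homogeneous Hilbert problem -/

/-- A matrix function `f` on a set `S` is bounded at the finite set `P`: it is bounded on the
intersection of `S` with some neighbourhood of `P`. -/
def BoundedAt {X : Type*} [TopologicalSpace X] (S P : Set X) (f : X → M2) : Prop :=
  ∃ U ∈ 𝓝ˢ P, ∃ C : ℝ, ∀ t ∈ U ∩ S, ∀ j k, ‖f t j k‖ ≤ C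

/-- `Y(x, σ) = 𝓕⁺(σ) v⁽ⁱ⁾(σ) [𝓕₀⁺(σ)]⁻¹`. -/
def YPlus (x₀ x : ℝ × ℝ) (v : (ℝ → M2) × (ℝ → M2)) (F₀ F : ℂ → M2) (σ : ℝ) : M2 :=
  plus F σ * onArcs x₀ x v σ * (plus F₀ σ)⁻¹

/-- `𝓕⁻(σ) v⁽ⁱ⁾(σ) [𝓕₀⁻(σ)]⁻¹`. -/
def YMinus (x₀ x : ℝ × ℝ) (v : (ℝ → M2) × (ℝ → M2)) (F₀ F : ℂ → M2) (σ : ℝ) : M2 :=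
  minus F σ * onArcs x₀ x v σ * (minus F₀ σ)⁻¹

/-- `F` is a solution of the homogeneous Hilbert problem corresponding to `(v, F₀, x)`.
Only the values of `F` off the closed cut matter; the value of `F` at infinity is `I`. -/
structure IsHHPSolution (x₀ x : ℝ × ℝ) (v : (ℝ → M2) × (ℝ → M2)) (F₀ F : ℂ → M2) : Prop where
  holomorphic : ∀ j k, DifferentiableOn ℂ (fun τ => F τ j k) (cut x₀ x)ᶜ
  /-- `F` is holomorphic at infinity with value `I` there. -/
  at_infinity : ∀ j k,
    AnalyticAt ℂ (fun w : ℂ => if w = 0 then (1 : M2) j k else F w⁻¹ j k) 0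
  hasPlus : ∀ σ ∈ arc x₀ x, HasPlus F σ
  hasMinus : ∀ σ ∈ arc x₀ x, HasMinus F σ
  jump : ∀ σ ∈ arc x₀ x, YPlus x₀ x v F₀ F σ = YMinus x₀ x v F₀ F σ
  bounded_base : BoundedAt (cut x₀ x)ᶜ {(x₀.1 : ℂ), (x₀.2 : ℂ)} F
  bounded_point : BoundedAt (cut x₀ x)ᶜ {(x.1 : ℂ), (x.2 : ℂ)}
    (fun τ => (nu x₀ x τ)⁻¹ • F τ)
  Y_bounded_base : BoundedAt (arc x₀ x) {x₀.1, x₀.2} (YPlus x₀ x v F₀ F)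
  Y_bounded_point : BoundedAt (arc x₀ x) {x.1, x.2} (YPlus x₀ x v F₀ F)

/-! ### The Alekseev-type equation -/

/-- `W(x, σ) = v⁽ⁱ⁾(σ) [[1, -i(σ - z₀)], [0, 1]]`. -/
def WMat (x₀ x : ℝ × ℝ) (v : (ℝ → M2) × (ℝ → M2)) (σ : ℝ) : M2 :=
  onArcs x₀ x v σ * !![1, -Complex.I * (σ - zc x₀); 0, 1]

/-- The first column of `W`. -/
def W1 (x₀ x : ℝ × ℝ) (v : (ℝ → M2) × (ℝ → M2)) (σ : ℝ) : Fin 2 → ℂ :=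
  fun j => WMat x₀ x v σ j 0

/-- The second column of `W`. -/
def W2 (x₀ x : ℝ × ℝ) (v : (ℝ → M2) × (ℝ → M2)) (σ : ℝ) : Fin 2 → ℂ :=
  fun j => WMat x₀ x v σ j 1

/-- The column `𝒴₁` is associated with `F`:
`½ {𝓕⁺(σ) + 𝓕⁻(σ)} W(σ)` has first column `𝒴₁(σ)` and second column `0`, for `σ ∈ 𝓘(x)`. -/
def IsAssociatedColumn (x₀ x : ℝ × ℝ) (v : (ℝ → M2) × (ℝ → M2)) (F : ℂ → M2)
    (Y₁ : ℝ → Fin 2 → ℂ) : Prop :=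
  ∀ σ ∈ arc x₀ x,
    (1 / 2 : ℂ) • (plus F σ + minus F σ) * WMat x₀ x v σ = !![Y₁ σ 0, 0; Y₁ σ 1, 0]

/-- The matrix density `[ν⁺(σ')]⁻¹ 𝒴₁(σ') W₂(σ')ᵀ J`. -/
def density (x₀ x : ℝ × ℝ) (v : (ℝ → M2) × (ℝ → M2)) (Y₁ : ℝ → Fin 2 → ℂ) (σ' : ℝ) : M2 :=
  (plus (nu x₀ x) σ')⁻¹ • (Matrix.vecMulVec (Y₁ σ') (W2 x₀ x v σ') * JM)

/-- The principal value at `σ` of the integral of `f` over `S` exists and equals `L`. -/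
def HasPVIntegral (S : Set ℝ) (σ : ℝ) (f : ℝ → ℂ) (L : ℂ) : Prop :=
  (∀ ε > 0, IntegrableOn f (S \ Metric.ball σ ε)) ∧
    Tendsto (fun ε : ℝ => ∫ t in S \ Metric.ball σ ε, f t) (𝓝[>] 0) (𝓝 L)

/-- The Alekseev-type singular integral equation for `𝒴₁`: for every `σ ∈ 𝓘(x)`,
`0 = W₁(σ) - (1/πi) PV ∫ dσ' [ν⁺(σ')]⁻¹ 𝒴₁(σ') W₂(σ')ᵀ J W₁(σ) / (σ' - σ)`. -/
def SolvesAlekseev (x₀ x : ℝ × ℝ) (v : (ℝ → M2) × (ℝ → M2)) (Y₁ : ℝ → Fin 2 → ℂ) : Prop :=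
  ∀ σ ∈ arc x₀ x, ∃ L : Fin 2 → ℂ,
    (∀ j, HasPVIntegral (arcBar x₀ x) σ
      (fun σ' : ℝ => (density x₀ x v Y₁ σ' *ᵥ W1 x₀ x v σ) j / ((σ' : ℂ) - σ)) (L j)) ∧
    0 = W1 x₀ x v σ - (1 / (Real.pi * Complex.I)) • L

/-- `F` is given by the Cauchy integral: for every finite `τ` off the closed cut,
`ν(τ)⁻¹ F(τ) = I - (1/πi) ∫ dσ' [ν⁺(σ')]⁻¹ 𝒴₁(σ') W₂(σ')ᵀ J / (σ' - τ)`, the integral being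
absolutely convergent. -/
def IsCauchyIntegral (x₀ x : ℝ × ℝ) (v : (ℝ → M2) × (ℝ → M2)) (F : ℂ → M2)
    (Y₁ : ℝ → Fin 2 → ℂ) : Prop :=
  ∀ τ ∈ (cut x₀ x)ᶜ, ∀ j k,
    IntegrableOn (fun σ' : ℝ => density x₀ x v Y₁ σ' j k / ((σ' : ℂ) - τ)) (arcBar x₀ x) ∧
    (nu x₀ x τ)⁻¹ * F τ j k = (1 : M2) j k - (1 / (Real.pi * Complex.I)) *
      ∫ σ' in arcBar x₀ x, density x₀ x v Y₁ σ' j k / ((σ' : ℂ) - τ)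

end GerochHHP

end

/-!
Both directions rest on the matrix function `G = ν⁻¹ 𝓕` and the density `d = [ν⁺]⁻¹ 𝒴₁ W₂ᵀ J`.

Since `ν⁻ = -ν⁺` on the arcs, the jump `G⁺ - G⁻` is `[ν⁺]⁻¹ (𝓕⁺ + 𝓕⁻)`. As `det W = 1`, the first
row of `W⁻¹` is `-W₂ᵀ J`, so that `½ (𝓕⁺ + 𝓕⁻) W = (𝒴₁ 0)` says exactly that this jump is `-2 d`.
Further, `ArcData.jump_iff` rewrites the condition `𝓕⁺ v [𝓕ᴹ⁺]⁻¹ = 𝓕⁻ v [𝓕ᴹ⁻]⁻¹` as: `𝓕 W₁` is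
continuous across the arcs and `𝓕 W₂` changes sign.

From the Hilbert problem to the integral equations. By `plemelj`, the Cauchy integral
`I - (1/πi) ∫ d(σ') / (σ' - τ) dσ'` has the same jump as `G`. Hence the difference of the two
functions has equal limits from both sides of the real line, except at the end points of the arcs,
where its product with the distance to the end point tends to zero, and it vanishes at infinity.
By Painlevé's, Riemann's and Liouville's theorems (`eq_zero_of_tendsto_offReal`) it is zero. With
this representation, `(𝓕⁺ - 𝓕⁻) W₁ = 0` is the singular integral equation.

From the integral equations to the Hilbert problem. The representation of `G` gives holomorphy,
the value at infinity and, by Plemelj's formulas, the boundary values of `𝓕`; the singular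
integral equation gives `𝓕⁺ W₁ = 𝓕⁻ W₁ = 𝒴₁`, while `𝓕⁺ W₂ = -𝓕⁻ W₂` because `W₂ᵀ J W₂ = 0`. What
remains are the bounds at the end points. The density vanishes at the points `r`, `s` like a
square root, so that its Cauchy integral is bounded there. At `r₀`, `s₀` it has an inverse square
root singularity; the substitution `t = a ± u²` turns the Cauchy integral into `ζ⁻¹` times that of
a Hölder function, where `ζ² = ±(τ - a)`, and the zero of `ν` compensates for this
(`mul_cauchyInt_endDensity`). Finally, the first column of `Y` is `𝒴₁`, and the second one is
controlled by the integral of `d(σ') W₂(σ) / (σ' - σ)`, the kernel of which has no singularity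
because `W₂` is Lipschitz and `W₂ᵀ J W₂ = 0` (`ArcData.exists_norm_pv_le`).

The intervals are allowed to degenerate to the empty set, with square root `1`; for this reason
the closed interval with end points `a` and `b` is `closedArc a b`, which is empty if `a = b`.
-/

namespace GerochHHP

/-! ### Removing singularities on the real line -/

/-- The complex plane without the real line. -/
def offReal : Set ℂ := {τ | τ.im ≠ 0}

lemma isOpen_offReal : IsOpen offReal := isOpen_ne_fun Complex.continuous_im continuous_const

lemma dense_offReal : Dense offReal :=
  (dense_compl_singleton (0 : ℝ)).preimage Complex.isOpenMap_im

instance nhdsWithin_offReal_neBot (τ : ℂ) : (𝓝[offReal] τ).NeBot :=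
  mem_closure_iff_nhdsWithin_neBot.1 (dense_offReal τ)

/-- Painlevé's theorem for the real line: each rectangle is cut by the real line into two
rectangles on which Cauchy's theorem holds, and Morera's theorem applies. -/
lemma differentiable_of_differentiableOn_offReal {f : ℂ → ℂ} (hc : Continuous f)
    (hd : DifferentiableOn ℂ f offReal) : Differentiable ℂ f := by
  have key : ∀ a b y₁ y₂ : ℝ, (0 : ℝ) ∉ Set.Ioo (min y₁ y₂) (max y₁ y₂) →
      (∫ x : ℝ in a..b, f (x + y₁ * Complex.I)) - (∫ x : ℝ in a..b, f (x + y₂ * Complex.I)) +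
      Complex.I • (∫ y : ℝ in y₁..y₂, f (b + y * Complex.I)) -
      Complex.I • (∫ y : ℝ in y₁..y₂, f (a + y * Complex.I)) = 0 := by
    intro a b y₁ y₂ h0
    have := Complex.integral_boundary_rect_eq_zero_of_continuousOn_of_differentiableOn f
      ⟨a, y₁⟩ ⟨b, y₂⟩ hc.continuousOn (hd.mono ?_)
    · simpa using this
    · rintro τ ⟨-, hτ⟩
      have hτ' : τ.im ∈ Set.Ioo (min y₁ y₂) (max y₁ y₂) := hτ
      intro h
      rw [h] at hτ'
      exact h0 hτ'
  -- The sides on the real line of the two halves of a rectangle cancel.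
  have hcons : Complex.IsConservativeOn f Set.univ := by
    intro z w _
    rw [eq_neg_iff_add_eq_zero, Complex.wedgeIntegral_add_wedgeIntegral_eq]
    have h1 := key z.re w.re z.im 0 (by
      rcases le_total z.im 0 with h | h <;> simp [h])
    have h2 := key z.re w.re 0 w.im (by
      rcases le_total w.im 0 with h | h <;> simp [h])
    have hi : ∀ (a : ℝ) (y₁ y₂ : ℝ),
        IntervalIntegrable (fun y : ℝ => f (a + y * Complex.I)) volume y₁ y₂ := fun a y₁ y₂ =>
      (by fun_prop : Continuous fun y : ℝ => f (a + y * Complex.I)).intervalIntegrable _ _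
    rw [← intervalIntegral.integral_add_adjacent_intervals (hi w.re z.im 0) (hi w.re 0 w.im),
      ← intervalIntegral.integral_add_adjacent_intervals (hi z.re z.im 0) (hi z.re 0 w.im)]
    simp only [smul_add]
    linear_combination h1 + h2
  exact differentiableOn_univ.1
    ((Complex.IsConservativeOn.isExactOn_univ hc hcons).differentiableOn isOpen_univ)

/-- An entire function that equals `∏ (τ - e) h(τ)` off the real line is divisible by the
product, if `(τ - e) h(τ)` tends to `0` at each point `e`. -/
lemma exists_entire_quotient (E : Finset ℝ) {h : ℂ → ℂ} {f : ℂ → ℂ} (hf : Differentiable ℂ f)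
    (hfh : ∀ τ ∈ offReal, f τ = (∏ e ∈ E, (τ - (e : ℂ))) * h τ)
    (h0 : ∀ e ∈ E, Tendsto (fun τ : ℂ => (τ - (e : ℂ)) * h τ) (𝓝[offReal] (e : ℂ)) (𝓝 0)) :
    ∃ g : ℂ → ℂ, Differentiable ℂ g ∧ ∀ τ ∈ offReal, g τ = h τ := by
  induction E using Finset.induction_on generalizing f with
  | empty => exact ⟨f, hf, fun τ hτ => by simpa using hfh τ hτ⟩
  | insert e E he ih =>
    have hne : ∀ τ ∈ offReal, τ ≠ (e : ℂ) := by
      rintro τ hτ rfl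
      exact hτ (by simp)
    have hfe : f e = 0 := by
      have h1 : Tendsto f (𝓝[offReal] (e : ℂ)) (𝓝 (f e)) :=
        (hf.continuous.tendsto _).mono_left nhdsWithin_le_nhds
      have h2 : Tendsto f (𝓝[offReal] (e : ℂ)) (𝓝 0) := by
        have h3 : Tendsto (fun τ : ℂ => ∏ x ∈ E, (τ - (x : ℂ))) (𝓝[offReal] (e : ℂ))
            (𝓝 (∏ x ∈ E, ((e : ℂ) - (x : ℂ)))) :=
          ((by fun_prop : Continuous fun τ : ℂ => ∏ x ∈ E, (τ - (x : ℂ))).tendsto _).mono_left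
            nhdsWithin_le_nhds
        have h4 := h3.mul (h0 e (Finset.mem_insert_self _ _))
        rw [mul_zero] at h4
        refine h4.congr' ?_
        filter_upwards [self_mem_nhdsWithin] with τ hτ
        rw [hfh τ hτ, Finset.prod_insert he]
        ring
      exact tendsto_nhds_unique h1 h2
    refine ih (f := dslope f e) ?_ ?_ (fun x hx => h0 x (Finset.mem_insert_of_mem hx))
    · exact differentiableOn_univ.1
        ((Complex.differentiableOn_dslope univ_mem).2 hf.differentiableOn)
    · intro τ hτ
      rw [dslope_of_ne _ (hne τ hτ), slope_def_field, hfe, hfh τ hτ, Finset.prod_insert he]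
      have := sub_ne_zero.2 (hne τ hτ)
      field_simp
      simp

/-- If a continuous function is bounded off the real line in an open set, it is bounded in the
open set. -/
lemma norm_le_of_norm_le_offReal {S U : Set ℂ} (hS : IsOpen S) (hU : IsOpen U) {f : ℂ → ℂ}
    (hf : ContinuousOn f S) {C : ℝ} (hC : ∀ τ ∈ U ∩ offReal, ‖f τ‖ ≤ C) :
    ∀ τ ∈ U ∩ S, ‖f τ‖ ≤ C := by
  rintro τ ⟨hτU, hτS⟩
  have h1 : Tendsto (fun τ => ‖f τ‖) (𝓝[offReal] τ) (𝓝 ‖f τ‖) :=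
    ((hf.continuousAt (hS.mem_nhds hτS)).norm).mono_left nhdsWithin_le_nhds
  refine le_of_tendsto h1 ?_
  filter_upwards [self_mem_nhdsWithin, nhdsWithin_le_nhds (hU.mem_nhds hτU)] with t ht ht'
  exact hC t ⟨ht', ht⟩

/-- A function holomorphic off the real line that has the same limits from both sides at all but
finitely many real points, has weak singularities at these, and vanishes at infinity, is zero. -/
lemma eq_zero_of_tendsto_offReal (E : Finset ℝ) {h : ℂ → ℂ} (hd : DifferentiableOn ℂ h offReal)
    (hlim : ∀ σ : ℝ, σ ∉ E → ∃ L, Tendsto h (𝓝[offReal] (σ : ℂ)) (𝓝 L))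
    (h0 : ∀ e ∈ E, Tendsto (fun τ : ℂ => (τ - (e : ℂ)) * h τ) (𝓝[offReal] (e : ℂ)) (𝓝 0))
    (hinf : Tendsto h (cocompact ℂ ⊓ 𝓟 offReal) (𝓝 0)) :
    ∀ τ ∈ offReal, h τ = 0 := by
  set K : ℂ → ℂ := fun τ => (∏ e ∈ E, (τ - (e : ℂ))) * h τ with hK
  have hpc : Continuous fun τ : ℂ => ∏ e ∈ E, (τ - (e : ℂ)) := by fun_prop
  have hKd : DifferentiableOn ℂ K offReal := by
    refine DifferentiableOn.mul (Differentiable.differentiableOn (by fun_prop)) hd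
  have hKlim : ∀ τ, ∃ y, Tendsto K (𝓝[offReal] τ) (𝓝 y) := by
    intro τ
    by_cases hτ : τ.im = 0
    · obtain ⟨σ, rfl⟩ : ∃ σ : ℝ, τ = σ := ⟨τ.re, by apply Complex.ext <;> simp [hτ]⟩
      by_cases hσ : σ ∈ E
      · refine ⟨(∏ e ∈ E.erase σ, ((σ : ℂ) - (e : ℂ))) * 0, ?_⟩
        have hpc' : Continuous fun τ : ℂ => ∏ e ∈ E.erase σ, (τ - (e : ℂ)) := by fun_prop
        refine (((hpc'.tendsto _).mono_left nhdsWithin_le_nhds).mul (h0 σ hσ)).congr fun τ => ?_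
        rw [hK]
        simp only
        rw [← Finset.mul_prod_erase E _ hσ]
        ring
      · obtain ⟨L, hL⟩ := hlim σ hσ
        exact ⟨_, ((hpc.tendsto _).mono_left nhdsWithin_le_nhds).mul hL⟩
    · exact ⟨K τ, (hKd.continuousOn.continuousAt (isOpen_offReal.mem_nhds hτ)).mono_left
        nhdsWithin_le_nhds⟩
  have hfc : Continuous (extendFrom offReal K) := continuous_extendFrom dense_offReal hKlim
  have hfK : ∀ τ ∈ offReal, extendFrom offReal K τ = K τ := fun τ hτ =>
    extendFrom_eq (dense_offReal τ)
      ((hKd.continuousOn.continuousAt (isOpen_offReal.mem_nhds hτ)).mono_left nhdsWithin_le_nhds)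
  have hfd : Differentiable ℂ (extendFrom offReal K) :=
    differentiable_of_differentiableOn_offReal hfc (hKd.congr hfK)
  obtain ⟨g, hg, hgh⟩ := exists_entire_quotient E hfd hfK h0
  have hg0 : Tendsto g (cocompact ℂ) (𝓝 0) := by
    rw [Metric.tendsto_nhds]
    intro ε hε
    have h1 := (Metric.tendsto_nhds.1 hinf) (ε / 2) (half_pos hε)
    rw [eventually_inf_principal, ← Metric.cobounded_eq_cocompact] at h1
    obtain ⟨R, hR⟩ := (hasBasis_cobounded_norm (E := ℂ)).eventually_iff.1 h1
    rw [← Metric.cobounded_eq_cocompact]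
    have hU : IsOpen {τ : ℂ | R < ‖τ‖} := isOpen_lt continuous_const continuous_norm
    have h2 := norm_le_of_norm_le_offReal (S := Set.univ) (U := {τ : ℂ | R < ‖τ‖}) isOpen_univ hU
      hg.continuous.continuousOn (C := ε / 2) (by
        rintro τ ⟨hτ1, hτ2⟩
        have h3 := hR.2 (show R ≤ ‖τ‖ from le_of_lt hτ1) hτ2
        rw [hgh τ hτ2]
        simpa using h3.le)
    refine (hasBasis_cobounded_norm (E := ℂ)).eventually_iff.2 ⟨R + 1, trivial, ?_⟩
    intro τ hτ
    have hτ' : R + 1 ≤ ‖τ‖ := hτ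
    have := h2 τ ⟨show R < ‖τ‖ by linarith, trivial⟩
    simp only [dist_zero_right]
    linarith
  intro τ hτ
  rw [← hgh τ hτ]
  exact hg.apply_eq_of_tendsto_cocompact τ hg0

/-! ### Boundary values of Cauchy integrals on the real line -/

lemma intervalIntegrable_abs_rpow {p : ℝ} (hp : -1 < p) (R : ℝ) :
    IntervalIntegrable (fun u : ℝ => |u| ^ p) volume (-R) R := by
  have key : ∀ R : ℝ, 0 ≤ R → IntervalIntegrable (fun u : ℝ => |u| ^ p) volume 0 R := by
    intro R hR
    refine (intervalIntegral.intervalIntegrable_rpow' (a := 0) (b := R) hp).congr ?_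
    intro u hu
    rw [Set.uIoc_of_le hR] at hu
    simp only [abs_of_pos hu.1]
  have key2 : ∀ R : ℝ, IntervalIntegrable (fun u : ℝ => |u| ^ p) volume 0 R := by
    intro R
    rcases le_total 0 R with hR | hR
    · exact key R hR
    · have := (key (-R) (by linarith)).comp_sub_left 0
      simp only [zero_sub, abs_neg, neg_neg, neg_zero] at this
      exact this
  exact (key2 (-R)).symm.trans (key2 R)

lemma integral_inv_sub_eq_log {R y : ℝ} (hy : y ≠ 0) :
    ∫ u in (-R)..R, (1 : ℂ) / ((u : ℂ) - y * Complex.I) =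
      Complex.log ((R : ℂ) - y * Complex.I) - Complex.log (((-R : ℝ) : ℂ) - y * Complex.I) := by
  have hne : ∀ u : ℝ, (u : ℂ) - y * Complex.I ∈ Complex.slitPlane := fun u =>
    Complex.mem_slitPlane_iff.2 (Or.inr (by simpa using hy))
  refine intervalIntegral.integral_eq_sub_of_hasDerivAt
    (f := fun u : ℝ => Complex.log ((u : ℂ) - y * Complex.I)) ?_ ?_
  · intro u _
    exact HasDerivAt.clog_real ((Complex.ofRealCLM.hasDerivAt).sub_const _) (hne u)
  · refine Continuous.intervalIntegrable ?_ _ _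
    refine continuous_const.div (by fun_prop) fun u => Complex.slitPlane_ne_zero (hne u)

lemma integral_odd_eq_zero {R : ℝ} {g : ℝ → ℂ} (hg : ∀ u, g (-u) = -g u) :
    ∫ u in (-R)..R, g u = 0 := by
  have h := intervalIntegral.integral_comp_neg (a := -R) (b := R) g
  simp only [hg, intervalIntegral.integral_neg, neg_neg] at h
  have : (2 : ℂ) * ∫ u in (-R)..R, g u = 0 := by linear_combination -h
  simpa using this

/-- The Hölder condition on the whole line, in the form in which it is used. -/
def IsHolderLine (ψ : ℝ → ℂ) : Prop :=
  ∃ C γ : ℝ, 0 ≤ C ∧ 0 < γ ∧ ∀ x y, ‖ψ x - ψ y‖ ≤ C * |x - y| ^ γ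

lemma IsHolderLine.continuous {ψ : ℝ → ℂ} (h : IsHolderLine ψ) : Continuous ψ := by
  obtain ⟨C, γ, hC, hγ, h⟩ := h
  refine continuous_iff_continuousAt.2 fun x => ?_
  rw [ContinuousAt, tendsto_iff_norm_sub_tendsto_zero]
  have h1 : Tendsto (fun y : ℝ => C * |y - x| ^ γ) (𝓝 x) (𝓝 (C * |x - x| ^ γ)) := by
    have : Continuous fun y : ℝ => C * |y - x| ^ γ :=
      continuous_const.mul ((by fun_prop : Continuous fun y : ℝ => |y - x|).rpow_const
        fun _ => Or.inr hγ.le)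
    exact this.tendsto x
  rw [sub_self, abs_zero, Real.zero_rpow hγ.ne', mul_zero] at h1
  exact squeeze_zero (fun _ => norm_nonneg _) (fun y => h y x) h1

/-- The difference quotients in Plemelj's formula are dominated, uniformly in the base point. -/
lemma norm_holder_quotient_le {ψ : ℝ → ℂ} {C γ : ℝ}
    (h : ∀ x y, ‖ψ x - ψ y‖ ≤ C * |x - y| ^ γ) (x y u : ℝ) (hu : u ≠ 0) :
    ‖(ψ (u + x) - ψ x) / ((u : ℂ) - y * Complex.I)‖ ≤ C * |u| ^ (γ - 1) := by
  have hu' : 0 < |u| := abs_pos.2 hu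
  have h1 : |u| ≤ ‖(u : ℂ) - y * Complex.I‖ := by
    simpa using Complex.abs_re_le_norm ((u : ℂ) - y * Complex.I)
  have h2 := h (u + x) x
  rw [add_sub_cancel_right] at h2
  rw [norm_div, Real.rpow_sub_one hu'.ne', ← mul_div_assoc]
  exact div_le_div₀ ((norm_nonneg _).trans h2) h2 hu' h1

lemma tendsto_integral_holder_quotient {ψ : ℝ → ℂ} {C γ : ℝ} (hψ : Continuous ψ) (hγ : 0 < γ)
    (h : ∀ x y, ‖ψ x - ψ y‖ ≤ C * |x - y| ^ γ) (R σ : ℝ) :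
    Tendsto (fun τ : ℂ => ∫ u in (-R)..R, (ψ (u + τ.re) - ψ τ.re) / ((u : ℂ) - τ.im * Complex.I))
      (𝓝 (σ : ℂ)) (𝓝 (∫ u in (-R)..R, (ψ (u + σ) - ψ σ) / (u : ℂ))) := by
  refine intervalIntegral.tendsto_integral_filter_of_dominated_convergence
    (fun u => C * |u| ^ (γ - 1)) ?_ ?_ ((intervalIntegrable_abs_rpow (by linarith) R).const_mul C)
    ?_
  · refine Eventually.of_forall fun τ => ?_
    have : Measurable fun u : ℝ => (ψ (u + τ.re) - ψ τ.re) / ((u : ℂ) - τ.im * Complex.I) := by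
      have h1 : Measurable fun u : ℝ => ψ (u + τ.re) - ψ τ.re := by fun_prop
      have h2 : Measurable fun u : ℝ => (u : ℂ) - τ.im * Complex.I := by fun_prop
      exact h1.div h2
    exact this.aestronglyMeasurable
  · refine Eventually.of_forall fun τ => ?_
    filter_upwards [compl_mem_ae_iff.2 (measure_singleton (0 : ℝ))] with u hu _
    exact norm_holder_quotient_le h _ _ u hu
  · filter_upwards [compl_mem_ae_iff.2 (measure_singleton (0 : ℝ))] with u hu _
    have hu' : (u : ℂ) - ((σ : ℂ).im : ℂ) * Complex.I ≠ 0 := by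
      simpa using hu
    have h1 : ContinuousAt (fun τ : ℂ => (ψ (u + τ.re) - ψ τ.re) /
        ((u : ℂ) - τ.im * Complex.I)) (σ : ℂ) := by
      refine ContinuousAt.div ?_ ?_ hu'
      · exact (by fun_prop : Continuous fun τ : ℂ => ψ (u + τ.re) - ψ τ.re).continuousAt
      · exact (by fun_prop : Continuous fun τ : ℂ => (u : ℂ) - τ.im * Complex.I).continuousAt
    simpa [ContinuousAt] using h1

lemma integral_eq_intervalIntegral_of_support {f : ℝ → ℂ} {R : ℝ} (hR : 0 ≤ R)
    (hf : ∀ u, R < |u| → f u = 0) : ∫ u, f u = ∫ u in (-R)..R, f u := by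
  rw [intervalIntegral.integral_of_le (by linarith), ← integral_Icc_eq_integral_Ioc]
  refine (setIntegral_eq_integral_of_forall_compl_eq_zero fun u hu => hf u ?_).symm
  by_contra hcon
  exact hu (abs_le.1 (not_lt.1 hcon))

lemma tendsto_log_reflected_lower {R : ℝ} (hR : 0 < R) {s : Set ℂ} (c : ℂ)
    (hs : Tendsto (fun τ : ℂ => ((-R : ℝ) : ℂ) - τ.im * Complex.I) (𝓝[s] c)
      (𝓝[{z : ℂ | z.im < 0}] ((-R : ℝ) : ℂ))) :
    Tendsto (fun τ : ℂ => Complex.log (((-R : ℝ) : ℂ) - τ.im * Complex.I)) (𝓝[s] c)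
      (𝓝 (Real.log R - Real.pi * Complex.I)) := by
  have h := Complex.tendsto_log_nhdsWithin_im_neg_of_re_neg_of_im_zero
    (z := ((-R : ℝ) : ℂ)) (by simpa using hR) (by simp)
  have h2 := h.comp hs
  rw [Complex.norm_real, Real.norm_eq_abs, abs_neg, abs_of_pos hR] at h2
  exact h2

lemma tendsto_log_reflected_upper {R : ℝ} (hR : 0 < R) {s : Set ℂ} (c : ℂ)
    (hs : Tendsto (fun τ : ℂ => ((-R : ℝ) : ℂ) - τ.im * Complex.I) (𝓝[s] c)
      (𝓝[{z : ℂ | 0 ≤ z.im}] ((-R : ℝ) : ℂ))) :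
    Tendsto (fun τ : ℂ => Complex.log (((-R : ℝ) : ℂ) - τ.im * Complex.I)) (𝓝[s] c)
      (𝓝 (Real.log R + Real.pi * Complex.I)) := by
  have h := Complex.tendsto_log_nhdsWithin_im_nonneg_of_re_neg_of_im_zero
    (z := ((-R : ℝ) : ℂ)) (by simpa using hR) (by simp)
  have h2 := h.comp hs
  rw [Complex.norm_real, Real.norm_eq_abs, abs_neg, abs_of_pos hR] at h2
  exact h2

lemma tendsto_sub_im_mul_I (a σ : ℝ) :
    Tendsto (fun τ : ℂ => (a : ℂ) - τ.im * Complex.I) (𝓝 (σ : ℂ)) (𝓝 (a : ℂ)) := by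
  have h : Continuous fun τ : ℂ => (a : ℂ) - τ.im * Complex.I := by fun_prop
  simpa using h.tendsto (σ : ℂ)

/-- The principal value of `∫ ψ(t) / (t - σ) dt` for a Hölder function with compact support. -/
lemma tendsto_principalValue {ψ : ℝ → ℂ} {C γ : ℝ} (hψ : Continuous ψ) (hγ : 0 < γ)
    (h : ∀ x y, ‖ψ x - ψ y‖ ≤ C * |x - y| ^ γ) {R σ : ℝ} (hR : 0 < R)
    (hsupp : ∀ u, R < |u| → ψ (u + σ) = 0) :
    Tendsto (fun ε : ℝ => ∫ t in (Metric.ball σ ε)ᶜ, ψ t / ((t : ℂ) - σ)) (𝓝[>] 0)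
      (𝓝 (∫ u in (-R)..R, (ψ (u + σ) - ψ σ) / (u : ℂ))) := by
  classical
  have hcut : ∀ ε : ℝ, MeasurableSet {u : ℝ | ε ≤ |u|} := fun ε =>
    measurableSet_le measurable_const (by fun_prop)
  have hmeas : ∀ c : ℂ, Measurable fun u : ℝ => (ψ (u + σ) - c) / (u : ℂ) := fun c =>
    (by fun_prop : Measurable fun u : ℝ => ψ (u + σ) - c).div (by fun_prop)
  have key : ∀ ε : ℝ, 0 < ε → ∫ t in (Metric.ball σ ε)ᶜ, ψ t / ((t : ℂ) - σ) =
      ∫ u in (-R)..R, Set.indicator {u : ℝ | ε ≤ |u|} (fun u => (ψ (u + σ) - ψ σ) / (u : ℂ)) u := by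
    intro ε hε
    rw [← integral_indicator Metric.isOpen_ball.measurableSet.compl,
      ← integral_add_right_eq_self _ σ]
    have h1 : ∀ u : ℝ, Set.indicator (Metric.ball σ ε)ᶜ (fun t : ℝ => ψ t / ((t : ℂ) - σ)) (u + σ) =
        Set.indicator {u : ℝ | ε ≤ |u|} (fun u => ψ (u + σ) / (u : ℂ)) u := by
      intro u
      by_cases hu : ε ≤ |u|
      · rw [Set.indicator_of_mem, Set.indicator_of_mem]
        · push_cast
          rw [add_sub_cancel_right]
        · exact hu
        · simpa [Real.dist_eq] using hu
      · rw [Set.indicator_of_notMem, Set.indicator_of_notMem]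
        · exact hu
        · simpa [Real.dist_eq] using hu
    simp only [h1]
    rw [integral_eq_intervalIntegral_of_support hR.le]
    · have hodd : ∫ u in (-R)..R, Set.indicator {u : ℝ | ε ≤ |u|} (fun u => ψ σ / (u : ℂ)) u = 0 := by
        refine integral_odd_eq_zero fun u => ?_
        by_cases hu : ε ≤ |u|
        · rw [Set.indicator_of_mem (by simpa using hu), Set.indicator_of_mem (by simpa using hu)]
          push_cast
          rw [div_neg]
        · rw [Set.indicator_of_notMem (by simpa using hu),
            Set.indicator_of_notMem (by simpa using hu), neg_zero]
      have hint : ∀ g : ℝ → ℂ, Continuous g → IntervalIntegrable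
          (fun u => Set.indicator {u : ℝ | ε ≤ |u|} (fun u => g u / (u : ℂ)) u) volume (-R) R := by
        intro g hg
        have hb : IntervalIntegrable (fun u => ‖g u‖ / ε) volume (-R) R :=
          (by fun_prop : Continuous fun u => ‖g u‖ / ε).intervalIntegrable _ _
        refine hb.mono_fun ?_ ?_
        · exact ((hg.measurable.div (by fun_prop)).indicator (hcut ε)).aestronglyMeasurable
        · refine Eventually.of_forall fun u => ?_
          by_cases hu : ε ≤ |u|
          · simp only [Set.indicator, Set.mem_ofPred_eq, if_pos hu]
            rw [norm_div, norm_div, norm_norm, Complex.norm_real, Real.norm_eq_abs,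
              Real.norm_eq_abs, abs_of_pos hε]
            gcongr
          · simp only [Set.indicator, Set.mem_ofPred_eq, if_neg hu, norm_zero]
            positivity
      have h2 := intervalIntegral.integral_sub (hint (fun u => ψ (u + σ)) (by fun_prop))
        (hint (fun _ => ψ σ) continuous_const)
      rw [hodd, sub_zero] at h2
      rw [← h2]
      refine intervalIntegral.integral_congr fun u _ => ?_
      simp only [Set.indicator]
      split_ifs
      · rw [sub_div]
      · simp
    · intro u hu
      simp [Set.indicator, hsupp u hu]
  refine Tendsto.congr' (f₁ := fun ε : ℝ => ∫ u in (-R)..R,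
    Set.indicator {u : ℝ | ε ≤ |u|} (fun u => (ψ (u + σ) - ψ σ) / (u : ℂ)) u) ?_ ?_
  · filter_upwards [self_mem_nhdsWithin] with ε hε
    exact (key ε hε).symm
  refine intervalIntegral.tendsto_integral_filter_of_dominated_convergence
    (fun u => C * |u| ^ (γ - 1)) ?_ ?_ ((intervalIntegrable_abs_rpow (by linarith) R).const_mul C)
    ?_
  · exact Eventually.of_forall fun ε => ((hmeas _).indicator (hcut ε)).aestronglyMeasurable
  · refine Eventually.of_forall fun ε => ?_
    filter_upwards [compl_mem_ae_iff.2 (measure_singleton (0 : ℝ))] with u hu _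
    refine (norm_indicator_le_norm_self _ _).trans ?_
    simpa using norm_holder_quotient_le h σ 0 u hu
  · filter_upwards [compl_mem_ae_iff.2 (measure_singleton (0 : ℝ))] with u hu _
    refine tendsto_const_nhds.congr' ?_
    have hu' : 0 < |u| := abs_pos.2 hu
    filter_upwards [nhdsWithin_le_nhds (Iio_mem_nhds hu')] with ε hε
    rw [Set.indicator_of_mem (show u ∈ {u : ℝ | ε ≤ |u|} from (show ε < |u| from hε).le)]

/-- Plemelj's formulas for a Hölder function of compact support on the line: the Cauchy integral
`∫ ψ(t) / (t - τ) dt` tends to its principal value plus or minus `πi ψ(σ)` as `τ` tends to `σ` from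
above or below. After the translation `t = u + Re τ` the difference quotients are dominated by
`|u|^(γ - 1)`; what remains is a logarithm. -/
theorem plemelj {ψ : ℝ → ℂ} (hψ : IsHolderLine ψ) {R₀ : ℝ} (hsupp : ∀ t, R₀ < |t| → ψ t = 0)
    (σ : ℝ) :
    ∃ L : ℂ,
      Tendsto (fun τ : ℂ => ∫ t : ℝ, ψ t / ((t : ℂ) - τ)) (𝓝[{z : ℂ | 0 < z.im}] (σ : ℂ))
        (𝓝 (L + Real.pi * Complex.I * ψ σ)) ∧
      Tendsto (fun τ : ℂ => ∫ t : ℝ, ψ t / ((t : ℂ) - τ)) (𝓝[{z : ℂ | z.im < 0}] (σ : ℂ))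
        (𝓝 (L - Real.pi * Complex.I * ψ σ)) ∧
      Tendsto (fun ε : ℝ => ∫ t in (Metric.ball σ ε)ᶜ, ψ t / ((t : ℂ) - σ)) (𝓝[>] 0) (𝓝 L) := by
  have hc := hψ.continuous
  obtain ⟨C, γ, hC, hγ, h⟩ := hψ
  set R : ℝ := |R₀| + |σ| + 2 with hRdef
  have hR : 0 < R := by positivity
  have hsupp' : ∀ x u : ℝ, |x - σ| < 1 → R < |u| → ψ (u + x) = 0 := by
    intro x u hx hu
    apply hsupp
    have h1 : |u| ≤ |u + x| + |x| := by simpa using abs_sub (u + x) x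
    have h2 : |x| ≤ |x - σ| + |σ| := by simpa using abs_add_le (x - σ) σ
    have h3 := le_abs_self R₀
    linarith
  refine ⟨∫ u in (-R)..R, (ψ (u + σ) - ψ σ) / (u : ℂ), ?_, ?_,
    tendsto_principalValue hc hγ h hR fun u hu => hsupp' σ u (by simp) hu⟩
  all_goals
    -- For `τ` close to `σ`, the part of the integral where `ψ` is replaced by the constant `ψ (Re τ)`
    -- is a difference of logarithms; only the second one has different limits from both sides.
    have hform : ∀ᶠ τ : ℂ in 𝓝 (σ : ℂ), τ.im ≠ 0 →
        (∫ u in (-R)..R, (ψ (u + τ.re) - ψ τ.re) / ((u : ℂ) - τ.im * Complex.I)) +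
          ψ τ.re * (Complex.log ((R : ℂ) - τ.im * Complex.I) -
            Complex.log (((-R : ℝ) : ℂ) - τ.im * Complex.I)) =
        ∫ t : ℝ, ψ t / ((t : ℂ) - τ) := by
      have h1 : ∀ᶠ τ : ℂ in 𝓝 (σ : ℂ), |τ.re - σ| < 1 := by
        have : Continuous fun τ : ℂ => |τ.re - σ| := by fun_prop
        exact this.continuousAt.eventually_lt continuousAt_const (by simp)
      filter_upwards [h1] with τ hτ hτ0
      have hne : ∀ u : ℝ, (u : ℂ) - τ.im * Complex.I ≠ 0 := by
        intro u hu
        have := congrArg Complex.im hu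
        simp at this
        exact hτ0 this
      rw [← integral_add_right_eq_self _ τ.re, ← integral_inv_sub_eq_log hτ0,
        integral_eq_intervalIntegral_of_support hR.le, ← intervalIntegral.integral_const_mul,
        ← intervalIntegral.integral_add]
      · refine intervalIntegral.integral_congr fun u _ => ?_
        have h2 : ((u + τ.re : ℝ) : ℂ) - τ = (u : ℂ) - τ.im * Complex.I := by
          push_cast
          linear_combination Complex.re_add_im τ
        simp only [h2]
        have := hne u
        field_simp
        ring
      · exact Continuous.intervalIntegrable (Continuous.div (by fun_prop) (by fun_prop) hne) _ _
      · exact Continuous.intervalIntegrable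
          (continuous_const.mul (Continuous.div (by fun_prop) (by fun_prop) hne)) _ _
      · intro u hu
        rw [hsupp' τ.re u hτ hu, zero_div]
    have hT := tendsto_integral_holder_quotient hc hγ h R σ
    have hψt : Tendsto (fun τ : ℂ => ψ τ.re) (𝓝 (σ : ℂ)) (𝓝 (ψ σ)) := by
      have : Continuous fun τ : ℂ => ψ τ.re := by fun_prop
      simpa using this.tendsto (σ : ℂ)
    have hlog1 : Tendsto (fun τ : ℂ => Complex.log ((R : ℂ) - τ.im * Complex.I)) (𝓝 (σ : ℂ))
        (𝓝 (Real.log R)) := by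
      rw [Complex.ofReal_log hR.le]
      exact (continuousAt_clog (Complex.ofReal_mem_slitPlane.2 hR)).tendsto.comp
        (tendsto_sub_im_mul_I R σ)
  · have hlog2 := tendsto_log_reflected_lower (s := {z : ℂ | 0 < z.im}) hR (σ : ℂ)
      (tendsto_nhdsWithin_iff.2 ⟨(tendsto_sub_im_mul_I (-R) σ).mono_left nhdsWithin_le_nhds, by
        filter_upwards [self_mem_nhdsWithin] with τ hτ
        have : 0 < τ.im := hτ
        simpa using this⟩)
    have := (hT.mono_left nhdsWithin_le_nhds).add ((hψt.mono_left nhdsWithin_le_nhds).mul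
      ((hlog1.mono_left nhdsWithin_le_nhds).sub hlog2))
    rw [show ψ σ * ((Real.log R : ℂ) - (Real.log R - Real.pi * Complex.I)) =
      Real.pi * Complex.I * ψ σ by ring] at this
    refine this.congr' ?_
    filter_upwards [self_mem_nhdsWithin, nhdsWithin_le_nhds hform] with τ hτ hτ'
    exact hτ' (ne_of_gt hτ)
  · have hlog2 := tendsto_log_reflected_upper (s := {z : ℂ | z.im < 0}) hR (σ : ℂ)
      (tendsto_nhdsWithin_iff.2 ⟨(tendsto_sub_im_mul_I (-R) σ).mono_left nhdsWithin_le_nhds, by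
        filter_upwards [self_mem_nhdsWithin] with τ hτ
        have : τ.im < 0 := hτ
        simpa using this.le⟩)
    have := (hT.mono_left nhdsWithin_le_nhds).add ((hψt.mono_left nhdsWithin_le_nhds).mul
      ((hlog1.mono_left nhdsWithin_le_nhds).sub hlog2))
    rw [show ψ σ * ((Real.log R : ℂ) - (Real.log R + Real.pi * Complex.I)) =
      -(Real.pi * Complex.I * ψ σ) by ring, ← sub_eq_add_neg] at this
    refine this.congr' ?_
    filter_upwards [self_mem_nhdsWithin, nhdsWithin_le_nhds hform] with τ hτ hτ'
    exact hτ' (ne_of_lt hτ)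

/-! ### Hölder functions on subsets of the line -/

/-- `f` obeys a Hölder condition of some positive index on `S`. -/
def IsHolderOn (S : Set ℝ) (f : ℝ → ℂ) : Prop :=
  ∃ C γ : ℝ, 0 ≤ C ∧ 0 < γ ∧ ∀ x ∈ S, ∀ y ∈ S, ‖f x - f y‖ ≤ C * |x - y| ^ γ

lemma IsHolderOn.congr {S : Set ℝ} {f g : ℝ → ℂ} (hf : IsHolderOn S f)
    (h : ∀ x ∈ S, g x = f x) : IsHolderOn S g := by
  obtain ⟨C, γ, hC, hγ, hf⟩ := hf
  exact ⟨C, γ, hC, hγ, fun x hx y hy => by rw [h x hx, h y hy]; exact hf x hx y hy⟩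

lemma IsHolderOn.continuousOn {S : Set ℝ} {f : ℝ → ℂ} (hf : IsHolderOn S f) :
    ContinuousOn f S := by
  obtain ⟨C, γ, hC, hγ, h⟩ := hf
  intro x hx
  rw [ContinuousWithinAt, tendsto_iff_norm_sub_tendsto_zero]
  have h1 : Tendsto (fun y : ℝ => C * |y - x| ^ γ) (𝓝[S] x) (𝓝 (C * |x - x| ^ γ)) := by
    have : Continuous fun y : ℝ => C * |y - x| ^ γ :=
      continuous_const.mul ((by fun_prop : Continuous fun y : ℝ => |y - x|).rpow_const
        fun _ => Or.inr hγ.le)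
    exact (this.tendsto x).mono_left nhdsWithin_le_nhds
  rw [sub_self, abs_zero, Real.zero_rpow hγ.ne', mul_zero] at h1
  refine squeeze_zero' (Eventually.of_forall fun _ => norm_nonneg _) ?_ h1
  filter_upwards [self_mem_nhdsWithin] with y hy using h y hy x hx

lemma isHolderOn_const (S : Set ℝ) (c : ℂ) : IsHolderOn S fun _ => c :=
  ⟨0, 1, le_rfl, one_pos, fun x _ y _ => by simp⟩

lemma isHolderOn_of_lipschitz {S : Set ℝ} {f : ℝ → ℂ} {K : ℝ} (hK : 0 ≤ K)
    (h : ∀ x ∈ S, ∀ y ∈ S, ‖f x - f y‖ ≤ K * |x - y|) : IsHolderOn S f :=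
  ⟨K, 1, hK, one_pos, fun x hx y hy => by simpa using h x hx y hy⟩

lemma rpow_le_mul_rpow_of_le {x D γ γ' : ℝ} (hx : 0 ≤ x) (hxD : x ≤ D) (hγ : 0 ≤ γ)
    (h : γ ≤ γ') : x ^ γ' ≤ D ^ (γ' - γ) * x ^ γ := by
  have : x ^ γ' = x ^ (γ' - γ) * x ^ γ := by
    rw [← Real.rpow_add_of_nonneg hx (by linarith) hγ]
    congr 1
    ring
  rw [this]
  exact mul_le_mul_of_nonneg_right (Real.rpow_le_rpow hx hxD (by linarith)) (by positivity)

/-- On a bounded set the index of a Hölder condition may be lowered. -/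
lemma exists_holder_lower {S : Set ℝ} {f : ℝ → ℂ} {D : ℝ}
    (hS : ∀ x ∈ S, ∀ y ∈ S, |x - y| ≤ D) {C γ' γ : ℝ} (hC : 0 ≤ C) (hγ : 0 < γ) (hle : γ ≤ γ')
    (h : ∀ x ∈ S, ∀ y ∈ S, ‖f x - f y‖ ≤ C * |x - y| ^ γ') :
    ∀ x ∈ S, ∀ y ∈ S, ‖f x - f y‖ ≤ (C * D ^ (γ' - γ)) * |x - y| ^ γ := by
  intro x hx y hy
  rw [mul_assoc]
  exact (h x hx y hy).trans (mul_le_mul_of_nonneg_left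
    (rpow_le_mul_rpow_of_le (abs_nonneg _) (hS x hx y hy) hγ.le hle) hC)

lemma abs_sub_le_of_mem_uIcc {a b x y : ℝ} (hx : x ∈ Set.uIcc a b) (hy : y ∈ Set.uIcc a b) :
    |x - y| ≤ |b - a| := by
  rw [abs_sub_comm x y]
  exact Set.abs_sub_le_of_uIcc_subset_uIcc (Set.uIcc_subset_uIcc hx hy)

lemma IsHolderOn.exists_norm_le {a b : ℝ} {f : ℝ → ℂ} (hf : IsHolderOn (Set.uIcc a b) f) :
    ∃ M, 0 ≤ M ∧ ∀ x ∈ Set.uIcc a b, ‖f x‖ ≤ M := by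
  obtain ⟨M, hM⟩ := isCompact_uIcc.exists_bound_of_continuousOn hf.continuousOn
  exact ⟨M, (norm_nonneg _).trans (hM a Set.left_mem_uIcc), hM⟩

lemma IsHolderOn.mul {a b : ℝ} {f g : ℝ → ℂ} (hf : IsHolderOn (Set.uIcc a b) f)
    (hg : IsHolderOn (Set.uIcc a b) g) : IsHolderOn (Set.uIcc a b) fun x => f x * g x := by
  obtain ⟨M, hM0, hM⟩ := hf.exists_norm_le
  obtain ⟨N, hN0, hN⟩ := hg.exists_norm_le
  obtain ⟨C, γ, hC, hγ, hf⟩ := hf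
  obtain ⟨C', γ', hC', hγ', hg⟩ := hg
  have hD : ∀ x ∈ Set.uIcc a b, ∀ y ∈ Set.uIcc a b, |x - y| ≤ |b - a| :=
    fun x hx y hy => abs_sub_le_of_mem_uIcc hx hy
  have hmin : 0 < min γ γ' := lt_min hγ hγ'
  have hf' := exists_holder_lower hD hC hmin (min_le_left _ _) hf
  have hg' := exists_holder_lower hD hC' hmin (min_le_right _ _) hg
  refine ⟨(C * |b - a| ^ (γ - min γ γ')) * N + M * (C' * |b - a| ^ (γ' - min γ γ')),
    min γ γ', by positivity, hmin, fun x hx y hy => ?_⟩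
  calc ‖f x * g x - f y * g y‖ = ‖(f x - f y) * g x + f y * (g x - g y)‖ := by ring_nf
    _ ≤ ‖f x - f y‖ * ‖g x‖ + ‖f y‖ * ‖g x - g y‖ := by
        refine (norm_add_le _ _).trans ?_
        rw [norm_mul, norm_mul]
    _ ≤ (C * |b - a| ^ (γ - min γ γ') * |x - y| ^ min γ γ') * N +
        M * (C' * |b - a| ^ (γ' - min γ γ') * |x - y| ^ min γ γ') :=
        add_le_add
          (mul_le_mul (hf' x hx y hy) (hN x hx) (norm_nonneg _) (by positivity))
          (mul_le_mul (hM y hy) (hg' x hx y hy) (norm_nonneg _) hM0)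
    _ = _ := by ring

lemma IsHolderOn.comp {S T : Set ℝ} {f : ℝ → ℂ} (hf : IsHolderOn T f) {g : ℝ → ℝ} {K : ℝ}
    (hK : 0 ≤ K) (hgS : ∀ x ∈ S, g x ∈ T)
    (hg : ∀ x ∈ S, ∀ y ∈ S, |g x - g y| ≤ K * |x - y|) : IsHolderOn S fun x => f (g x) := by
  obtain ⟨C, γ, hC, hγ, hf⟩ := hf
  refine ⟨C * K ^ γ, γ, by positivity, hγ, fun x hx y hy => ?_⟩
  refine (hf _ (hgS x hx) _ (hgS y hy)).trans ?_
  rw [mul_assoc, ← Real.mul_rpow hK (abs_nonneg _)]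
  exact mul_le_mul_of_nonneg_left (Real.rpow_le_rpow (abs_nonneg _) (hg x hx y hy) hγ.le) hC

lemma abs_sqrt_sub_sqrt_le {x y : ℝ} (hx : 0 ≤ x) (hy : 0 ≤ y) : |√x - √y| ≤ √|x - y| := by
  wlog h : y ≤ x generalizing x y
  · rw [abs_sub_comm, abs_sub_comm x y]
    exact this hy hx (le_of_not_ge h)
  rw [abs_of_nonneg (sub_nonneg.2 (Real.sqrt_le_sqrt h)), abs_of_nonneg (sub_nonneg.2 h)]
  apply Real.le_sqrt_of_sq_le
  have h1 := Real.sq_sqrt hx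
  have h2 := Real.sq_sqrt hy
  have h3 := Real.sqrt_le_sqrt h
  nlinarith [Real.sqrt_nonneg y]

lemma isHolderOn_sqrt_abs (S : Set ℝ) (a : ℝ) : IsHolderOn S fun σ => ((√|σ - a| : ℝ) : ℂ) := by
  refine ⟨1, 1 / 2, zero_le_one, by norm_num, fun x _ y _ => ?_⟩
  rw [← Complex.ofReal_sub, Complex.norm_real, Real.norm_eq_abs, one_mul, ← Real.sqrt_eq_rpow]
  refine (abs_sqrt_sub_sqrt_le (abs_nonneg _) (abs_nonneg _)).trans (Real.sqrt_le_sqrt ?_)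
  simpa using abs_abs_sub_abs_le_abs_sub (x - a) (y - a)

/-- The extension by zero of a Hölder function on an interval that vanishes at the end points is a
Hölder function, since it is the composition with the projection onto the interval. -/
lemma isHolderLine_indicator {a b : ℝ} {f : ℝ → ℂ} (hf : IsHolderOn (Set.uIcc a b) f)
    (ha : f a = 0) (hb : f b = 0) : IsHolderLine ((Set.uIcc a b).indicator f) := by
  have hle : min a b ≤ max a b := min_le_max
  have hend : f (min a b) = 0 ∧ f (max a b) = 0 := by
    rcases le_total a b with h | h <;> simp [h, ha, hb]
  have hproj : ∀ x, (Set.uIcc a b).indicator f x = f (Set.projIcc (min a b) (max a b) hle x) := by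
    intro x
    by_cases hx : x ∈ Set.uIcc a b
    · rw [Set.indicator_of_mem hx, Set.projIcc_of_mem hle hx]
    · rw [Set.indicator_of_notMem hx]
      rcases lt_or_ge x (min a b) with h | h
      · rw [Set.projIcc_of_le_left hle h.le, hend.1]
      · have h' : max a b ≤ x := by
          by_contra hcon
          exact hx ⟨h, (not_le.1 hcon).le⟩
        rw [Set.projIcc_of_right_le hle h', hend.2]
  obtain ⟨C, γ, hC, hγ, hf⟩ := hf
  refine ⟨C, γ, hC, hγ, fun x y => ?_⟩
  rw [hproj, hproj]
  refine (hf _ (Subtype.prop _) _ (Subtype.prop _)).trans ?_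
  exact mul_le_mul_of_nonneg_left
    (Real.rpow_le_rpow (abs_nonneg _) (Set.abs_projIcc_sub_projIcc hle) hγ.le) hC

/-! ### Cauchy integrals over compact sets -/

/-- The complex plane without a set of real points. -/
def offCut (S : Set ℝ) : Set ℂ := ((fun σ : ℝ => (σ : ℂ)) '' S)ᶜ

/-- The Cauchy integral of `d` over `S`. -/
noncomputable def cauchyInt (S : Set ℝ) (d : ℝ → ℂ) (τ : ℂ) : ℂ := ∫ t in S, d t / ((t : ℂ) - τ)

lemma isOpen_offCut {S : Set ℝ} (hS : IsCompact S) : IsOpen (offCut S) :=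
  (hS.image Complex.continuous_ofReal).isClosed.isOpen_compl

lemma offReal_subset_offCut (S : Set ℝ) : offReal ⊆ offCut S := by
  rintro τ hτ ⟨σ, -, rfl⟩
  exact hτ (by simp)

lemma ofReal_mem_offCut {S : Set ℝ} {σ : ℝ} : (σ : ℂ) ∈ offCut S ↔ σ ∉ S := by
  simp [offCut]

lemma exists_le_norm_sub {S : Set ℝ} (hS : IsCompact S) {τ : ℂ} (hτ : τ ∈ offCut S) :
    ∃ δ > 0, ∀ z, dist z τ < δ → ∀ t ∈ S, δ ≤ ‖(t : ℂ) - z‖ := by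
  obtain ⟨δ, hδ, h⟩ := Metric.isOpen_iff.1 (isOpen_offCut hS) τ hτ
  refine ⟨δ / 2, half_pos hδ, fun z hz t ht => ?_⟩
  by_contra hcon
  rw [not_le] at hcon
  have h1 : dist (t : ℂ) τ < δ := by
    have := dist_triangle (t : ℂ) z τ
    rw [dist_eq_norm (t : ℂ) z] at this
    linarith
  exact h (Metric.mem_ball.2 h1) ⟨t, ht, rfl⟩

lemma aestronglyMeasurable_div {μ : Measure ℝ} {d g : ℝ → ℂ} (hd : AEStronglyMeasurable d μ)
    (hg : Measurable g) : AEStronglyMeasurable (fun t => d t / g t) μ := by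
  simp only [div_eq_mul_inv]
  exact hd.mul hg.inv.aestronglyMeasurable

lemma integrableOn_cauchy {S : Set ℝ} (hS : IsCompact S) {d : ℝ → ℂ} (hd : IntegrableOn d S)
    {τ : ℂ} (hτ : τ ∈ offCut S) : IntegrableOn (fun t : ℝ => d t / ((t : ℂ) - τ)) S := by
  obtain ⟨δ, hδ, h⟩ := exists_le_norm_sub hS hτ
  refine Integrable.mono' (hd.norm.div_const δ) ?_ ?_
  · exact aestronglyMeasurable_div hd.1 (by fun_prop)
  · filter_upwards [ae_restrict_mem hS.measurableSet] with t ht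
    rw [norm_div]
    exact div_le_div_of_nonneg_left (norm_nonneg _) hδ (h τ (by simpa using hδ) t ht)

lemma differentiableOn_cauchyInt {S : Set ℝ} (hS : IsCompact S) {d : ℝ → ℂ}
    (hd : IntegrableOn d S) : DifferentiableOn ℂ (cauchyInt S d) (offCut S) := by
  intro τ hτ
  obtain ⟨δ, hδ, h⟩ := exists_le_norm_sub hS hτ
  have hne : ∀ z, dist z τ < δ → ∀ t ∈ S, (t : ℂ) - z ≠ 0 := fun z hz t ht =>
    norm_pos_iff.1 (hδ.trans_le (h z hz t ht))
  have hm : ∀ z : ℂ, AEStronglyMeasurable (fun t : ℝ => d t / ((t : ℂ) - z))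
      (volume.restrict S) := fun z =>
    aestronglyMeasurable_div hd.1 (by fun_prop)
  have := hasDerivAt_integral_of_dominated_loc_of_deriv_le (μ := volume.restrict S)
    (F := fun (z : ℂ) (t : ℝ) => d t / ((t : ℂ) - z))
    (F' := fun (z : ℂ) (t : ℝ) => d t / ((t : ℂ) - z) ^ 2)
    (bound := fun t => ‖d t‖ / δ ^ 2) (s := Metric.ball τ δ) (x₀ := τ)
    (Metric.ball_mem_nhds _ hδ) (Eventually.of_forall hm) (integrableOn_cauchy hS hd hτ)
    (aestronglyMeasurable_div hd.1 (by fun_prop))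
    ?_ (hd.norm.div_const _) ?_
  · exact this.2.differentiableAt.differentiableWithinAt
  · filter_upwards [ae_restrict_mem hS.measurableSet] with t ht z hz
    rw [norm_div, norm_pow]
    exact div_le_div_of_nonneg_left (norm_nonneg _) (by positivity)
      (pow_le_pow_left₀ hδ.le (h z hz t ht) 2)
  · filter_upwards [ae_restrict_mem hS.measurableSet] with t ht z hz
    have hne' := hne z hz t ht
    have h1 : HasDerivAt (fun z : ℂ => (t : ℂ) - z) (-1) z := (hasDerivAt_id z).const_sub _
    have h2 := (hasDerivAt_const z (d t)).div h1 hne'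
    convert! h2 using 1
    ring

lemma tendsto_cauchyInt_cocompact {S : Set ℝ} (hS : IsCompact S) {d : ℝ → ℂ}
    (hd : IntegrableOn d S) : Tendsto (cauchyInt S d) (cocompact ℂ) (𝓝 0) := by
  obtain ⟨R, hR⟩ := hS.isBounded.exists_norm_le
  have hnorm := tendsto_norm_cocompact_atTop (E := ℂ)
  have h1 : Tendsto (fun τ : ℂ => (‖τ‖ - R)⁻¹ * ∫ t in S, ‖d t‖) (cocompact ℂ) (𝓝 0) := by
    have h2 : Tendsto (fun τ : ℂ => (‖τ‖ - R)⁻¹) (cocompact ℂ) (𝓝 0) :=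
      tendsto_inv_atTop_zero.comp (tendsto_atTop_add_const_right _ (-R) hnorm)
    simpa using h2.mul_const (∫ t in S, ‖d t‖)
  refine squeeze_zero_norm' ?_ h1
  filter_upwards [hnorm.eventually (eventually_gt_atTop R)] with τ hτ
  rw [cauchyInt, ← integral_const_mul]
  refine norm_integral_le_of_norm_le (hd.norm.const_mul _) ?_
  filter_upwards [ae_restrict_mem hS.measurableSet] with t ht
  have h3 : ‖τ‖ - R ≤ ‖(t : ℂ) - τ‖ := by
    have h4 := norm_sub_norm_le τ (t : ℂ)
    have h5 := hR t ht
    rw [norm_sub_rev, Complex.norm_real] at h4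
    linarith
  rw [norm_div, div_eq_inv_mul]
  exact mul_le_mul_of_nonneg_right (inv_anti₀ (by linarith) h3) (norm_nonneg _)

/-- The integral over the complement of a small ball tends to the integral. -/
lemma tendsto_setIntegral_diff_ball {S : Set ℝ} {f : ℝ → ℂ}
    (hf : IntegrableOn f S) (σ : ℝ) :
    Tendsto (fun ε : ℝ => ∫ t in S \ Metric.ball σ ε, f t) (𝓝[>] 0) (𝓝 (∫ t in S, f t)) := by
  have h : ∀ ε : ℝ, ∫ t in S \ Metric.ball σ ε, f t =
      ∫ t in S, (Metric.ball σ ε)ᶜ.indicator f t := by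
    intro ε
    rw [setIntegral_indicator Metric.isOpen_ball.measurableSet.compl]
    rfl
  simp only [h]
  refine tendsto_integral_filter_of_dominated_convergence (fun t => ‖f t‖) ?_ ?_ hf.norm ?_
  · exact Eventually.of_forall fun ε => hf.1.indicator Metric.isOpen_ball.measurableSet.compl
  · exact Eventually.of_forall fun ε => Eventually.of_forall fun t => norm_indicator_le_norm_self _ _
  · have h0 : ∀ᵐ t ∂(volume.restrict S), t ≠ σ :=
      ae_restrict_of_ae (compl_mem_ae_iff.2 (measure_singleton σ))
    filter_upwards [h0] with t ht
    refine tendsto_const_nhds.congr' ?_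
    filter_upwards [nhdsWithin_le_nhds (Iio_mem_nhds (dist_pos.2 ht))] with ε hε
    rw [Set.indicator_of_mem]
    simpa using le_of_lt hε

/-! ### Plemelj's formulas on an interval -/

/-- Plemelj's formulas at `σ` for the Cauchy integral of `d` over `S`: the principal value at `σ`
is `L`, and the limits from above and below are `L ± πi c`. Here `c` stands for the value of the
density at `σ`, taken as `0` if `σ` does not belong to `S`. -/
structure PlemeljAt (S : Set ℝ) (d : ℝ → ℂ) (σ : ℝ) (c L : ℂ) : Prop where
  above : Tendsto (cauchyInt S d) (𝓝[{z : ℂ | 0 < z.im}] (σ : ℂ)) (𝓝 (L + Real.pi * Complex.I * c))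
  below : Tendsto (cauchyInt S d) (𝓝[{z : ℂ | z.im < 0}] (σ : ℂ)) (𝓝 (L - Real.pi * Complex.I * c))
  pv : HasPVIntegral S σ (fun t : ℝ => d t / ((t : ℂ) - σ)) L

lemma integrableOn_div_diff_ball {S : Set ℝ} (hS : MeasurableSet S) {d : ℝ → ℂ}
    (hd : IntegrableOn d S) (σ : ℝ) {ε : ℝ} (hε : 0 < ε) :
    IntegrableOn (fun t : ℝ => d t / ((t : ℂ) - σ)) (S \ Metric.ball σ ε) := by
  have hd' : IntegrableOn d (S \ Metric.ball σ ε) := hd.mono_set Set.sdiff_subset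
  refine Integrable.mono' (hd'.norm.div_const ε) (aestronglyMeasurable_div hd'.1 (by fun_prop)) ?_
  filter_upwards [ae_restrict_mem (hS.diff Metric.isOpen_ball.measurableSet)] with t ht
  rw [norm_div, ← Complex.ofReal_sub, Complex.norm_real, ← dist_eq_norm]
  exact div_le_div_of_nonneg_left (norm_nonneg _) hε (not_lt.1 ht.2)

lemma plemeljAt_of_notMem {S : Set ℝ} (hS : IsCompact S) {d : ℝ → ℂ} (hd : IntegrableOn d S)
    {σ : ℝ} (hσ : σ ∉ S) : PlemeljAt S d σ 0 (cauchyInt S d σ) := by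
  have hσ' : (σ : ℂ) ∈ offCut S := ofReal_mem_offCut.2 hσ
  have hc : Tendsto (cauchyInt S d) (𝓝 (σ : ℂ)) (𝓝 (cauchyInt S d σ)) :=
    (differentiableOn_cauchyInt hS hd).continuousOn.continuousAt
      ((isOpen_offCut hS).mem_nhds hσ')
  refine ⟨?_, ?_, fun ε hε => integrableOn_div_diff_ball hS.measurableSet hd σ hε,
    tendsto_setIntegral_diff_ball (integrableOn_cauchy hS hd hσ') σ⟩
  · simpa using hc.mono_left nhdsWithin_le_nhds
  · simpa using hc.mono_left nhdsWithin_le_nhds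

lemma cauchyInt_union {S T : Set ℝ} (hS : IsCompact S) (hT : IsCompact T) (hST : Disjoint S T)
    {d : ℝ → ℂ} (hdS : IntegrableOn d S) (hdT : IntegrableOn d T) {τ : ℂ}
    (hτ : τ ∈ offCut (S ∪ T)) : cauchyInt (S ∪ T) d τ = cauchyInt S d τ + cauchyInt T d τ := by
  have h : τ ∈ offCut S ∧ τ ∈ offCut T := by
    simpa [offCut, Set.image_union, not_or] using hτ
  exact setIntegral_union hST hT.measurableSet (integrableOn_cauchy hS hdS h.1)
    (integrableOn_cauchy hT hdT h.2)

lemma PlemeljAt.union {S T : Set ℝ} (hS : IsCompact S) (hT : IsCompact T) (hST : Disjoint S T)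
    {d : ℝ → ℂ} (hdS : IntegrableOn d S) (hdT : IntegrableOn d T) {σ : ℝ} {c c' L L' : ℂ}
    (h : PlemeljAt S d σ c L) (h' : PlemeljAt T d σ c' L') :
    PlemeljAt (S ∪ T) d σ (c + c') (L + L') := by
  have hoff : ∀ τ ∈ offReal, cauchyInt (S ∪ T) d τ = cauchyInt S d τ + cauchyInt T d τ :=
    fun τ hτ => cauchyInt_union hS hT hST hdS hdT (offReal_subset_offCut _ hτ)
  refine ⟨?_, ?_, fun ε hε => ?_, ?_⟩
  · rw [show L + L' + Real.pi * Complex.I * (c + c') =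
      (L + Real.pi * Complex.I * c) + (L' + Real.pi * Complex.I * c') by ring]
    refine (h.above.add h'.above).congr' ?_
    filter_upwards [self_mem_nhdsWithin] with τ hτ
    exact (hoff τ (ne_of_gt hτ)).symm
  · rw [show L + L' - Real.pi * Complex.I * (c + c') =
      (L - Real.pi * Complex.I * c) + (L' - Real.pi * Complex.I * c') by ring]
    refine (h.below.add h'.below).congr' ?_
    filter_upwards [self_mem_nhdsWithin] with τ hτ
    exact (hoff τ (ne_of_lt hτ)).symm
  · rw [Set.union_sdiff_distrib]
    exact (h.pv.1 ε hε).union (h'.pv.1 ε hε)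
  · refine (h.pv.2.add h'.pv.2).congr' ?_
    filter_upwards [self_mem_nhdsWithin] with ε hε
    rw [Set.union_sdiff_distrib, setIntegral_union (hST.mono Set.sdiff_subset Set.sdiff_subset)
      (hT.measurableSet.diff Metric.isOpen_ball.measurableSet) (h.pv.1 ε hε) (h'.pv.1 ε hε)]

/-- The density `m(t) / |t - a|^{1/2}`, with the singularity of the densities at the base point. -/
noncomputable def endDensity (a : ℝ) (m : ℝ → ℂ) (t : ℝ) : ℂ := m t / ((√|t - a| : ℝ) : ℂ)

lemma integrableOn_endDensity {a b : ℝ} {m : ℝ → ℂ} (hm : IsHolderOn (Set.uIcc a b) m) :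
    IntegrableOn (endDensity a m) (Set.uIcc a b) := by
  obtain ⟨M, hM0, hM⟩ := hm.exists_norm_le
  set R := |b - a| with hR
  have h1 : IntegrableOn (fun t : ℝ => |t - a| ^ (-(1 / 2) : ℝ)) (Set.uIcc a b) := by
    have h2 := (intervalIntegrable_abs_rpow (p := -(1 / 2)) (by norm_num) R).comp_sub_right a
    rw [intervalIntegrable_iff_integrableOn_Icc_of_le
      (by linarith [abs_nonneg (b - a)])] at h2
    refine h2.mono_set fun t ht => ?_
    have h3 := abs_sub_le_of_mem_uIcc ht Set.left_mem_uIcc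
    rw [abs_le] at h3
    constructor <;> linarith [h3.1, h3.2]
  refine Integrable.mono' (h1.const_mul M) ?_ ?_
  · exact aestronglyMeasurable_div (hm.continuousOn.aestronglyMeasurable measurableSet_uIcc)
      (by fun_prop)
  · filter_upwards [ae_restrict_mem measurableSet_uIcc] with t ht
    rw [endDensity, norm_div, Complex.norm_real, Real.norm_eq_abs, abs_of_nonneg (Real.sqrt_nonneg _),
      Real.rpow_neg (abs_nonneg _), ← Real.sqrt_eq_rpow, ← div_eq_mul_inv]
    exact div_le_div_of_nonneg_right (hM t ht) (Real.sqrt_nonneg _)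

lemma exists_sign {a b : ℝ} (hab : a ≠ b) :
    ∃ s : ℝ, (s = 1 ∨ s = -1) ∧ ∀ t ∈ Set.uIcc a b, t - a = s * |t - a| := by
  rcases lt_or_gt_of_ne hab with h | h
  · refine ⟨1, Or.inl rfl, fun t ht => ?_⟩
    rw [Set.uIcc_of_le h.le] at ht
    rw [abs_of_nonneg (by linarith [ht.1]), one_mul]
  · refine ⟨-1, Or.inr rfl, fun t ht => ?_⟩
    rw [Set.uIcc_of_ge h.le] at ht
    rw [abs_of_nonpos (by linarith [ht.2])]
    ring

/-- The factor `t - a` removes the singularity of the density at `a`, and the density vanishes at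
`b`, so that the extension by zero to the line is a Hölder function. -/
lemma isHolderLine_regularized {a b : ℝ} (hab : a ≠ b) {m : ℝ → ℂ}
    (hm : IsHolderOn (Set.uIcc a b) m) (hmb : m b = 0) :
    IsHolderLine ((Set.uIcc a b).indicator fun t => ((t : ℂ) - a) * endDensity a m t) := by
  obtain ⟨s, -, hs⟩ := exists_sign hab
  refine isHolderLine_indicator ?_ (by simp) (by simp [endDensity, hmb])
  have h := ((isHolderOn_const (Set.uIcc a b) (s : ℂ)).mul
    (isHolderOn_sqrt_abs (Set.uIcc a b) a)).mul hm
  refine h.congr fun t ht => ?_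
  rcases eq_or_ne t a with rfl | hta
  · simp [endDensity]
  have hpos : 0 < |t - a| := abs_pos.2 (sub_ne_zero.2 hta)
  have h1 : ((t : ℂ) - a) = s * (((√|t - a| : ℝ) : ℂ) * ((√|t - a| : ℝ) : ℂ)) := by
    rw [← Complex.ofReal_mul, Real.mul_self_sqrt hpos.le, ← Complex.ofReal_mul, ← hs t ht]
    push_cast
    ring
  have h2 : ((√|t - a| : ℝ) : ℂ) ≠ 0 := by
    exact_mod_cast (Real.sqrt_pos.2 hpos).ne'
  rw [h1, endDensity]
  field_simp

/-- Multiplication by `τ - a` turns the Cauchy integral into that of a Hölder function of compact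
support. -/
lemma sub_mul_cauchyInt {a b : ℝ} {m : ℝ → ℂ} (hm : IsHolderOn (Set.uIcc a b) m) {τ : ℂ}
    (hτ : τ ∈ offCut (Set.uIcc a b)) :
    (τ - a) * cauchyInt (Set.uIcc a b) (endDensity a m) τ =
      (∫ t : ℝ, (Set.uIcc a b).indicator (fun t => ((t : ℂ) - a) * endDensity a m t) t /
        ((t : ℂ) - τ)) - ∫ t in Set.uIcc a b, endDensity a m t := by
  have hd := integrableOn_endDensity hm
  have h1 : ∀ t : ℝ, (Set.uIcc a b).indicator (fun t => ((t : ℂ) - a) * endDensity a m t) t /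
      ((t : ℂ) - τ) = (Set.uIcc a b).indicator
        (fun t => ((t : ℂ) - a) * endDensity a m t / ((t : ℂ) - τ)) t := by
    intro t
    by_cases ht : t ∈ Set.uIcc a b
    · simp only [Set.indicator_of_mem ht]
    · simp only [Set.indicator_of_notMem ht, zero_div]
  simp only [h1]
  rw [integral_indicator measurableSet_uIcc, eq_sub_iff_add_eq, cauchyInt,
    ← integral_const_mul, ← integral_add ((integrableOn_cauchy isCompact_uIcc hd hτ).const_mul _) hd]
  refine setIntegral_congr_fun measurableSet_uIcc fun t ht => ?_
  have hne : (t : ℂ) - τ ≠ 0 := by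
    intro h
    exact hτ ⟨t, ht, sub_eq_zero.1 h⟩
  field_simp
  ring

lemma indicator_uIcc_support {a b : ℝ} (f : ℝ → ℂ) :
    ∀ t, |a| + |b| < |t| → (Set.uIcc a b).indicator f t = 0 := by
  intro t ht
  refine Set.indicator_of_notMem (fun h => ?_) _
  have h1 := abs_sub_le_of_mem_uIcc h Set.left_mem_uIcc
  rcases le_total a b with hab | hab
  · rw [Set.uIcc_of_le hab] at h
    rcases abs_cases t with ⟨h2, -⟩ | ⟨h2, -⟩
    · linarith [h.2, le_abs_self b, abs_nonneg a]
    · linarith [h.1, neg_abs_le a, abs_nonneg b]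
  · rw [Set.uIcc_of_ge hab] at h
    rcases abs_cases t with ⟨h2, -⟩ | ⟨h2, -⟩
    · linarith [h.2, le_abs_self a, abs_nonneg b]
    · linarith [h.1, neg_abs_le b, abs_nonneg a]

/-- Plemelj's formulas inside the interval, from those on the line for the density multiplied by
`t - a`. -/
lemma plemeljAt_endDensity {a b : ℝ} {m : ℝ → ℂ}
    (hm : IsHolderOn (Set.uIcc a b) m) (hmb : m b = 0) {σ : ℝ} (hσ : σ ∈ Set.uIoo a b) :
    ∃ L, PlemeljAt (Set.uIcc a b) (endDensity a m) σ (endDensity a m σ) L := by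
  have hab : a ≠ b := by
    rintro rfl
    simp at hσ
  have hσ' : σ ∈ Set.uIcc a b := Set.uIoo_subset_uIcc_self hσ
  have hσa : σ ≠ a := by
    rintro rfl
    simp at hσ
  have hσa' : (σ : ℂ) - a ≠ 0 := by
    rw [← Complex.ofReal_sub]
    exact_mod_cast sub_ne_zero.2 hσa
  have hd := integrableOn_endDensity hm
  obtain ⟨L, h1, h2, h3⟩ := plemelj (isHolderLine_regularized hab hm hmb)
    (indicator_uIcc_support _) σ
  rw [Set.indicator_of_mem hσ'] at h1 h2
  set I₀ := ∫ t in Set.uIcc a b, endDensity a m t with hI₀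
  have hsub : ∀ s : Set ℂ, Tendsto (fun τ : ℂ => τ - a) (𝓝[s] (σ : ℂ)) (𝓝 ((σ : ℂ) - a)) :=
    fun s => ((by fun_prop : Continuous fun τ : ℂ => τ - (a : ℂ)).tendsto _).mono_left
      nhdsWithin_le_nhds
  have hform : ∀ τ ∈ offReal,
      ((∫ t : ℝ, (Set.uIcc a b).indicator (fun t => ((t : ℂ) - a) * endDensity a m t) t /
        ((t : ℂ) - τ)) - I₀) / (τ - a) = cauchyInt (Set.uIcc a b) (endDensity a m) τ := by
    intro τ hτ
    have hne : τ - a ≠ 0 := by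
      intro h
      rw [sub_eq_zero] at h
      exact hτ (by simp [h])
    rw [← sub_mul_cauchyInt hm (offReal_subset_offCut _ hτ), mul_div_cancel_left₀ _ hne]
  refine ⟨(L - I₀) / ((σ : ℂ) - a), ?_, ?_,
    fun ε hε => integrableOn_div_diff_ball measurableSet_uIcc hd σ hε, ?_⟩
  · have h4 := (h1.sub_const I₀).div (hsub _) hσa'
    rw [show (L + Real.pi * Complex.I * (((σ : ℂ) - a) * endDensity a m σ) - I₀) / ((σ : ℂ) - a) =
      (L - I₀) / ((σ : ℂ) - a) + Real.pi * Complex.I * endDensity a m σ by field_simp; ring] at h4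
    refine h4.congr' ?_
    filter_upwards [self_mem_nhdsWithin] with τ hτ using hform τ (ne_of_gt hτ)
  · have h4 := (h2.sub_const I₀).div (hsub _) hσa'
    rw [show (L - Real.pi * Complex.I * (((σ : ℂ) - a) * endDensity a m σ) - I₀) / ((σ : ℂ) - a) =
      (L - I₀) / ((σ : ℂ) - a) - Real.pi * Complex.I * endDensity a m σ by field_simp; ring] at h4
    refine h4.congr' ?_
    filter_upwards [self_mem_nhdsWithin] with τ hτ using hform τ (ne_of_lt hτ)
  · have h4 := (h3.sub (tendsto_setIntegral_diff_ball hd σ)).div_const ((σ : ℂ) - a)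
    refine h4.congr' ?_
    filter_upwards [self_mem_nhdsWithin] with ε hε
    have hε' : 0 < ε := hε
    have h5 : ∫ t in (Metric.ball σ ε)ᶜ,
        (Set.uIcc a b).indicator (fun t => ((t : ℂ) - a) * endDensity a m t) t / ((t : ℂ) - σ) =
        ∫ t in Set.uIcc a b \ Metric.ball σ ε,
          ((t : ℂ) - a) * endDensity a m t / ((t : ℂ) - σ) := by
      rw [Set.sdiff_eq, Set.inter_comm, ← setIntegral_indicator measurableSet_uIcc]
      refine integral_congr_ae (Eventually.of_forall fun t => ?_)
      by_cases ht : t ∈ Set.uIcc a b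
      · simp only [Set.indicator_of_mem ht]
      · simp only [Set.indicator_of_notMem ht, zero_div]
    have hi := integrableOn_div_diff_ball measurableSet_uIcc hd σ hε'
    rw [h5, div_eq_iff hσa', mul_comm, ← integral_const_mul, sub_eq_iff_eq_add,
      ← integral_add (hi.const_mul _) (hd.mono_set Set.sdiff_subset)]
    refine setIntegral_congr_fun (measurableSet_uIcc.diff Metric.isOpen_ball.measurableSet)
      fun t ht => ?_
    have hne : (t : ℂ) - σ ≠ 0 := by
      rw [← Complex.ofReal_sub]
      exact_mod_cast sub_ne_zero.2 fun h : t = σ =>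
        ht.2 (by rw [h]; exact Metric.mem_ball_self hε')
    field_simp
    ring

lemma nhdsWithin_offReal_eq (c : ℂ) :
    𝓝[offReal] c = 𝓝[{z : ℂ | 0 < z.im}] c ⊔ 𝓝[{z : ℂ | z.im < 0}] c := by
  rw [← nhdsWithin_union]
  congr 1
  ext z
  exact ⟨fun h => (lt_or_gt_of_ne h).symm, fun h => h.elim (fun h => ne_of_gt h) fun h => ne_of_lt h⟩

lemma eventually_norm_le_of_tendsto {l : Filter ℂ} {f : ℂ → ℂ} {L : ℂ} (h : Tendsto f l (𝓝 L)) :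
    ∀ᶠ τ in l, ‖f τ‖ ≤ ‖L‖ + 1 := by
  filter_upwards [h.norm.eventually (gt_mem_nhds (lt_add_one ‖L‖))] with τ hτ using le_of_lt hτ

/-- A bound near a real point off the real line extends to the complement of the cut. -/
lemma eventually_norm_le_offCut {S : Set ℝ} (hS : IsCompact S) {f : ℂ → ℂ}
    (hf : ContinuousOn f (offCut S)) {c : ℂ} {C : ℝ} (h : ∀ᶠ τ in 𝓝[offReal] c, ‖f τ‖ ≤ C) :
    ∀ᶠ τ in 𝓝 c, τ ∈ offCut S → ‖f τ‖ ≤ C := by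
  obtain ⟨U, hU, hcU, h⟩ := mem_nhdsWithin.1 h
  filter_upwards [hU.mem_nhds hcU] with τ hτ hτS
  exact norm_le_of_norm_le_offReal (isOpen_offCut hS) hU hf (fun τ hτ => h hτ) τ ⟨hτ, hτS⟩

/-- The Cauchy integral is bounded at the end point where the density vanishes. -/
lemma cauchyInt_endDensity_bounded_tip {a b : ℝ} (hab : a ≠ b) {m : ℝ → ℂ}
    (hm : IsHolderOn (Set.uIcc a b) m) (hmb : m b = 0) :
    ∃ C, ∀ᶠ τ in 𝓝 (b : ℂ), τ ∈ offCut (Set.uIcc a b) →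
      ‖cauchyInt (Set.uIcc a b) (endDensity a m) τ‖ ≤ C := by
  have hba : (b : ℂ) - a ≠ 0 := by
    rw [← Complex.ofReal_sub]
    exact_mod_cast sub_ne_zero.2 hab.symm
  obtain ⟨L, h1, h2, -⟩ := plemelj (isHolderLine_regularized hab hm hmb)
    (indicator_uIcc_support _) b
  set I₀ := ∫ t in Set.uIcc a b, endDensity a m t with hI₀
  have hb0 : (Set.uIcc a b).indicator (fun t => ((t : ℂ) - a) * endDensity a m t) b = 0 := by
    simp [endDensity, hmb]
  rw [hb0, mul_zero, add_zero] at h1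
  rw [hb0, mul_zero, sub_zero] at h2
  have h3 := h1.sup h2
  rw [← nhdsWithin_offReal_eq] at h3
  have hsub : Tendsto (fun τ : ℂ => τ - a) (𝓝[offReal] (b : ℂ)) (𝓝 ((b : ℂ) - a)) :=
    ((by fun_prop : Continuous fun τ : ℂ => τ - (a : ℂ)).tendsto _).mono_left nhdsWithin_le_nhds
  have h4 := (h3.sub_const I₀).div hsub hba
  refine ⟨_, eventually_norm_le_offCut isCompact_uIcc (differentiableOn_cauchyInt isCompact_uIcc
    (integrableOn_endDensity hm)).continuousOn (eventually_norm_le_of_tendsto (h4.congr' ?_))⟩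
  filter_upwards [self_mem_nhdsWithin] with τ hτ
  have hne : τ - a ≠ 0 := by
    intro h
    rw [sub_eq_zero] at h
    exact hτ (by simp [h])
  rw [Pi.div_apply, hI₀, ← sub_mul_cauchyInt hm (offReal_subset_offCut _ hτ),
    mul_div_cancel_left₀ _ hne]

/-! ### The singular end point -/

lemma image_quadratic {a b s : ℝ} (hs : s = 1 ∨ s = -1) (hab : b - a = s * |b - a|) :
    (fun u : ℝ => a + s * u ^ 2) '' Set.Ioo 0 √|b - a| = Set.uIoo a b := by
  have hss : s * s = 1 := by rcases hs with rfl | rfl <;> norm_num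
  have hmem : ∀ t, t ∈ Set.uIoo a b ↔ 0 < s * (t - a) ∧ s * (t - a) < |b - a| := by
    intro t
    rcases hs with rfl | rfl
    · have h : a ≤ b := by linarith [abs_nonneg (b - a)]
      rw [Set.uIoo_of_le h, abs_of_nonneg (by linarith)]
      constructor
      · rintro ⟨h1, h2⟩; constructor <;> linarith
      · rintro ⟨h1, h2⟩; constructor <;> linarith
    · have h : b ≤ a := by linarith [abs_nonneg (b - a)]
      rw [Set.uIoo_of_ge h, abs_of_nonpos (by linarith)]
      constructor
      · rintro ⟨h1, h2⟩; constructor <;> linarith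
      · rintro ⟨h1, h2⟩; constructor <;> linarith
  ext t
  rw [hmem]
  constructor
  · rintro ⟨u, ⟨hu0, hu1⟩, rfl⟩
    have h1 : s * (a + s * u ^ 2 - a) = u ^ 2 := by linear_combination u ^ 2 * hss
    rw [h1]
    exact ⟨by positivity, (Real.lt_sqrt hu0.le).1 hu1⟩
  · rintro ⟨h1, h2⟩
    refine ⟨√(s * (t - a)), ⟨Real.sqrt_pos.2 h1, Real.sqrt_lt_sqrt h1.le h2⟩, ?_⟩
    simp only
    rw [Real.sq_sqrt h1.le]
    linear_combination (t - a) * hss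

lemma uIoo_ae_eq_uIcc (a b : ℝ) : Set.uIoo a b =ᵐ[volume] Set.uIcc a b := Ioo_ae_eq_Icc

/-- The substitution `t = a + s u²`, `ζ² = s (τ - a)` turns the Cauchy integral of a density with
an inverse square root singularity at `a` into the Cauchy integral of an even function without
singularity. -/
lemma mul_cauchyInt_endDensity {a b s : ℝ} (hs : s = 1 ∨ s = -1) (hab : b - a = s * |b - a|)
    {m : ℝ → ℂ} (hm : IsHolderOn (Set.uIcc (-√|b - a|) √|b - a|) fun u => m (a + s * u ^ 2))
    {τ ζ : ℂ} (hζ : 0 < ζ.im) (hζτ : ζ ^ 2 = s * (τ - a)) :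
    ζ * cauchyInt (Set.uIcc a b) (endDensity a m) τ =
      s * ∫ u : ℝ, (Set.uIcc (-√|b - a|) √|b - a|).indicator (fun u => m (a + s * u ^ 2)) u /
        ((u : ℂ) - ζ) := by
  have hss : s * s = 1 := by rcases hs with rfl | rfl <;> norm_num
  have hss' : (s : ℂ) * s = 1 := by exact_mod_cast hss
  set β := √|b - a| with hβ
  have hβ0 : 0 ≤ β := Real.sqrt_nonneg _
  set M : ℝ → ℂ := fun u => m (a + s * u ^ 2) with hM
  have hne : ∀ u : ℝ, (u : ℂ) - ζ ≠ 0 := by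
    intro u h
    have := congrArg Complex.im h
    simp at this
    exact hζ.ne' this
  have hne' : ∀ u : ℝ, (u : ℂ) + ζ ≠ 0 := by
    intro u h
    have := congrArg Complex.im h
    simp at this
    exact hζ.ne' this
  have hMc : ContinuousOn M (Set.uIcc (-β) β) := hm.continuousOn
  have hsub1 : Set.uIcc (-β) 0 ⊆ Set.uIcc (-β) β :=
    Set.uIcc_subset_uIcc Set.left_mem_uIcc (by rw [Set.mem_uIcc]; left; constructor <;> linarith)
  have hsub2 : Set.uIcc 0 β ⊆ Set.uIcc (-β) β :=
    Set.uIcc_subset_uIcc (by rw [Set.mem_uIcc]; left; constructor <;> linarith) Set.right_mem_uIcc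
  have hi1 : IntervalIntegrable (fun u : ℝ => M u / ((u : ℂ) - ζ)) volume (-β) 0 :=
    ((hMc.mono hsub1).div (by fun_prop) fun u _ => hne u).intervalIntegrable
  have hi2 : IntervalIntegrable (fun u : ℝ => M u / ((u : ℂ) - ζ)) volume 0 β :=
    ((hMc.mono hsub2).div (by fun_prop) fun u _ => hne u).intervalIntegrable
  have hi3 : IntervalIntegrable (fun u : ℝ => M u / ((u : ℂ) + ζ)) volume 0 β :=
    ((hMc.mono hsub2).div (by fun_prop) fun u _ => hne' u).intervalIntegrable
  have hR : ∫ u : ℝ, (Set.uIcc (-β) β).indicator M u / ((u : ℂ) - ζ) =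
      ∫ u in (0 : ℝ)..β, (M u / ((u : ℂ) - ζ) - M u / ((u : ℂ) + ζ)) := by
    have h1 : ∀ u : ℝ, (Set.uIcc (-β) β).indicator M u / ((u : ℂ) - ζ) =
        (Set.uIcc (-β) β).indicator (fun u : ℝ => M u / ((u : ℂ) - ζ)) u := by
      intro u
      by_cases hu : u ∈ Set.uIcc (-β) β
      · simp only [Set.indicator_of_mem hu]
      · simp only [Set.indicator_of_notMem hu, zero_div]
    simp only [h1]
    rw [integral_indicator measurableSet_uIcc, Set.uIcc_of_le (by linarith),
      integral_Icc_eq_integral_Ioc, ← intervalIntegral.integral_of_le (by linarith),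
      ← intervalIntegral.integral_add_adjacent_intervals hi1 hi2,
      intervalIntegral.integral_sub hi2 hi3]
    have h2 := intervalIntegral.integral_comp_neg (a := 0) (b := β)
      (fun u : ℝ => M u / ((u : ℂ) - ζ))
    rw [neg_zero] at h2
    rw [← h2, ← neg_add_eq_sub, ← intervalIntegral.integral_neg]
    congr 1
    refine intervalIntegral.integral_congr fun u _ => ?_
    have h3 : M (-u) = M u := by simp only [hM, neg_sq]
    have h4 : ((-u : ℝ) : ℂ) - ζ = -((u : ℂ) + ζ) := by push_cast; ring
    simp only [h3, h4, div_neg]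
  have hL : cauchyInt (Set.uIcc a b) (endDensity a m) τ =
      ∫ u in (0 : ℝ)..β, s * (2 * M u / ((u : ℂ) ^ 2 - ζ ^ 2)) := by
    rw [cauchyInt, ← setIntegral_congr_set (uIoo_ae_eq_uIcc a b), ← image_quadratic hs hab,
      integral_image_eq_integral_abs_deriv_smul (f' := fun u => s * (2 * u)) measurableSet_Ioo,
      intervalIntegral.integral_of_le hβ0, integral_Ioc_eq_integral_Ioo]
    · refine setIntegral_congr_fun measurableSet_Ioo fun u hu => ?_
      have hu0 : 0 < u := hu.1
      have habs : |s * (2 * u)| = 2 * u := by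
        rcases hs with rfl | rfl
        · rw [one_mul, abs_of_pos (by positivity)]
        · rw [neg_one_mul, abs_neg, abs_of_pos (by positivity)]
      have hsq : √|a + s * u ^ 2 - a| = u := by
        have h5 : |a + s * u ^ 2 - a| = u ^ 2 := by
          rw [add_sub_cancel_left]
          rcases hs with rfl | rfl
          · rw [one_mul, abs_of_pos (by positivity)]
          · rw [neg_one_mul, abs_neg, abs_of_pos (by positivity)]
        rw [h5, Real.sqrt_sq hu0.le]
      have hden : ((a + s * u ^ 2 : ℝ) : ℂ) - τ = s * ((u : ℂ) ^ 2 - ζ ^ 2) := by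
        push_cast
        rw [hζτ]
        linear_combination (τ - a) * hss'
      have hs0 : (s : ℂ) ≠ 0 := left_ne_zero_of_mul_eq_one hss'
      have hu0' : (u : ℂ) ≠ 0 := by exact_mod_cast hu0.ne'
      have hq : (u : ℂ) ^ 2 - ζ ^ 2 ≠ 0 := by
        rw [sq_sub_sq]
        exact mul_ne_zero (hne' u) (hne u)
      simp only [endDensity, habs, hsq, hden, Complex.real_smul, hM]
      push_cast
      field_simp
      linear_combination (-m (a + s * u ^ 2)) * hss'
    · intro u _
      have h6 : HasDerivAt (fun u : ℝ => a + s * u ^ 2) (s * (2 * u)) u := by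
        simpa using ((hasDerivAt_pow 2 u).const_mul s).const_add a
      exact h6.hasDerivWithinAt
    · intro u hu w hw h
      have hs0 : s ≠ 0 := left_ne_zero_of_mul_eq_one hss
      simp only at h
      have h7 : u ^ 2 = w ^ 2 := mul_left_cancel₀ hs0 (by linarith)
      exact (pow_left_inj₀ hu.1.le hw.1.le two_ne_zero).1 h7
  rw [hR, hL, ← intervalIntegral.integral_const_mul, ← intervalIntegral.integral_const_mul]
  refine intervalIntegral.integral_congr fun u _ => ?_
  have h8 := hne u
  have h9 := hne' u
  have hq : (u : ℂ) ^ 2 - ζ ^ 2 ≠ 0 := by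
    rw [sq_sub_sq]
    exact mul_ne_zero h9 h8
  field_simp
  ring

lemma exists_sq_eq_im_pos {z : ℂ} (hz : z.im ≠ 0) : ∃ ζ : ℂ, 0 < ζ.im ∧ ζ ^ 2 = z := by
  obtain ⟨w, hw⟩ := IsAlgClosed.exists_pow_nat_eq z (n := 2) two_pos
  have hw0 : w.im ≠ 0 := by
    intro h
    apply hz
    rw [← hw, pow_two, Complex.mul_im, h]
    ring
  rcases lt_or_gt_of_ne hw0 with h | h
  · exact ⟨-w, by simpa using h, by rw [neg_sq, hw]⟩
  · exact ⟨w, h, hw⟩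

/-- The Cauchy integral is `O(|τ - a|^{-1/2})` at the end point `a` where the density has an
inverse square root singularity. -/
lemma cauchyInt_endDensity_bounded_base {a b : ℝ} (hab : a ≠ b) {m : ℝ → ℂ}
    (hm : IsHolderOn (Set.uIcc a b) m) (hmb : m b = 0) :
    ∃ C, ∀ᶠ τ in 𝓝 (a : ℂ), τ ∈ offCut (Set.uIcc a b) →
      √‖τ - a‖ * ‖cauchyInt (Set.uIcc a b) (endDensity a m) τ‖ ≤ C := by
  obtain ⟨s, hs, hsab⟩ := exists_sign hab
  have hss : s * s = 1 := by rcases hs with rfl | rfl <;> norm_num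
  have hs1 : |s| = 1 := by rcases hs with rfl | rfl <;> norm_num
  have hb := hsab b Set.right_mem_uIcc
  set β := √|b - a| with hβ
  have hβ0 : 0 ≤ β := Real.sqrt_nonneg _
  have hβ2 : β ^ 2 = |b - a| := Real.sq_sqrt (abs_nonneg _)
  have hmaps : ∀ u ∈ Set.uIcc (-β) β, a + s * u ^ 2 ∈ Set.uIcc a b := by
    intro u hu
    rw [Set.uIcc_of_le (by linarith)] at hu
    have h1 : u ^ 2 ≤ |b - a| := by
      rw [← hβ2]
      exact sq_le_sq' hu.1 hu.2
    have h2 := sq_nonneg u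
    rw [Set.mem_uIcc]
    rcases hs with rfl | rfl
    · left; constructor <;> linarith
    · right; constructor <;> linarith
  have hM : IsHolderOn (Set.uIcc (-β) β) fun u => m (a + s * u ^ 2) := by
    refine hm.comp (K := 2 * β) (by positivity) hmaps fun x hx y hy => ?_
    rw [Set.uIcc_of_le (by linarith)] at hx hy
    have h1 : a + s * x ^ 2 - (a + s * y ^ 2) = s * ((x + y) * (x - y)) := by ring
    rw [h1, abs_mul, hs1, one_mul, abs_mul]
    refine mul_le_mul_of_nonneg_right ?_ (abs_nonneg _)
    rw [abs_le]
    constructor <;> linarith [hx.1, hx.2, hy.1, hy.2]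
  have hend : ∀ u : ℝ, u ^ 2 = |b - a| → m (a + s * u ^ 2) = 0 := by
    intro u hu
    rw [hu, ← hb, add_sub_cancel, hmb]
  obtain ⟨L, h1, -, -⟩ := plemelj (isHolderLine_indicator hM (hend _ (by rw [neg_sq, hβ2]))
    (hend _ hβ2)) (indicator_uIcc_support _) 0
  have h2 := eventually_norm_le_of_tendsto h1
  set C := ‖L + Real.pi * Complex.I *
    (Set.uIcc (-β) β).indicator (fun u => m (a + s * u ^ 2)) 0‖ + 1 with hC
  obtain ⟨δ, hδ, h3⟩ := Metric.mem_nhdsWithin_iff.1 h2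
  have hcont : ContinuousOn (fun τ : ℂ => ((√‖τ - a‖ : ℝ) : ℂ) *
      cauchyInt (Set.uIcc a b) (endDensity a m) τ) (offCut (Set.uIcc a b)) := by
    refine ContinuousOn.mul (Continuous.continuousOn ?_)
      (differentiableOn_cauchyInt isCompact_uIcc (integrableOn_endDensity hm)).continuousOn
    exact Complex.continuous_ofReal.comp (Real.continuous_sqrt.comp (by fun_prop))
  refine ⟨C, ?_⟩
  have h4 : ∀ᶠ τ : ℂ in 𝓝[offReal] (a : ℂ), ‖((√‖τ - a‖ : ℝ) : ℂ) *
      cauchyInt (Set.uIcc a b) (endDensity a m) τ‖ ≤ C := by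
    filter_upwards [self_mem_nhdsWithin,
      nhdsWithin_le_nhds (Metric.ball_mem_nhds (a : ℂ) (show 0 < δ ^ 2 by positivity))] with τ hτ hτδ
    have hz : ((s : ℂ) * (τ - a)).im ≠ 0 := by
      have hτ' : τ.im ≠ 0 := hτ
      have hs0 : s ≠ 0 := left_ne_zero_of_mul_eq_one hss
      simp [hτ', hs0]
    obtain ⟨ζ, hζ, hζτ⟩ := exists_sq_eq_im_pos hz
    have hnorm : ‖ζ‖ ^ 2 = ‖τ - a‖ := by
      rw [← norm_pow, hζτ, norm_mul, Complex.norm_real, Real.norm_eq_abs, hs1, one_mul]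
    have hsqrt : √‖τ - a‖ = ‖ζ‖ := by rw [← hnorm, Real.sqrt_sq (norm_nonneg _)]
    have hζδ : ‖ζ‖ < δ := by
      rw [Metric.mem_ball, dist_eq_norm, ← hnorm] at hτδ
      exact lt_of_pow_lt_pow_left₀ 2 hδ.le hτδ
    have h5 := h3 ⟨show ζ ∈ Metric.ball (((0 : ℝ) : ℂ)) δ by simpa using hζδ, hζ⟩
    have h6 := mul_cauchyInt_endDensity hs hb hM hζ hζτ
    rw [norm_mul, Complex.norm_real, Real.norm_eq_abs, abs_of_nonneg (Real.sqrt_nonneg _), hsqrt,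
      ← norm_mul, h6, norm_mul, Complex.norm_real, Real.norm_eq_abs, hs1, one_mul]
    exact h5
  filter_upwards [eventually_norm_le_offCut isCompact_uIcc hcont h4] with τ hτ hτS
  have h5 := hτ hτS
  rwa [norm_mul, Complex.norm_real, Real.norm_eq_abs, abs_of_nonneg (Real.sqrt_nonneg _)] at h5

/-! ### The square roots `((τ - a) / (τ - b))^{1/2}` -/

/-- The closed interval with end points `a` and `b`, or the empty set if `a = b`. -/
def closedArc (a b : ℝ) : Set ℝ := closure (Set.uIoo b a)

lemma closedArc_of_ne {a b : ℝ} (hab : a ≠ b) : closedArc a b = Set.uIcc a b := by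
  rw [closedArc, closure_uIoo hab.symm, Set.uIcc_comm]

lemma closedArc_self (a : ℝ) : closedArc a a = ∅ := by simp [closedArc]

lemma isCompact_closedArc (a b : ℝ) : IsCompact (closedArc a b) := by
  rcases eq_or_ne a b with rfl | hab
  · rw [closedArc_self]; exact isCompact_empty
  · rw [closedArc_of_ne hab]; exact isCompact_uIcc

lemma uIoo_subset_closedArc (a b : ℝ) : Set.uIoo b a ⊆ closedArc a b := subset_closure

lemma closedArc_subset_uIcc (a b : ℝ) : closedArc a b ⊆ Set.uIcc a b := by
  rcases eq_or_ne a b with rfl | hab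
  · simp [closedArc_self]
  · rw [closedArc_of_ne hab]

lemma ae_mem_uIoo (a b : ℝ) : ∀ᵐ t ∂(volume.restrict (closedArc a b)), t ∈ Set.uIoo b a := by
  rcases eq_or_ne a b with rfl | hab
  · simp [closedArc_self]
  · rw [closedArc_of_ne hab, ← Measure.restrict_congr_set (uIoo_ae_eq_uIcc a b), Set.uIoo_comm]
    exact ae_restrict_mem measurableSet_Ioo

lemma div_mem_slitPlane {a b : ℝ} (hab : a ≠ b) {τ : ℂ} (hτ : τ ∈ offCut (closedArc a b)) :
    (τ - a) / (τ - b) ∈ Complex.slitPlane := by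
  rw [closedArc_of_ne hab] at hτ
  by_contra hcon
  rw [Complex.mem_slitPlane_iff, not_or, not_not, not_lt] at hcon
  obtain ⟨hre, him⟩ := hcon
  set c : ℝ := -((τ - a) / (τ - b)).re with hc
  have hc0 : 0 ≤ c := by linarith
  have hw : (τ - a) / (τ - b) = -(c : ℂ) := by
    apply Complex.ext
    · simp [hc]
    · simpa using him
  have hτb : τ - b ≠ 0 := by
    intro h
    exact hτ ⟨b, Set.right_mem_uIcc, (sub_eq_zero.1 h).symm⟩
  rw [div_eq_iff hτb] at hw
  have h1 : ((1 + c : ℝ) : ℂ) ≠ 0 := by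
    have : 1 + c ≠ 0 := by linarith
    exact_mod_cast this
  apply hτ
  refine ⟨(a + c * b) / (1 + c), ?_, ?_⟩
  · have h2 : (a + c * b) / (1 + c) = (1 / (1 + c)) • a + (c / (1 + c)) • b := by
      simp only [smul_eq_mul]
      field_simp
    rw [h2]
    refine (convex_uIcc a b) Set.left_mem_uIcc Set.right_mem_uIcc (by positivity) (by positivity) ?_
    field_simp
  · simp only
    push_cast at h1 ⊢
    rw [div_eq_iff h1]
    linear_combination -hw

lemma differentiableOn_nuFactor (a b : ℝ) :
    DifferentiableOn ℂ (nuFactor a b) (offCut (closedArc a b)) := by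
  intro τ hτ
  rcases eq_or_ne a b with rfl | hab
  · have : nuFactor a a = fun _ => 1 := by
      funext τ
      simp [nuFactor]
    rw [this]
    exact (differentiableAt_const _).differentiableWithinAt
  · have : nuFactor a b = fun τ : ℂ => ((τ - a) / (τ - b)) ^ (1 / 2 : ℂ) := by
      funext τ
      simp [nuFactor, hab]
    rw [this]
    have hτb : τ - b ≠ 0 := by
      intro h
      rw [closedArc_of_ne hab] at hτ
      exact hτ ⟨b, Set.right_mem_uIcc, (sub_eq_zero.1 h).symm⟩
    have h1 : DifferentiableAt ℂ (fun τ : ℂ => (τ - a) / (τ - b)) τ :=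
      DifferentiableAt.div (by fun_prop) (by fun_prop) hτb
    exact (h1.cpow_const (div_mem_slitPlane hab hτ)).differentiableWithinAt

lemma nuFactor_ne_zero {a b : ℝ} {τ : ℂ} (hτ : τ ∈ offCut (closedArc a b)) :
    nuFactor a b τ ≠ 0 := by
  rcases eq_or_ne a b with rfl | hab
  · simp [nuFactor]
  · rw [nuFactor, if_neg hab, Complex.cpow_ne_zero_iff_of_exponent_ne_zero (by norm_num)]
    exact Complex.slitPlane_ne_zero (div_mem_slitPlane hab hτ)

lemma norm_nuFactor {a b : ℝ} (hab : a ≠ b) (τ : ℂ) :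
    ‖nuFactor a b τ‖ = √‖τ - a‖ / √‖τ - b‖ := by
  rw [nuFactor, if_neg hab, show (1 / 2 : ℂ) = ((1 / 2 : ℝ) : ℂ) by push_cast; rfl,
    Complex.norm_cpow_real, norm_div, ← Real.sqrt_eq_rpow, Real.sqrt_div (norm_nonneg _)]

lemma tendsto_nuFactor_cocompact (a b : ℝ) :
    Tendsto (nuFactor a b) (cocompact ℂ) (𝓝 1) := by
  rcases eq_or_ne a b with rfl | hab
  · refine tendsto_const_nhds.congr fun τ => ?_
    simp [nuFactor]
  have h1 : Tendsto (fun τ : ℂ => 1 + ((b : ℂ) - a) / (τ - b)) (cocompact ℂ) (𝓝 1) := by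
    have h2 : Tendsto (fun τ : ℂ => τ - b) (cocompact ℂ) (cocompact ℂ) :=
      (Homeomorph.subRight (b : ℂ)).isClosedEmbedding.tendsto_cocompact
    rw [← Metric.cobounded_eq_cocompact] at h2 ⊢
    have h3 := (tendsto_inv₀_cobounded.comp h2).const_mul ((b : ℂ) - a)
    simpa [div_eq_mul_inv] using h3.const_add 1
  have h4 : ContinuousAt (fun w : ℂ => w ^ (1 / 2 : ℂ)) 1 :=
    (continuousAt_cpow_const (by simp)).tendsto
  have h5 := h4.tendsto.comp h1
  rw [Complex.one_cpow] at h5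
  refine h5.congr' ?_
  have h6 : ∀ᶠ τ : ℂ in cocompact ℂ, τ ≠ b :=
    (isCompact_singleton (x := (b : ℂ))).compl_mem_cocompact
  filter_upwards [h6] with τ hτ
  have := sub_ne_zero.2 hτ
  rw [nuFactor, if_neg hab, Function.comp_apply]
  congr 1
  field_simp
  ring

/-- The boundary values of the square root on the cut, in terms of the sign `s` of `b - a`. -/
lemma tendsto_nuFactor {a b s σ : ℝ} (hs : s = 1 ∨ s = -1) (hab : b - a = s * |b - a|)
    (hσ : σ ∈ Set.uIoo b a) :
    Tendsto (nuFactor a b) (𝓝[{z : ℂ | 0 < z.im}] (σ : ℂ))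
      (𝓝 (-(s * Complex.I * (√|σ - a| / √|σ - b| : ℝ)))) ∧
    Tendsto (nuFactor a b) (𝓝[{z : ℂ | z.im < 0}] (σ : ℂ))
      (𝓝 (s * Complex.I * (√|σ - a| / √|σ - b| : ℝ))) := by
  have hne : a ≠ b := by
    rintro rfl
    simp at hσ
  have hσ1 : min b a < σ := hσ.1
  have hσ2 : σ < max b a := hσ.2
  have hσb : σ ≠ b := by
    rintro rfl
    simp at hσ
  have hσb' : (σ : ℂ) - b ≠ 0 := by
    rw [← Complex.ofReal_sub]
    exact_mod_cast sub_ne_zero.2 hσb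
  have hneg : (σ - a) / (σ - b) < 0 := by
    rcases lt_or_gt_of_ne hne with h | h
    · rw [min_eq_right h.le] at hσ1
      rw [max_eq_left h.le] at hσ2
      exact div_neg_of_pos_of_neg (by linarith) (by linarith)
    · rw [min_eq_left h.le] at hσ1
      rw [max_eq_right h.le] at hσ2
      exact div_neg_of_neg_of_pos (by linarith) (by linarith)
  set q : ℝ := (σ - a) / (σ - b) with hq
  have hqc : ((q : ℝ) : ℂ) = ((σ : ℂ) - a) / ((σ : ℂ) - b) := by
    rw [hq]; push_cast; rfl
  have hqs : √|q| = √|σ - a| / √|σ - b| := by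
    rw [hq, abs_div, Real.sqrt_div (abs_nonneg _)]
  have hw : ∀ S : Set ℂ, Tendsto (fun τ : ℂ => (τ - a) / (τ - b)) (𝓝[S] (σ : ℂ)) (𝓝 (q : ℂ)) := by
    intro S
    rw [hqc]
    have h1 : ContinuousAt (fun τ : ℂ => (τ - a) / (τ - b)) (σ : ℂ) :=
      ContinuousAt.div (by fun_prop) (by fun_prop) hσb'
    exact h1.tendsto.mono_left nhdsWithin_le_nhds
  have him : ∀ τ : ℂ, ((τ - a) / (τ - b)).im = -(b - a) * τ.im / Complex.normSq (τ - b) := by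
    intro τ
    rw [Complex.div_im]
    simp only [Complex.sub_im, Complex.sub_re, Complex.ofReal_im, Complex.ofReal_re]
    ring
  have hpos : ∀ τ : ℂ, τ.im ≠ 0 → 0 < Complex.normSq (τ - b) := by
    intro τ hτ
    rw [Complex.normSq_pos]
    intro h
    rw [sub_eq_zero] at h
    exact hτ (by simp [h])
  have hba : 0 < |b - a| := abs_pos.2 (sub_ne_zero.2 hne.symm)
  have hfun : nuFactor a b = fun τ : ℂ => ((τ - a) / (τ - b)) ^ (1 / 2 : ℂ) := by
    funext τ
    simp [nuFactor, hne]
  have hq0 : (0 : ℝ) < |q| := abs_pos.2 hneg.ne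
  have hexp : Complex.exp (Real.log |q| * (1 / 2)) = ((√|q| : ℝ) : ℂ) := by
    rw [Real.sqrt_eq_rpow, Real.rpow_def_of_pos hq0, Complex.ofReal_exp]
    push_cast
    rfl
  have hpi : Complex.exp (Real.pi / 2 * Complex.I) = Complex.I := Complex.exp_pi_div_two_mul_I
  -- The principal square root of numbers tending to `q < 0` from below and from above.
  have hbelow : ∀ S : Set ℂ, (∀ τ ∈ S, ((τ - a) / (τ - b)).im < 0) →
      Tendsto (nuFactor a b) (𝓝[S] (σ : ℂ)) (𝓝 (-(Complex.I * (√|q| : ℝ)))) := by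
    intro S hS
    have h1 := (Complex.tendsto_log_nhdsWithin_im_neg_of_re_neg_of_im_zero
      (z := (q : ℂ)) (by simpa using hneg) (by simp)).comp
      (tendsto_nhdsWithin_iff.2 ⟨hw S, by
        filter_upwards [self_mem_nhdsWithin] with τ hτ using hS τ hτ⟩)
    have h2 := (h1.mul_const (1 / 2 : ℂ)).cexp
    rw [Complex.norm_real, Real.norm_eq_abs] at h2
    have h3 : Complex.exp ((Real.log |q| - Real.pi * Complex.I) * (1 / 2)) =
        -(Complex.I * (√|q| : ℝ)) := by
      rw [show ((Real.log |q| : ℂ) - Real.pi * Complex.I) * (1 / 2) =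
        Real.log |q| * (1 / 2) + -(Real.pi / 2 * Complex.I) by ring, Complex.exp_add, hexp,
        Complex.exp_neg, hpi, Complex.inv_I]
      ring
    rw [h3] at h2
    refine h2.congr' ?_
    filter_upwards [self_mem_nhdsWithin] with τ hτ
    have hw0 : (τ - a) / (τ - b) ≠ 0 := by
      intro h
      have := hS τ hτ
      rw [h] at this
      simp at this
    rw [hfun]
    simp only [Function.comp_apply]
    rw [Complex.cpow_def_of_ne_zero hw0]
  have habove : ∀ S : Set ℂ, (∀ τ ∈ S, 0 < ((τ - a) / (τ - b)).im) →
      Tendsto (nuFactor a b) (𝓝[S] (σ : ℂ)) (𝓝 (Complex.I * (√|q| : ℝ))) := by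
    intro S hS
    have h1 := (Complex.tendsto_log_nhdsWithin_im_nonneg_of_re_neg_of_im_zero
      (z := (q : ℂ)) (by simpa using hneg) (by simp)).comp
      (tendsto_nhdsWithin_iff.2 ⟨hw S, by
        filter_upwards [self_mem_nhdsWithin] with τ hτ using (hS τ hτ).le⟩)
    have h2 := (h1.mul_const (1 / 2 : ℂ)).cexp
    rw [Complex.norm_real, Real.norm_eq_abs] at h2
    have h3 : Complex.exp ((Real.log |q| + Real.pi * Complex.I) * (1 / 2)) =
        Complex.I * (√|q| : ℝ) := by
      rw [show ((Real.log |q| : ℂ) + Real.pi * Complex.I) * (1 / 2) =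
        Real.log |q| * (1 / 2) + (Real.pi / 2 * Complex.I) by ring, Complex.exp_add, hexp, hpi]
      ring
    rw [h3] at h2
    refine h2.congr' ?_
    filter_upwards [self_mem_nhdsWithin] with τ hτ
    have hw0 : (τ - a) / (τ - b) ≠ 0 := by
      intro h
      have := hS τ hτ
      rw [h] at this
      simp at this
    rw [hfun]
    simp only [Function.comp_apply]
    rw [Complex.cpow_def_of_ne_zero hw0]
  rw [← hqs]
  rcases hs with rfl | rfl
  · rw [Complex.ofReal_one, one_mul]
    refine ⟨hbelow _ fun τ hτ => ?_, habove _ fun τ hτ => ?_⟩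
    · have hτ' : 0 < τ.im := hτ
      rw [him]
      refine div_neg_of_neg_of_pos ?_ (hpos τ hτ'.ne')
      nlinarith
    · have hτ' : τ.im < 0 := hτ
      rw [him]
      refine div_pos ?_ (hpos τ hτ'.ne)
      nlinarith
  · rw [Complex.ofReal_neg, Complex.ofReal_one, neg_one_mul, neg_mul, neg_neg]
    refine ⟨habove _ fun τ hτ => ?_, hbelow _ fun τ hτ => ?_⟩
    · have hτ' : 0 < τ.im := hτ
      rw [him]
      refine div_pos ?_ (hpos τ hτ'.ne')
      nlinarith
    · have hτ' : τ.im < 0 := hτ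
      rw [him]
      refine div_neg_of_neg_of_pos ?_ (hpos τ hτ'.ne)
      nlinarith

/-- The restriction to an interval of a holomorphic function is Lipschitz, hence Hölder. -/
lemma isHolderOn_of_differentiableOn {U : Set ℂ} (hU : IsOpen U) {f : ℂ → ℂ}
    (hf : DifferentiableOn ℂ f U) {a b : ℝ} (hab : ∀ t ∈ Set.uIcc a b, (t : ℂ) ∈ U) :
    IsHolderOn (Set.uIcc a b) fun t => f t := by
  have hdc : ContinuousOn (fun t : ℝ => deriv f t) (Set.uIcc a b) :=
    ((hf.deriv hU).continuousOn).comp Complex.continuous_ofReal.continuousOn hab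
  obtain ⟨K, hK⟩ := isCompact_uIcc.exists_bound_of_continuousOn hdc
  refine isHolderOn_of_lipschitz (K := K) ((norm_nonneg _).trans (hK a Set.left_mem_uIcc))
    fun x hx y hy => ?_
  have h := (convex_uIcc a b).norm_image_sub_le_of_norm_hasDerivWithin_le
    (f := fun t : ℝ => f t) (f' := fun t : ℝ => deriv f t) (C := K) (fun t ht => ?_) hK hy hx
  · simpa using h
  · exact ((hf.differentiableAt (hU.mem_nhds (hab t ht))).hasDerivAt.comp_ofReal).hasDerivWithinAt

/-! ### Boundary values -/

lemma tendsto_add_iff {E : Type*} {l : Filter E} {f : ℂ → E} {σ : ℝ} :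
    Tendsto (fun ζ : ℂ => f (σ + ζ)) (𝓝[{ζ : ℂ | 0 < ζ.im}] 0) l ↔
      Tendsto f (𝓝[{z : ℂ | 0 < z.im}] (σ : ℂ)) l := by
  have h1 : Tendsto (fun ζ : ℂ => (σ : ℂ) + ζ) (𝓝[{ζ : ℂ | 0 < ζ.im}] 0)
      (𝓝[{z : ℂ | 0 < z.im}] (σ : ℂ)) := by
    refine tendsto_nhdsWithin_iff.2 ⟨?_, ?_⟩
    · have h : Continuous fun ζ : ℂ => (σ : ℂ) + ζ := by fun_prop
      simpa using (h.tendsto 0).mono_left nhdsWithin_le_nhds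
    · filter_upwards [self_mem_nhdsWithin] with ζ hζ
      have hζ' : 0 < ζ.im := hζ
      simpa using hζ'
  have h2 : Tendsto (fun τ : ℂ => τ - σ) (𝓝[{z : ℂ | 0 < z.im}] (σ : ℂ))
      (𝓝[{ζ : ℂ | 0 < ζ.im}] 0) := by
    refine tendsto_nhdsWithin_iff.2 ⟨?_, ?_⟩
    · have h : Continuous fun τ : ℂ => τ - (σ : ℂ) := by fun_prop
      simpa using (h.tendsto (σ : ℂ)).mono_left nhdsWithin_le_nhds
    · filter_upwards [self_mem_nhdsWithin] with ζ hζ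
      have hζ' : 0 < ζ.im := hζ
      simpa using hζ'
  refine ⟨fun h => (h.comp h2).congr fun τ => ?_, fun h => h.comp h1⟩
  simp

lemma tendsto_sub_iff {E : Type*} {l : Filter E} {f : ℂ → E} {σ : ℝ} :
    Tendsto (fun ζ : ℂ => f (σ - ζ)) (𝓝[{ζ : ℂ | 0 < ζ.im}] 0) l ↔
      Tendsto f (𝓝[{z : ℂ | z.im < 0}] (σ : ℂ)) l := by
  have h1 : Tendsto (fun ζ : ℂ => (σ : ℂ) - ζ) (𝓝[{ζ : ℂ | 0 < ζ.im}] 0)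
      (𝓝[{z : ℂ | z.im < 0}] (σ : ℂ)) := by
    refine tendsto_nhdsWithin_iff.2 ⟨?_, ?_⟩
    · have h : Continuous fun ζ : ℂ => (σ : ℂ) - ζ := by fun_prop
      simpa using (h.tendsto 0).mono_left nhdsWithin_le_nhds
    · filter_upwards [self_mem_nhdsWithin] with ζ hζ
      have hζ' : 0 < ζ.im := hζ
      simpa using hζ'
  have h2 : Tendsto (fun τ : ℂ => (σ : ℂ) - τ) (𝓝[{z : ℂ | z.im < 0}] (σ : ℂ))
      (𝓝[{ζ : ℂ | 0 < ζ.im}] 0) := by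
    refine tendsto_nhdsWithin_iff.2 ⟨?_, ?_⟩
    · have h : Continuous fun τ : ℂ => (σ : ℂ) - τ := by fun_prop
      simpa using (h.tendsto (σ : ℂ)).mono_left nhdsWithin_le_nhds
    · filter_upwards [self_mem_nhdsWithin] with ζ hζ
      have hζ' : ζ.im < 0 := hζ
      simpa using hζ'
  refine ⟨fun h => (h.comp h2).congr fun τ => ?_, fun h => h.comp h1⟩
  simp

instance upper_neBot (σ : ℝ) : (𝓝[{z : ℂ | 0 < z.im}] (σ : ℂ)).NeBot := by
  rw [← mem_closure_iff_nhdsWithin_neBot, Complex.closure_setOfPred_lt_im]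
  simp

instance upper_zero_neBot : (𝓝[{z : ℂ | 0 < z.im}] (0 : ℂ)).NeBot := by
  simpa using upper_neBot 0

section
variable {E : Type*} [TopologicalSpace E]

lemma hasPlus_of_tendsto {f : ℂ → E} {σ : ℝ} {A : E}
    (h : Tendsto f (𝓝[{z : ℂ | 0 < z.im}] (σ : ℂ)) (𝓝 A)) : HasPlus f σ :=
  ⟨A, tendsto_add_iff.2 h⟩

lemma hasMinus_of_tendsto {f : ℂ → E} {σ : ℝ} {A : E}
    (h : Tendsto f (𝓝[{z : ℂ | z.im < 0}] (σ : ℂ)) (𝓝 A)) : HasMinus f σ :=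
  ⟨A, tendsto_sub_iff.2 h⟩

lemma plus_eq_of_tendsto [T2Space E] [Nonempty E] {f : ℂ → E} {σ : ℝ} {A : E}
    (h : Tendsto f (𝓝[{z : ℂ | 0 < z.im}] (σ : ℂ)) (𝓝 A)) : plus f σ = A :=
  (tendsto_add_iff.2 h).limUnder_eq

lemma minus_eq_of_tendsto [T2Space E] [Nonempty E] {f : ℂ → E} {σ : ℝ} {A : E}
    (h : Tendsto f (𝓝[{z : ℂ | z.im < 0}] (σ : ℂ)) (𝓝 A)) : minus f σ = A :=
  (tendsto_sub_iff.2 h).limUnder_eq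

lemma HasPlus.tendsto [Nonempty E] {f : ℂ → E} {σ : ℝ} (h : HasPlus f σ) :
    Tendsto f (𝓝[{z : ℂ | 0 < z.im}] (σ : ℂ)) (𝓝 (plus f σ)) :=
  tendsto_add_iff.1 (tendsto_nhds_limUnder h)

lemma HasMinus.tendsto [Nonempty E] {f : ℂ → E} {σ : ℝ} (h : HasMinus f σ) :
    Tendsto f (𝓝[{z : ℂ | z.im < 0}] (σ : ℂ)) (𝓝 (minus f σ)) :=
  tendsto_sub_iff.1 (tendsto_nhds_limUnder h)

end

lemma ofReal_mem_offCut_of_disjoint {a b a' b' : ℝ} (hd : Disjoint (Set.uIcc a b) (Set.uIcc a' b'))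
    {σ : ℝ} (hσ : σ ∈ Set.uIcc a b) : (σ : ℂ) ∈ offCut (closedArc a' b') :=
  ofReal_mem_offCut.2 fun h => Set.disjoint_left.1 hd hσ (closedArc_subset_uIcc _ _ h)

lemma continuousAt_nuFactor_of_disjoint {a b a' b' : ℝ}
    (hd : Disjoint (Set.uIcc a b) (Set.uIcc a' b')) {σ : ℝ} (hσ : σ ∈ Set.uIcc a b) :
    ContinuousAt (nuFactor a' b') (σ : ℂ) :=
  (differentiableOn_nuFactor a' b').continuousOn.continuousAt
    ((isOpen_offCut (isCompact_closedArc _ _)).mem_nhds (ofReal_mem_offCut_of_disjoint hd hσ))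

/-- The boundary values of the product of two square roots with disjoint cuts, on the first cut. -/
lemma tendsto_nuFactor_mul {a b a' b' s σ : ℝ} (hd : Disjoint (Set.uIcc a b) (Set.uIcc a' b'))
    (hs : s = 1 ∨ s = -1) (hab : b - a = s * |b - a|) (hσ : σ ∈ Set.uIoo b a) :
    Tendsto (fun τ => nuFactor a b τ * nuFactor a' b' τ) (𝓝[{z : ℂ | 0 < z.im}] (σ : ℂ))
      (𝓝 (-(s * Complex.I * (√|σ - a| / √|σ - b| : ℝ)) * nuFactor a' b' σ)) ∧
    Tendsto (fun τ => nuFactor a b τ * nuFactor a' b' τ) (𝓝[{z : ℂ | z.im < 0}] (σ : ℂ))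
      (𝓝 (s * Complex.I * (√|σ - a| / √|σ - b| : ℝ) * nuFactor a' b' σ)) := by
  have hσ' : σ ∈ Set.uIcc a b := by
    rw [Set.uIcc_comm]
    exact Set.uIoo_subset_uIcc_self hσ
  have hc := continuousAt_nuFactor_of_disjoint hd hσ'
  obtain ⟨h1, h2⟩ := tendsto_nuFactor hs hab hσ
  exact ⟨h1.mul (hc.tendsto.mono_left nhdsWithin_le_nhds),
    h2.mul (hc.tendsto.mono_left nhdsWithin_le_nhds)⟩

/-! ### Densities on the arcs -/

/-- What the argument uses about a density `d` on the interval with end points `a` (the base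
point) and `b`: it is integrable, Plemelj's formulas hold inside, and its Cauchy integral is bounded
at `b` and `O(|τ - a|^{-1/2})` at `a`. -/
structure ArcDensity (a b : ℝ) (d : ℝ → ℂ) : Prop where
  integrable : IntegrableOn d (closedArc a b)
  plemelj : ∀ σ ∈ Set.uIoo b a, ∃ L, PlemeljAt (closedArc a b) d σ (d σ) L
  tip : ∃ C, ∀ᶠ τ in 𝓝 (b : ℂ), τ ∈ offCut (closedArc a b) → ‖cauchyInt (closedArc a b) d τ‖ ≤ C
  base : a ≠ b → ∃ C, ∀ᶠ τ in 𝓝 (a : ℂ), τ ∈ offCut (closedArc a b) →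
    √‖τ - a‖ * ‖cauchyInt (closedArc a b) d τ‖ ≤ C

lemma cauchyInt_congr_ae {S : Set ℝ} {d d' : ℝ → ℂ}
    (h : ∀ᵐ t ∂(volume.restrict S), d t = d' t) : cauchyInt S d = cauchyInt S d' := by
  funext τ
  refine integral_congr_ae ?_
  filter_upwards [h] with t ht
  rw [ht]

lemma PlemeljAt.congr_ae {S : Set ℝ} {d d' : ℝ → ℂ} {σ : ℝ} {c L : ℂ}
    (hp : PlemeljAt S d' σ c L) (h : ∀ᵐ t ∂(volume.restrict S), d t = d' t) :
    PlemeljAt S d σ c L := by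
  have hball : ∀ ε : ℝ, (fun t : ℝ => d t / ((t : ℂ) - σ)) =ᵐ[volume.restrict (S \ Metric.ball σ ε)]
      fun t : ℝ => d' t / ((t : ℂ) - σ) := by
    intro ε
    filter_upwards [ae_restrict_of_ae_restrict_of_subset Set.sdiff_subset h] with t ht
    rw [ht]
  refine ⟨?_, ?_, fun ε hε => (hp.pv.1 ε hε).congr (hball ε).symm, ?_⟩
  · rw [cauchyInt_congr_ae h]; exact hp.above
  · rw [cauchyInt_congr_ae h]; exact hp.below
  · exact hp.pv.2.congr fun ε => (integral_congr_ae (hball ε)).symm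

lemma arcDensity_self (a : ℝ) (d : ℝ → ℂ) : ArcDensity a a d := by
  refine ⟨?_, ?_, ⟨0, ?_⟩, fun h => absurd rfl h⟩
  · rw [closedArc_self]; exact integrableOn_empty
  · intro σ hσ
    simp at hσ
  · refine Eventually.of_forall fun τ _ => ?_
    simp [closedArc_self, cauchyInt]

/-- A Hölder function divided by `ν⁺` is a density of the required kind, because `1 / ν⁺` is a
smooth multiple of `|σ - b|^{1/2} |σ - a|^{-1/2}`. -/
lemma arcDensity_inv_plus {a b a' b' : ℝ} (hd : Disjoint (Set.uIcc a b) (Set.uIcc a' b'))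
    {g : ℝ → ℂ} (hg : a ≠ b → IsHolderOn (Set.uIcc a b) g) :
    ArcDensity a b fun σ => (plus (fun τ => nuFactor a b τ * nuFactor a' b' τ) σ)⁻¹ * g σ := by
  rcases eq_or_ne a b with rfl | hab
  · exact arcDensity_self a _
  obtain ⟨s, hs, hsab⟩ := exists_sign hab
  have hb := hsab b Set.right_mem_uIcc
  have hss : (s : ℂ) * s = 1 := by rcases hs with rfl | rfl <;> norm_num
  have hs0 : (s : ℂ) ≠ 0 := left_ne_zero_of_mul_eq_one hss
  set m : ℝ → ℂ := fun σ =>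
    (s * Complex.I) * ((√|σ - b| : ℝ) : ℂ) * ((nuFactor a' b' σ)⁻¹ * g σ) with hm
  -- The factor `1 / ν` of the other arc is holomorphic near this one.
  have hκ : IsHolderOn (Set.uIcc a b) fun σ => (nuFactor a' b' σ)⁻¹ := by
    refine isHolderOn_of_differentiableOn (U := offCut (closedArc a' b'))
      (f := fun τ => (nuFactor a' b' τ)⁻¹) (isOpen_offCut (isCompact_closedArc _ _)) ?_ ?_
    · exact (differentiableOn_nuFactor a' b').inv fun τ hτ => nuFactor_ne_zero hτ
    · exact fun t ht => ofReal_mem_offCut_of_disjoint hd ht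
  have hmH : IsHolderOn (Set.uIcc a b) m :=
    ((isHolderOn_const _ _).mul (isHolderOn_sqrt_abs _ b)).mul (hκ.mul (hg hab))
  have hmb : m b = 0 := by simp [hm]
  have hval : ∀ σ ∈ Set.uIoo b a,
      (plus (fun τ => nuFactor a b τ * nuFactor a' b' τ) σ)⁻¹ * g σ = endDensity a m σ := by
    intro σ hσ
    rw [plus_eq_of_tendsto (tendsto_nuFactor_mul hd hs hb hσ).1, endDensity, hm]
    have hσa : σ ≠ a := by
      rintro rfl
      simp at hσ
    have hσb : σ ≠ b := by
      rintro rfl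
      simp at hσ
    have h1 : ((√|σ - a| : ℝ) : ℂ) ≠ 0 := by
      exact_mod_cast (Real.sqrt_pos.2 (abs_pos.2 (sub_ne_zero.2 hσa))).ne'
    have h2 : ((√|σ - b| : ℝ) : ℂ) ≠ 0 := by
      exact_mod_cast (Real.sqrt_pos.2 (abs_pos.2 (sub_ne_zero.2 hσb))).ne'
    have h3 : nuFactor a' b' σ ≠ 0 := nuFactor_ne_zero (ofReal_mem_offCut_of_disjoint hd (by
      rw [Set.uIcc_comm]
      exact Set.uIoo_subset_uIcc_self hσ))
    have h4 := Complex.I_ne_zero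
    push_cast
    field_simp
    linear_combination (-g σ * (s : ℂ) ^ 2) * Complex.I_sq + g σ * hss
  have hae : ∀ᵐ t ∂(volume.restrict (Set.uIcc a b)),
      (plus (fun τ => nuFactor a b τ * nuFactor a' b' τ) t)⁻¹ * g t = endDensity a m t := by
    have h := ae_mem_uIoo a b
    rw [closedArc_of_ne hab] at h
    filter_upwards [h] with t ht using hval t ht
  refine ⟨?_, fun σ hσ => ?_, ?_, fun _ => ?_⟩
  · rw [closedArc_of_ne hab]
    exact (integrableOn_endDensity hmH).congr (hae.mono fun t ht => ht.symm)
  · obtain ⟨L, hL⟩ := plemeljAt_endDensity hmH hmb (σ := σ) (by rwa [Set.uIoo_comm])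
    refine ⟨L, ?_⟩
    rw [closedArc_of_ne hab]
    simp only [hval σ hσ]
    exact hL.congr_ae hae
  · rw [closedArc_of_ne hab, cauchyInt_congr_ae hae]
    exact cauchyInt_endDensity_bounded_tip hab hmH hmb
  · rw [closedArc_of_ne hab, cauchyInt_congr_ae hae]
    exact cauchyInt_endDensity_bounded_base hab hmH hmb

lemma tendsto_norm_sub_zero (c : ℂ) (s : Set ℂ) : Tendsto (fun τ : ℂ => ‖τ - c‖) (𝓝[s] c) (𝓝 0) := by
  have h : Continuous fun τ : ℂ => ‖τ - c‖ := by fun_prop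
  simpa using (h.tendsto c).mono_left nhdsWithin_le_nhds

lemma tendsto_sqrt_norm_sub_zero (c : ℂ) (s : Set ℂ) :
    Tendsto (fun τ : ℂ => √‖τ - c‖) (𝓝[s] c) (𝓝 0) := by
  have h : Continuous fun τ : ℂ => √‖τ - c‖ := Real.continuous_sqrt.comp (by fun_prop)
  simpa using (h.tendsto c).mono_left nhdsWithin_le_nhds

lemma tendsto_sub_mul_of_bounded {f : ℂ → ℂ} {c : ℂ} {C : ℝ} {s : Set ℂ}
    (h : ∀ᶠ τ in 𝓝[s] c, ‖f τ‖ ≤ C) : Tendsto (fun τ => (τ - c) * f τ) (𝓝[s] c) (𝓝 0) := by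
  have h1 := (tendsto_norm_sub_zero c s).mul_const C
  rw [zero_mul] at h1
  refine squeeze_zero_norm' ?_ h1
  filter_upwards [h] with τ hτ
  rw [norm_mul]
  exact mul_le_mul_of_nonneg_left hτ (norm_nonneg _)

/-- The Cauchy integral has weak singularities at both end points. -/
lemma ArcDensity.tendsto_sub_mul {a b : ℝ} {d : ℝ → ℂ} (h : ArcDensity a b d) {e : ℝ}
    (he : e = a ∨ e = b) :
    Tendsto (fun τ : ℂ => (τ - e) * cauchyInt (closedArc a b) d τ) (𝓝[offReal] (e : ℂ)) (𝓝 0) := by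
  have htip : Tendsto (fun τ : ℂ => (τ - b) * cauchyInt (closedArc a b) d τ)
      (𝓝[offReal] (b : ℂ)) (𝓝 0) := by
    obtain ⟨C, hC⟩ := h.tip
    refine tendsto_sub_mul_of_bounded (C := C) ?_
    filter_upwards [self_mem_nhdsWithin, nhdsWithin_le_nhds hC] with τ hτ hτC
    exact hτC (offReal_subset_offCut _ hτ)
  rcases he with rfl | rfl
  · rcases eq_or_ne e b with rfl | hab
    · exact htip
    · obtain ⟨C, hC⟩ := h.base hab
      have h1 := (tendsto_sqrt_norm_sub_zero (e : ℂ) offReal).mul_const C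
      rw [zero_mul] at h1
      refine squeeze_zero_norm' ?_ h1
      filter_upwards [self_mem_nhdsWithin, nhdsWithin_le_nhds hC] with τ hτ hτC
      have h2 := hτC (offReal_subset_offCut _ hτ)
      rw [norm_mul, ← Real.mul_self_sqrt (norm_nonneg (τ - e)), mul_assoc]
      rw [Real.mul_self_sqrt (norm_nonneg (τ - e))]
      exact mul_le_mul_of_nonneg_left h2 (Real.sqrt_nonneg _)
  · exact htip

lemma tendsto_sub_mul_inv_nuFactor (a b : ℝ) :
    Tendsto (fun τ : ℂ => (τ - a) * (nuFactor a b τ)⁻¹) (𝓝[offReal] (a : ℂ)) (𝓝 0) := by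
  rcases eq_or_ne a b with rfl | hab
  · refine tendsto_sub_mul_of_bounded (C := 1) (Eventually.of_forall fun τ => ?_)
    simp [nuFactor]
  have h1 : Tendsto (fun τ : ℂ => √‖τ - b‖) (𝓝[offReal] (a : ℂ)) (𝓝 √‖(a : ℂ) - b‖) := by
    have h : Continuous fun τ : ℂ => √‖τ - b‖ := Real.continuous_sqrt.comp (by fun_prop)
    exact (h.tendsto _).mono_left nhdsWithin_le_nhds
  have h2 := (tendsto_sqrt_norm_sub_zero (a : ℂ) offReal).mul h1
  rw [zero_mul] at h2
  refine squeeze_zero_norm (fun τ => le_of_eq ?_) h2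
  rw [norm_mul, norm_inv, norm_nuFactor hab, inv_div]
  rcases eq_or_ne τ a with rfl | hτ
  · simp
  have h3 : 0 < √‖τ - a‖ := Real.sqrt_pos.2 (norm_pos_iff.2 (sub_ne_zero.2 hτ))
  have h4 := Real.mul_self_sqrt (norm_nonneg (τ - a))
  field_simp
  rw [sq, h4]
  exact mul_comm _ _

/-- Near `a` the square root is `O(|τ - a|^{1/2})`. -/
lemma exists_norm_nuFactor_le {a b : ℝ} (hab : a ≠ b) :
    ∃ C, 0 ≤ C ∧ ∀ᶠ τ in 𝓝 (a : ℂ), ‖nuFactor a b τ‖ ≤ C * √‖τ - a‖ := by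
  have hpos : 0 < √‖(a : ℂ) - b‖ := by
    refine Real.sqrt_pos.2 (norm_pos_iff.2 ?_)
    rw [← Complex.ofReal_sub]
    exact_mod_cast sub_ne_zero.2 hab
  have h : Continuous fun τ : ℂ => √‖τ - b‖ := Real.continuous_sqrt.comp (by fun_prop)
  refine ⟨(√‖(a : ℂ) - b‖ / 2)⁻¹, by positivity, ?_⟩
  filter_upwards [(h.tendsto (a : ℂ)).eventually (lt_mem_nhds (half_lt_self hpos))] with τ hτ
  rw [norm_nuFactor hab, div_eq_inv_mul]
  exact mul_le_mul_of_nonneg_right (inv_anti₀ (by positivity) hτ.le) (Real.sqrt_nonneg _)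

/-! ### The data of the singular integral equation on the arcs -/

/-- `f` is Lipschitz on `S`. -/
def IsLipOn (S : Set ℝ) (f : ℝ → ℂ) : Prop :=
  ∃ K : ℝ, 0 ≤ K ∧ ∀ x ∈ S, ∀ y ∈ S, ‖f x - f y‖ ≤ K * |x - y|

lemma IsLipOn.isHolderOn {S : Set ℝ} {f : ℝ → ℂ} (h : IsLipOn S f) : IsHolderOn S f := by
  obtain ⟨K, hK, h⟩ := h
  exact isHolderOn_of_lipschitz hK h

lemma IsLipOn.congr {S : Set ℝ} {f g : ℝ → ℂ} (hf : IsLipOn S f) (h : ∀ x ∈ S, g x = f x) :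
    IsLipOn S g := by
  obtain ⟨K, hK, hf⟩ := hf
  exact ⟨K, hK, fun x hx y hy => by rw [h x hx, h y hy]; exact hf x hx y hy⟩

lemma IsLipOn.add {S : Set ℝ} {f g : ℝ → ℂ} (hf : IsLipOn S f) (hg : IsLipOn S g) :
    IsLipOn S fun x => f x + g x := by
  obtain ⟨K, hK, hf⟩ := hf
  obtain ⟨L, hL, hg⟩ := hg
  refine ⟨K + L, by positivity, fun x hx y hy => ?_⟩
  rw [add_sub_add_comm, add_mul]
  exact (norm_add_le _ _).trans (add_le_add (hf x hx y hy) (hg x hx y hy))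

lemma IsLipOn.mul {a b : ℝ} {f g : ℝ → ℂ} (hf : IsLipOn (Set.uIcc a b) f)
    (hg : IsLipOn (Set.uIcc a b) g) : IsLipOn (Set.uIcc a b) fun x => f x * g x := by
  obtain ⟨M, hM0, hM⟩ := hf.isHolderOn.exists_norm_le
  obtain ⟨N, hN0, hN⟩ := hg.isHolderOn.exists_norm_le
  obtain ⟨K, hK, hf⟩ := hf
  obtain ⟨L, hL, hg⟩ := hg
  refine ⟨K * N + M * L, by positivity, fun x hx y hy => ?_⟩
  calc ‖f x * g x - f y * g y‖ = ‖(f x - f y) * g x + f y * (g x - g y)‖ := by ring_nf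
    _ ≤ ‖f x - f y‖ * ‖g x‖ + ‖f y‖ * ‖g x - g y‖ := by
        refine (norm_add_le _ _).trans ?_
        rw [norm_mul, norm_mul]
    _ ≤ (K * |x - y|) * N + M * (L * |x - y|) := add_le_add
        (mul_le_mul (hf x hx y hy) (hN x hx) (norm_nonneg _) (by positivity))
        (mul_le_mul (hM y hy) (hg x hx y hy) (norm_nonneg _) hM0)
    _ = _ := by ring

/-- A function that is Lipschitz on two sets of positive distance is Lipschitz on their union. -/
lemma IsLipOn.union {a b a' b' : ℝ} {f : ℝ → ℂ} (hd : Disjoint (Set.uIcc a b) (Set.uIcc a' b'))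
    (hf : IsLipOn (Set.uIcc a b) f) (hf' : IsLipOn (Set.uIcc a' b') f) :
    IsLipOn (Set.uIcc a b ∪ Set.uIcc a' b') f := by
  obtain ⟨M, hM0, hM⟩ := hf.isHolderOn.exists_norm_le
  obtain ⟨N, hN0, hN⟩ := hf'.isHolderOn.exists_norm_le
  obtain ⟨K, hK, hf⟩ := hf
  obtain ⟨L, hL, hf'⟩ := hf'
  obtain ⟨δ, hδ, hdist⟩ := Metric.exists_pos_forall_lt_edist (s := Set.uIcc a b)
    (t := Set.uIcc a' b') isCompact_uIcc isCompact_uIcc.isClosed hd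
  have hdist' : ∀ x ∈ Set.uIcc a b, ∀ y ∈ Set.uIcc a' b', (δ : ℝ) ≤ |x - y| := by
    intro x hx y hy
    have h := hdist x hx y hy
    rw [edist_nndist, ENNReal.coe_lt_coe] at h
    rw [← Real.dist_eq, ← coe_nndist]
    exact_mod_cast h.le
  have hδ' : (0 : ℝ) < δ := hδ
  have hcross : ∀ x ∈ Set.uIcc a b, ∀ y ∈ Set.uIcc a' b',
      ‖f x - f y‖ ≤ (M + N) / δ * |x - y| := by
    intro x hx y hy
    have h1 : ‖f x - f y‖ ≤ M + N := (norm_sub_le _ _).trans (add_le_add (hM x hx) (hN y hy))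
    have h2 : M + N = (M + N) / δ * δ := by field_simp
    rw [h2] at h1
    exact h1.trans (mul_le_mul_of_nonneg_left (hdist' x hx y hy) (by positivity))
  have hQ : 0 ≤ (M + N) / δ := by positivity
  have hmono : ∀ {c t : ℝ}, c ≤ K + L + (M + N) / δ → c * |t| ≤ (K + L + (M + N) / δ) * |t| :=
    fun h => mul_le_mul_of_nonneg_right h (abs_nonneg _)
  refine ⟨K + L + (M + N) / δ, by positivity, ?_⟩
  rintro x (hx | hx) y (hy | hy)
  · exact (hf x hx y hy).trans (hmono (by linarith))
  · exact (hcross x hx y hy).trans (hmono (by linarith))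
  · rw [norm_sub_rev, abs_sub_comm]
    exact (hcross y hy x hx).trans (hmono (by linarith))
  · exact (hf' x hx y hy).trans (hmono (by linarith))

lemma IsC0Plus.isHolderOn {S : Set ℝ} {f : ℝ → ℂ} (hf : IsC0Plus S f) {a b : ℝ}
    (hab : Set.uIcc a b ⊆ S) : IsHolderOn (Set.uIcc a b) f := by
  obtain ⟨C, γ, hγ, -, h⟩ := hf (min a b) (max a b) min_le_max hab
  refine ⟨C, γ, C.2, hγ, fun x hx y hy => ?_⟩
  have := h.dist_le hx hy
  rwa [dist_eq_norm, Real.dist_eq] at this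

lemma IsC1Plus.isLipOn {S : Set ℝ} {f : ℝ → ℂ} (hf : IsC1Plus S f) {a b : ℝ}
    (hab : Set.uIcc a b ⊆ S) : IsLipOn (Set.uIcc a b) f := by
  obtain ⟨K, hK0, hK⟩ := (hf.2.isHolderOn hab).exists_norm_le
  refine ⟨K, hK0, fun x hx y hy => ?_⟩
  have h := (convex_uIcc a b).norm_image_sub_le_of_norm_hasDerivWithin_le
    (f := f) (f' := derivWithin f S) (C := K)
    (fun t ht => ((hf.1 t (hab ht)).hasDerivWithinAt).mono hab) hK hy hx
  simpa using h

/-- The row `W₂ᵀ J`. -/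
noncomputable def rowW2J (x₀ x : ℝ × ℝ) (v : (ℝ → M2) × (ℝ → M2)) (σ : ℝ) : Fin 2 → ℂ :=
  ![-WMat x₀ x v σ 1 1, WMat x₀ x v σ 0 1]

lemma density_apply (x₀ x : ℝ × ℝ) (v : (ℝ → M2) × (ℝ → M2)) (Y₁ : ℝ → Fin 2 → ℂ) (σ : ℝ)
    (j k : Fin 2) : density x₀ x v Y₁ σ j k =
      (plus (nu x₀ x) σ)⁻¹ * (Y₁ σ j * rowW2J x₀ x v σ k) := by
  fin_cases k <;>
    simp [density, JM, rowW2J, W2, Matrix.vecMulVec, Matrix.mul_apply, Fin.sum_univ_two]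

/-- The facts about the arcs, the matrix `W` and the column `𝒴₁` that the proof of the equivalence
uses. -/
structure ArcData (x₀ x : ℝ × ℝ) (v : (ℝ → M2) × (ℝ → M2)) (Y₁ : ℝ → Fin 2 → ℂ) : Prop where
  disj : Disjoint (Set.uIcc x₀.1 x.1) (Set.uIcc x₀.2 x.2)
  det : ∀ σ ∈ arc x₀ x, WMat x₀ x v σ 0 0 * WMat x₀ x v σ 1 1 -
    WMat x₀ x v σ 0 1 * WMat x₀ x v σ 1 0 = 1
  lip : ∀ j k, IsLipOn (arc x₀ x) fun σ => WMat x₀ x v σ j k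
  bound : ∃ B, 0 ≤ B ∧ ∀ σ ∈ arc x₀ x, ∀ j, ‖Y₁ σ j‖ ≤ B ∧ ∀ k, ‖WMat x₀ x v σ j k‖ ≤ B
  density₃ : ∀ j k, ArcDensity x₀.1 x.1 fun σ => density x₀ x v Y₁ σ j k
  density₄ : ∀ j k, ArcDensity x₀.2 x.2 fun σ => density x₀ x v Y₁ σ j k
  integrable : ∀ j, IntegrableOn (fun σ => (plus (nu x₀ x) σ)⁻¹ * Y₁ σ j) (arcBar x₀ x)

lemma disjoint_arcs {r₁ s₁ : EReal} {r₂ s₂ : ℝ} {x₀ x : ℝ × ℝ}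
    (hD : IsDomainData r₁ s₁ r₂ s₂ x₀) (hx : x ∈ nullDomain r₁ s₁ r₂ s₂) :
    Disjoint (Set.uIcc x₀.1 x.1) (Set.uIcc x₀.2 x.2) := by
  obtain ⟨h1, h2, h3, h4, h5⟩ := hx
  have h6 := (hD.segment_r x.1 h1 h2).2.2.2.2
  have h7 := (hD.segment_s x.2 h3 h4).2.2.2.2
  have h8 := hD.base_mem.2.2.2.2
  simp only at h6 h7
  rw [Set.disjoint_left]
  intro t ht ht'
  have h9 : t ≤ max x₀.1 x.1 := ht.2
  have h10 : min x₀.2 x.2 ≤ t := ht'.1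
  have h11 : max x₀.1 x.1 < min x₀.2 x.2 := by
    rw [max_lt_iff, lt_min_iff, lt_min_iff]
    exact ⟨⟨h8, h7⟩, h6, h5⟩
  linarith

lemma uIcc_subset_interval3 {r₁ : EReal} {r₂ a b : ℝ} (ha : a ∈ interval3 r₁ r₂)
    (hb : b ∈ interval3 r₁ r₂) : Set.uIcc a b ⊆ interval3 r₁ r₂ := by
  intro t ht
  rcases le_total a b with h | h
  · rw [Set.uIcc_of_le h] at ht
    exact ⟨ha.1.trans_le (EReal.coe_le_coe_iff.2 ht.1), ht.2.trans_lt hb.2⟩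
  · rw [Set.uIcc_of_ge h] at ht
    exact ⟨hb.1.trans_le (EReal.coe_le_coe_iff.2 ht.1), ht.2.trans_lt ha.2⟩

lemma uIcc_subset_interval4 {s₁ : EReal} {s₂ a b : ℝ} (ha : a ∈ interval4 s₁ s₂)
    (hb : b ∈ interval4 s₁ s₂) : Set.uIcc a b ⊆ interval4 s₁ s₂ := by
  intro t ht
  rcases le_total a b with h | h
  · rw [Set.uIcc_of_le h] at ht
    exact ⟨ha.1.trans_le ht.1, (EReal.coe_le_coe_iff.2 ht.2).trans_lt hb.2⟩
  · rw [Set.uIcc_of_ge h] at ht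
    exact ⟨hb.1.trans_le ht.1, (EReal.coe_le_coe_iff.2 ht.2).trans_lt ha.2⟩

lemma isLipOn_mul_upper {x₀ : ℝ × ℝ} {S : Set ℝ} {w : ℝ → M2} (hw : IsK1PlusComponent x₀ S w)
    {a b : ℝ} (hab : Set.uIcc a b ⊆ S) (j k : Fin 2) :
    IsLipOn (Set.uIcc a b) fun σ =>
      (w σ * !![1, -Complex.I * ((σ : ℂ) - zc x₀); 0, 1]) j k := by
  have h : ∀ k, IsLipOn (Set.uIcc a b) fun σ => w σ j k := fun k => (hw.smooth j k).isLipOn hab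
  have hlin : IsLipOn (Set.uIcc a b) fun σ : ℝ => -Complex.I * ((σ : ℂ) - zc x₀) := by
    refine ⟨1, zero_le_one, fun x _ y _ => le_of_eq ?_⟩
    rw [← mul_sub, sub_sub_sub_cancel_right, norm_mul, norm_neg, Complex.norm_I,
      ← Complex.ofReal_sub, Complex.norm_real, Real.norm_eq_abs]
  fin_cases k
  · refine (h 0).congr fun σ _ => ?_
    simp [Matrix.mul_apply, Fin.sum_univ_two]
  · refine (((h 0).mul hlin).add (h 1)).congr fun σ _ => ?_
    simp [Matrix.mul_apply, Fin.sum_univ_two]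

lemma det_mul_upper {w : M2} (hw : w.det = 1) (c : ℂ) :
    (w * !![1, c; 0, 1]) 0 0 * (w * !![1, c; 0, 1]) 1 1 -
      (w * !![1, c; 0, 1]) 0 1 * (w * !![1, c; 0, 1]) 1 0 = 1 := by
  rw [← Matrix.det_fin_two, Matrix.det_mul, hw]
  simp

lemma exists_entry_bound {a b : ℝ} {Y : ℝ → Fin 2 → ℂ} {V : ℝ → M2}
    (hY : ∀ j, IsHolderOn (Set.uIcc a b) fun σ => Y σ j)
    (hV : ∀ j k, IsHolderOn (Set.uIcc a b) fun σ => V σ j k) :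
    ∃ B, 0 ≤ B ∧ ∀ σ ∈ Set.uIcc a b, ∀ j, ‖Y σ j‖ ≤ B ∧ ∀ k, ‖V σ j k‖ ≤ B := by
  choose M hM0 hM using fun j => (hY j).exists_norm_le
  choose N hN0 hN using fun j k => (hV j k).exists_norm_le
  have h1 := Finset.sum_nonneg (s := Finset.univ) fun j _ => hM0 j
  have h2 := Finset.sum_nonneg (s := Finset.univ) fun j _ =>
    Finset.sum_nonneg (s := Finset.univ) fun k _ => hN0 j k
  refine ⟨(∑ j, M j) + ∑ j, ∑ k, N j k, add_nonneg h1 h2, fun σ hσ j =>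
    ⟨(hM j σ hσ).trans ?_, fun k => (hN j k σ hσ).trans ?_⟩⟩
  · have := Finset.single_le_sum (fun j _ => hM0 j) (Finset.mem_univ j)
    linarith
  · have h3 := Finset.single_le_sum (fun k _ => hN0 j k) (Finset.mem_univ k)
    have h4 := Finset.single_le_sum
      (fun j _ => Finset.sum_nonneg (s := Finset.univ) fun k _ => hN0 j k) (Finset.mem_univ j)
    linarith

lemma nu_eq (x₀ x : ℝ × ℝ) :
    nu x₀ x = fun τ => nuFactor x₀.1 x.1 τ * nuFactor x₀.2 x.2 τ := rfl

lemma nu_eq_swap (x₀ x : ℝ × ℝ) :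
    nu x₀ x = fun τ => nuFactor x₀.2 x.2 τ * nuFactor x₀.1 x.1 τ := by
  funext τ
  rw [nu_eq, mul_comm]

lemma arcBar_eq (x₀ x : ℝ × ℝ) :
    arcBar x₀ x = closedArc x₀.1 x.1 ∪ closedArc x₀.2 x.2 := rfl

/-- The standing assumptions provide the facts about the arcs: the arcs have disjoint closures because
both null segments through `x₀` lie in `D`, and `W` is Lipschitz because `v` is of class `C^{1+}`. -/
lemma arcData {r₁ s₁ : EReal} {r₂ s₂ : ℝ} {x₀ x : ℝ × ℝ}
    (hD : IsDomainData r₁ s₁ r₂ s₂ x₀) {v : (ℝ → M2) × (ℝ → M2)}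
    (hv : MemK1Plus r₁ s₁ r₂ s₂ x₀ v) (hx : x ∈ nullDomain r₁ s₁ r₂ s₂) {Y₁ : ℝ → Fin 2 → ℂ}
    (hY₁ : ∀ j, IsC0Plus (arcBar x₀ x) (fun σ => Y₁ σ j)) : ArcData x₀ x v Y₁ := by
  have hdisj := disjoint_arcs hD hx
  have hsub3 : Set.uIcc x₀.1 x.1 ⊆ interval3 r₁ r₂ :=
    uIcc_subset_interval3 ⟨hD.base_mem.1, hD.base_mem.2.1⟩ ⟨hx.1, hx.2.1⟩
  have hsub4 : Set.uIcc x₀.2 x.2 ⊆ interval4 s₁ s₂ :=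
    uIcc_subset_interval4 ⟨hD.base_mem.2.2.1, hD.base_mem.2.2.2.1⟩ ⟨hx.2.2.1, hx.2.2.2.1⟩
  have hon3 : ∀ σ ∈ closedArc x₀.1 x.1, onArcs x₀ x v σ = v.1 σ := fun σ hσ => if_pos hσ
  have hon4 : ∀ σ ∈ Set.uIcc x₀.2 x.2, onArcs x₀ x v σ = v.2 σ := fun σ hσ =>
    if_neg fun h => Set.disjoint_left.1 hdisj (closedArc_subset_uIcc _ _ h) hσ
  have hlip3 : x₀.1 ≠ x.1 → ∀ j k, IsLipOn (Set.uIcc x₀.1 x.1) fun σ => WMat x₀ x v σ j k := by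
    intro hne j k
    refine (isLipOn_mul_upper hv.1 hsub3 j k).congr fun σ hσ => ?_
    rw [WMat, hon3 σ (by rwa [closedArc_of_ne hne])]
  have hlip4 : ∀ j k, IsLipOn (Set.uIcc x₀.2 x.2) fun σ => WMat x₀ x v σ j k := by
    intro j k
    refine (isLipOn_mul_upper hv.2 hsub4 j k).congr fun σ hσ => ?_
    rw [WMat, hon4 σ hσ]
  have harc3 : ∀ σ ∈ arc3 x₀ x, x₀.1 ≠ x.1 ∧ σ ∈ closedArc x₀.1 x.1 ∧ σ ∈ Set.uIcc x₀.1 x.1 := by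
    intro σ hσ
    have h := uIoo_subset_closedArc x₀.1 x.1 hσ
    refine ⟨fun hne => ?_, h, closedArc_subset_uIcc _ _ h⟩
    rw [arc3, hne] at hσ
    simp at hσ
  have harc4 : ∀ σ ∈ arc4 x₀ x, x₀.2 ≠ x.2 ∧ σ ∈ closedArc x₀.2 x.2 ∧ σ ∈ Set.uIcc x₀.2 x.2 := by
    intro σ hσ
    have h := uIoo_subset_closedArc x₀.2 x.2 hσ
    refine ⟨fun hne => ?_, h, closedArc_subset_uIcc _ _ h⟩
    rw [arc4, hne] at hσ
    simp at hσ
  have hlip : ∀ j k, IsLipOn (arc x₀ x) fun σ => WMat x₀ x v σ j k := by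
    intro j k
    rcases eq_or_ne x₀.1 x.1 with hne | hne
    · obtain ⟨K, hK, h⟩ := hlip4 j k
      have hmem : ∀ σ ∈ arc x₀ x, σ ∈ Set.uIcc x₀.2 x.2 := fun σ hσ =>
        hσ.elim (fun h => absurd hne (harc3 σ h).1) fun h => (harc4 σ h).2.2
      exact ⟨K, hK, fun t ht y hy => h t (hmem t ht) y (hmem y hy)⟩
    · obtain ⟨K, hK, h⟩ := IsLipOn.union hdisj (hlip3 hne j k) (hlip4 j k)
      have hmem : ∀ σ ∈ arc x₀ x, σ ∈ Set.uIcc x₀.1 x.1 ∪ Set.uIcc x₀.2 x.2 := fun σ hσ =>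
        hσ.elim (fun h => Or.inl (harc3 σ h).2.2) fun h => Or.inr (harc4 σ h).2.2
      exact ⟨K, hK, fun t ht y hy => h t (hmem t ht) y (hmem y hy)⟩
  have hY3 : x₀.1 ≠ x.1 → ∀ j, IsHolderOn (Set.uIcc x₀.1 x.1) fun σ => Y₁ σ j := fun hne j =>
    (hY₁ j).isHolderOn (by
      rw [← closedArc_of_ne hne]
      exact Set.subset_union_left)
  have hY4 : x₀.2 ≠ x.2 → ∀ j, IsHolderOn (Set.uIcc x₀.2 x.2) fun σ => Y₁ σ j := fun hne j =>
    (hY₁ j).isHolderOn (by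
      rw [← closedArc_of_ne hne]
      exact Set.subset_union_right)
  have hrow : ∀ {a b : ℝ}, (∀ j k, IsLipOn (Set.uIcc a b) fun σ => WMat x₀ x v σ j k) →
      ∀ k, IsHolderOn (Set.uIcc a b) fun σ => rowW2J x₀ x v σ k := by
    intro a b h k
    fin_cases k
    · refine ((isHolderOn_const _ (-1)).mul (h 1 1).isHolderOn).congr fun σ _ => ?_
      simp [rowW2J]
    · refine (h 0 1).isHolderOn.congr fun σ _ => ?_
      simp [rowW2J]
  refine ⟨hdisj, ?_, hlip, ?_, fun j k => ?_, fun j k => ?_, fun j => ?_⟩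
  · rintro σ (hσ | hσ)
    · rw [WMat, hon3 σ (harc3 σ hσ).2.1]
      exact det_mul_upper (hv.1.det_eq_one σ (hsub3 (harc3 σ hσ).2.2)) _
    · rw [WMat, hon4 σ (harc4 σ hσ).2.2]
      exact det_mul_upper (hv.2.det_eq_one σ (hsub4 (harc4 σ hσ).2.2)) _
  · have hb3 : ∃ B, 0 ≤ B ∧ ∀ σ ∈ arc3 x₀ x, ∀ j, ‖Y₁ σ j‖ ≤ B ∧ ∀ k, ‖WMat x₀ x v σ j k‖ ≤ B := by
      rcases eq_or_ne x₀.1 x.1 with hne | hne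
      · exact ⟨0, le_rfl, fun σ hσ => absurd hne (harc3 σ hσ).1⟩
      · obtain ⟨B, hB0, hB⟩ := exists_entry_bound (hY3 hne) fun j k => (hlip3 hne j k).isHolderOn
        exact ⟨B, hB0, fun σ hσ => hB σ (harc3 σ hσ).2.2⟩
    have hb4 : ∃ B, 0 ≤ B ∧ ∀ σ ∈ arc4 x₀ x, ∀ j, ‖Y₁ σ j‖ ≤ B ∧ ∀ k, ‖WMat x₀ x v σ j k‖ ≤ B := by
      rcases eq_or_ne x₀.2 x.2 with hne | hne
      · exact ⟨0, le_rfl, fun σ hσ => absurd hne (harc4 σ hσ).1⟩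
      · obtain ⟨B, hB0, hB⟩ := exists_entry_bound (hY4 hne) fun j k => (hlip4 j k).isHolderOn
        exact ⟨B, hB0, fun σ hσ => hB σ (harc4 σ hσ).2.2⟩
    obtain ⟨B, hB0, hB⟩ := hb3
    obtain ⟨B', hB0', hB'⟩ := hb4
    refine ⟨max B B', hB0.trans (le_max_left _ _), ?_⟩
    rintro σ (hσ | hσ) j
    · exact ⟨(hB σ hσ j).1.trans (le_max_left _ _),
        fun k => ((hB σ hσ j).2 k).trans (le_max_left _ _)⟩
    · exact ⟨(hB' σ hσ j).1.trans (le_max_right _ _),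
        fun k => ((hB' σ hσ j).2 k).trans (le_max_right _ _)⟩
  · simp only [density_apply, nu_eq]
    exact arcDensity_inv_plus hdisj fun hne => (hY3 hne j).mul (hrow (hlip3 hne) k)
  · simp only [density_apply, nu_eq_swap]
    exact arcDensity_inv_plus hdisj.symm fun hne => (hY4 hne j).mul (hrow hlip4 k)
  · rw [arcBar_eq]
    refine IntegrableOn.union ?_ ?_
    · simp only [nu_eq]
      exact (arcDensity_inv_plus hdisj fun hne => hY3 hne j).integrable
    · simp only [nu_eq_swap]
      exact (arcDensity_inv_plus hdisj.symm fun hne => hY4 hne j).integrable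

/-! ### The Cauchy integral over both arcs -/

section TwoArcs
variable {a b a' b' : ℝ} {d : ℝ → ℂ}

lemma disjoint_closedArc (hd : Disjoint (Set.uIcc a b) (Set.uIcc a' b')) :
    Disjoint (closedArc a b) (closedArc a' b') :=
  hd.mono (closedArc_subset_uIcc _ _) (closedArc_subset_uIcc _ _)

lemma mem_offCut_union {S T : Set ℝ} {τ : ℂ} :
    τ ∈ offCut (S ∪ T) ↔ τ ∈ offCut S ∧ τ ∈ offCut T := by
  simp [offCut, Set.image_union]

lemma ArcDensity.cauchyInt_union (h : ArcDensity a b d) (h' : ArcDensity a' b' d)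
    (hd : Disjoint (Set.uIcc a b) (Set.uIcc a' b')) {τ : ℂ}
    (hτ : τ ∈ offCut (closedArc a b ∪ closedArc a' b')) :
    cauchyInt (closedArc a b ∪ closedArc a' b') d τ =
      cauchyInt (closedArc a b) d τ + cauchyInt (closedArc a' b') d τ :=
  GerochHHP.cauchyInt_union (isCompact_closedArc _ _) (isCompact_closedArc _ _)
    (disjoint_closedArc hd) h.integrable h'.integrable hτ

lemma ArcDensity.continuousAt_cauchyInt (h' : ArcDensity a' b' d)
    (hd : Disjoint (Set.uIcc a b) (Set.uIcc a' b')) {e : ℝ} (he : e ∈ Set.uIcc a b) :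
    ContinuousAt (cauchyInt (closedArc a' b') d) (e : ℂ) :=
  (differentiableOn_cauchyInt (isCompact_closedArc _ _) h'.integrable).continuousOn.continuousAt
    ((isOpen_offCut (isCompact_closedArc _ _)).mem_nhds (ofReal_mem_offCut_of_disjoint hd he))

lemma eventually_norm_le_of_continuousAt {f : ℂ → ℂ} {e : ℂ} (hf : ContinuousAt f e) :
    ∃ C, 0 ≤ C ∧ ∀ᶠ τ in 𝓝 e, ‖f τ‖ ≤ C :=
  ⟨‖f e‖ + 1, by positivity, eventually_norm_le_of_tendsto hf⟩

lemma ArcDensity.plemeljAt_union (h : ArcDensity a b d) (h' : ArcDensity a' b' d)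
    (hd : Disjoint (Set.uIcc a b) (Set.uIcc a' b')) {σ : ℝ} (hσ : σ ∈ Set.uIoo b a) :
    ∃ L, PlemeljAt (closedArc a b ∪ closedArc a' b') d σ (d σ) L := by
  obtain ⟨L, hL⟩ := h.plemelj σ hσ
  have hσ' : σ ∉ closedArc a' b' := fun h =>
    Set.disjoint_left.1 (disjoint_closedArc hd) (uIoo_subset_closedArc _ _ hσ) h
  have h1 := hL.union (isCompact_closedArc _ _) (isCompact_closedArc _ _) (disjoint_closedArc hd)
    h.integrable h'.integrable
    (plemeljAt_of_notMem (isCompact_closedArc _ _) h'.integrable hσ')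
  rw [add_zero] at h1
  exact ⟨_, h1⟩

lemma ArcDensity.tendsto_sub_mul_union (h : ArcDensity a b d) (h' : ArcDensity a' b' d)
    (hd : Disjoint (Set.uIcc a b) (Set.uIcc a' b')) {e : ℝ} (he : e = a ∨ e = b) :
    Tendsto (fun τ : ℂ => (τ - e) * cauchyInt (closedArc a b ∪ closedArc a' b') d τ)
      (𝓝[offReal] (e : ℂ)) (𝓝 0) := by
  have heI : e ∈ Set.uIcc a b := by
    rcases he with rfl | rfl
    · exact Set.left_mem_uIcc
    · exact Set.right_mem_uIcc
  obtain ⟨C, -, hC⟩ := eventually_norm_le_of_continuousAt (h'.continuousAt_cauchyInt hd heI)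
  have h1 := (h.tendsto_sub_mul he).add
    (tendsto_sub_mul_of_bounded (nhdsWithin_le_nhds (s := offReal) hC))
  rw [add_zero] at h1
  refine h1.congr' ?_
  filter_upwards [self_mem_nhdsWithin] with τ hτ
  rw [h.cauchyInt_union h' hd (offReal_subset_offCut _ hτ), mul_add]

lemma ArcDensity.exists_norm_le_tip (h : ArcDensity a b d) (h' : ArcDensity a' b' d)
    (hd : Disjoint (Set.uIcc a b) (Set.uIcc a' b')) :
    ∃ C, ∀ᶠ τ in 𝓝 (b : ℂ), τ ∈ offCut (closedArc a b ∪ closedArc a' b') →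
      ‖cauchyInt (closedArc a b ∪ closedArc a' b') d τ‖ ≤ C := by
  obtain ⟨C, hC⟩ := h.tip
  obtain ⟨C', -, hC'⟩ := eventually_norm_le_of_continuousAt
    (h'.continuousAt_cauchyInt hd Set.right_mem_uIcc)
  refine ⟨C + C', ?_⟩
  filter_upwards [hC, hC'] with τ h1 h2 hτ
  rw [h.cauchyInt_union h' hd hτ]
  exact (norm_add_le _ _).trans (add_le_add (h1 (mem_offCut_union.1 hτ).1) h2)

/-- The zero of the square root at the base point compensates the singularity of the Cauchy
integral. -/
lemma ArcDensity.exists_norm_nuFactor_mul_le (h : ArcDensity a b d) :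
    ∃ C, 0 ≤ C ∧ ∀ᶠ τ in 𝓝 (a : ℂ), τ ∈ offCut (closedArc a b) →
      ‖nuFactor a b τ‖ ≤ C ∧ ‖nuFactor a b τ * cauchyInt (closedArc a b) d τ‖ ≤ C := by
  rcases eq_or_ne a b with rfl | hab
  · refine ⟨1, zero_le_one, Eventually.of_forall fun τ _ => ?_⟩
    simp [nuFactor, closedArc_self, cauchyInt]
  obtain ⟨C, hC⟩ := h.base hab
  obtain ⟨K, hK0, hK⟩ := exists_norm_nuFactor_le hab
  refine ⟨K + K * max C 0, by positivity, ?_⟩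
  have hK0' : 0 ≤ K * max C 0 := by positivity
  filter_upwards [hC, hK, Metric.ball_mem_nhds (a : ℂ) one_pos] with τ h1 h2 h3 hτ
  have h4 : √‖τ - a‖ ≤ 1 := by
    rw [Real.sqrt_le_one]
    rw [Metric.mem_ball, dist_eq_norm] at h3
    exact h3.le
  constructor
  · have := mul_le_mul_of_nonneg_left h4 hK0
    linarith
  · rw [norm_mul]
    have h5 := mul_le_mul_of_nonneg_right h2 (norm_nonneg (cauchyInt (closedArc a b) d τ))
    rw [mul_assoc] at h5
    have h6 := mul_le_mul_of_nonneg_left ((h1 hτ).trans (le_max_left C 0)) hK0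
    linarith

lemma ArcDensity.exists_norm_le_base (h : ArcDensity a b d) (h' : ArcDensity a' b' d)
    (hd : Disjoint (Set.uIcc a b) (Set.uIcc a' b')) :
    ∃ C, ∀ᶠ τ in 𝓝 (a : ℂ), τ ∈ offCut (closedArc a b ∪ closedArc a' b') →
      ‖nuFactor a b τ * nuFactor a' b' τ‖ ≤ C ∧
      ‖nuFactor a b τ * nuFactor a' b' τ *
        cauchyInt (closedArc a b ∪ closedArc a' b') d τ‖ ≤ C := by
  obtain ⟨C, hC0, hC⟩ := h.exists_norm_nuFactor_mul_le
  obtain ⟨K, hK0, hK⟩ := eventually_norm_le_of_continuousAt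
    (continuousAt_nuFactor_of_disjoint hd Set.left_mem_uIcc)
  obtain ⟨C', hC0', hC'⟩ := eventually_norm_le_of_continuousAt
    (h'.continuousAt_cauchyInt hd Set.left_mem_uIcc)
  refine ⟨C * K + (C * K + C * K * C'), ?_⟩
  have hp : 0 ≤ C * K := by positivity
  have hp' : 0 ≤ C * K * C' := by positivity
  filter_upwards [hC, hK, hC'] with τ h1 h2 h3 hτ
  obtain ⟨h4, h5⟩ := h1 (mem_offCut_union.1 hτ).1
  have h6 : ‖nuFactor a b τ * nuFactor a' b' τ‖ ≤ C * K := by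
    rw [norm_mul]
    exact mul_le_mul h4 h2 (norm_nonneg _) hC0
  constructor
  · linarith
  · rw [h.cauchyInt_union h' hd hτ, mul_add]
    refine (norm_add_le _ _).trans ?_
    have h7 : ‖nuFactor a b τ * nuFactor a' b' τ * cauchyInt (closedArc a b) d τ‖ ≤ C * K := by
      rw [mul_right_comm, norm_mul]
      exact mul_le_mul h5 h2 (norm_nonneg _) hC0
    have h8 : ‖nuFactor a b τ * nuFactor a' b' τ * cauchyInt (closedArc a' b') d τ‖ ≤
        C * K * C' := by
      rw [norm_mul]
      exact mul_le_mul h6 h3 (norm_nonneg _) hp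
    linarith

lemma tendsto_sub_mul_inv_nuFactor_mul (hd : Disjoint (Set.uIcc a b) (Set.uIcc a' b')) :
    Tendsto (fun τ : ℂ => (τ - a) * (nuFactor a b τ * nuFactor a' b' τ)⁻¹)
      (𝓝[offReal] (a : ℂ)) (𝓝 0) := by
  have h1 := (continuousAt_nuFactor_of_disjoint hd Set.left_mem_uIcc).inv₀
    (nuFactor_ne_zero (ofReal_mem_offCut_of_disjoint hd Set.left_mem_uIcc))
  have h2 := (tendsto_sub_mul_inv_nuFactor a b).mul
    (h1.tendsto.mono_left (nhdsWithin_le_nhds (s := offReal)))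
  rw [zero_mul] at h2
  refine h2.congr fun τ => ?_
  simp only [Pi.inv_apply, mul_inv]
  ring

lemma exists_tendsto_nuFactor_mul (hd : Disjoint (Set.uIcc a b) (Set.uIcc a' b')) {σ : ℝ}
    (hσ : σ ∈ Set.uIoo b a) : ∃ N : ℂ, N ≠ 0 ∧
      Tendsto (fun τ => nuFactor a b τ * nuFactor a' b' τ) (𝓝[{z : ℂ | 0 < z.im}] (σ : ℂ))
        (𝓝 N) ∧
      Tendsto (fun τ => nuFactor a b τ * nuFactor a' b' τ) (𝓝[{z : ℂ | z.im < 0}] (σ : ℂ))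
        (𝓝 (-N)) := by
  have hab : a ≠ b := by
    rintro rfl
    simp at hσ
  obtain ⟨s, hs, hsab⟩ := exists_sign hab
  obtain ⟨h1, h2⟩ := tendsto_nuFactor_mul hd hs (hsab b Set.right_mem_uIcc) hσ
  refine ⟨_, ?_, h1, by convert! h2 using 2; ring⟩
  have hσa : σ ≠ a := by
    rintro rfl
    simp at hσ
  have hσb : σ ≠ b := by
    rintro rfl
    simp at hσ
  have h3 : √|σ - a| / √|σ - b| ≠ 0 :=
    (div_pos (Real.sqrt_pos.2 (abs_pos.2 (sub_ne_zero.2 hσa)))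
      (Real.sqrt_pos.2 (abs_pos.2 (sub_ne_zero.2 hσb)))).ne'
  have h4 : nuFactor a' b' σ ≠ 0 := nuFactor_ne_zero (ofReal_mem_offCut_of_disjoint hd (by
    rw [Set.uIcc_comm]
    exact Set.uIoo_subset_uIcc_self hσ))
  have h5 : (s : ℂ) ≠ 0 := by
    rcases hs with rfl | rfl <;> norm_num
  refine mul_ne_zero (neg_ne_zero.2 (mul_ne_zero (mul_ne_zero h5 Complex.I_ne_zero) ?_)) h4
  exact_mod_cast h3

end TwoArcs

variable {x₀ x : ℝ × ℝ} {v : (ℝ → M2) × (ℝ → M2)} {Y₁ : ℝ → Fin 2 → ℂ}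

lemma isCompact_arcBar (x₀ x : ℝ × ℝ) : IsCompact (arcBar x₀ x) :=
  (isCompact_closedArc x₀.1 x.1).union (isCompact_closedArc x₀.2 x.2)

lemma arcBar_eq_swap (x₀ x : ℝ × ℝ) :
    arcBar x₀ x = closedArc x₀.2 x.2 ∪ closedArc x₀.1 x.1 := Set.union_comm _ _

lemma differentiableOn_nu (x₀ x : ℝ × ℝ) :
    DifferentiableOn ℂ (nu x₀ x) (offCut (arcBar x₀ x)) := by
  refine DifferentiableOn.mul ((differentiableOn_nuFactor x₀.1 x.1).mono ?_)
    ((differentiableOn_nuFactor x₀.2 x.2).mono ?_)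
  · exact fun τ hτ => (mem_offCut_union.1 hτ).1
  · exact fun τ hτ => (mem_offCut_union.1 hτ).2

lemma nu_ne_zero {τ : ℂ} (hτ : τ ∈ offCut (arcBar x₀ x)) : nu x₀ x τ ≠ 0 :=
  mul_ne_zero (nuFactor_ne_zero (mem_offCut_union.1 hτ).1)
    (nuFactor_ne_zero (mem_offCut_union.1 hτ).2)

lemma tendsto_nu_cocompact (x₀ x : ℝ × ℝ) : Tendsto (nu x₀ x) (cocompact ℂ) (𝓝 1) := by
  have h := (tendsto_nuFactor_cocompact x₀.1 x.1).mul (tendsto_nuFactor_cocompact x₀.2 x.2)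
  rw [one_mul] at h
  exact h

namespace ArcData

lemma integrable_density (hA : ArcData x₀ x v Y₁) (j k : Fin 2) :
    IntegrableOn (fun σ => density x₀ x v Y₁ σ j k) (arcBar x₀ x) :=
  (hA.density₃ j k).integrable.union (hA.density₄ j k).integrable

lemma plemeljAt (hA : ArcData x₀ x v Y₁) {σ : ℝ} (hσ : σ ∈ arc x₀ x) (j k : Fin 2) :
    ∃ L, PlemeljAt (arcBar x₀ x) (fun σ => density x₀ x v Y₁ σ j k) σ
      (density x₀ x v Y₁ σ j k) L := by
  rcases hσ with hσ | hσ
  · exact (hA.density₃ j k).plemeljAt_union (hA.density₄ j k) hA.disj hσ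
  · rw [arcBar_eq_swap]
    exact (hA.density₄ j k).plemeljAt_union (hA.density₃ j k) hA.disj.symm hσ

lemma tendsto_sub_mul (hA : ArcData x₀ x v Y₁) (j k : Fin 2) {e : ℝ}
    (he : e = x₀.1 ∨ e = x.1 ∨ e = x₀.2 ∨ e = x.2) :
    Tendsto (fun τ : ℂ => (τ - e) * cauchyInt (arcBar x₀ x)
      (fun σ => density x₀ x v Y₁ σ j k) τ) (𝓝[offReal] (e : ℂ)) (𝓝 0) := by
  have h3 := fun he => (hA.density₃ j k).tendsto_sub_mul_union (hA.density₄ j k) hA.disj (e := e) he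
  have h4 := fun he =>
    (hA.density₄ j k).tendsto_sub_mul_union (hA.density₃ j k) hA.disj.symm (e := e) he
  rw [← arcBar_eq_swap] at h4
  rcases he with he | he | he | he
  · exact h3 (Or.inl he)
  · exact h3 (Or.inr he)
  · exact h4 (Or.inl he)
  · exact h4 (Or.inr he)

lemma exists_norm_le_tip (hA : ArcData x₀ x v Y₁) (j k : Fin 2) {e : ℝ}
    (he : e = x.1 ∨ e = x.2) :
    ∃ C, ∀ᶠ τ in 𝓝 (e : ℂ), τ ∈ offCut (arcBar x₀ x) →
      ‖cauchyInt (arcBar x₀ x) (fun σ => density x₀ x v Y₁ σ j k) τ‖ ≤ C := by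
  rcases he with rfl | rfl
  · exact (hA.density₃ j k).exists_norm_le_tip (hA.density₄ j k) hA.disj
  · rw [arcBar_eq_swap]
    exact (hA.density₄ j k).exists_norm_le_tip (hA.density₃ j k) hA.disj.symm

lemma exists_norm_le_base (hA : ArcData x₀ x v Y₁) (j k : Fin 2) {e : ℝ}
    (he : e = x₀.1 ∨ e = x₀.2) :
    ∃ C, ∀ᶠ τ in 𝓝 (e : ℂ), τ ∈ offCut (arcBar x₀ x) → ‖nu x₀ x τ‖ ≤ C ∧
      ‖nu x₀ x τ * cauchyInt (arcBar x₀ x) (fun σ => density x₀ x v Y₁ σ j k) τ‖ ≤ C := by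
  rcases he with rfl | rfl
  · exact (hA.density₃ j k).exists_norm_le_base (hA.density₄ j k) hA.disj
  · rw [arcBar_eq_swap, nu_eq_swap]
    exact (hA.density₄ j k).exists_norm_le_base (hA.density₃ j k) hA.disj.symm

lemma tendsto_sub_mul_inv_nu (hA : ArcData x₀ x v Y₁) {e : ℝ} (he : e = x₀.1 ∨ e = x₀.2) :
    Tendsto (fun τ : ℂ => (τ - e) * (nu x₀ x τ)⁻¹) (𝓝[offReal] (e : ℂ)) (𝓝 0) := by
  rcases he with rfl | rfl
  · exact tendsto_sub_mul_inv_nuFactor_mul hA.disj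
  · rw [nu_eq_swap]
    exact tendsto_sub_mul_inv_nuFactor_mul hA.disj.symm

/-- On the arcs `ν⁻ = -ν⁺ ≠ 0`. -/
lemma tendsto_nu (hA : ArcData x₀ x v Y₁) {σ : ℝ} (hσ : σ ∈ arc x₀ x) :
    plus (nu x₀ x) σ ≠ 0 ∧
      Tendsto (nu x₀ x) (𝓝[{z : ℂ | 0 < z.im}] (σ : ℂ)) (𝓝 (plus (nu x₀ x) σ)) ∧
      Tendsto (nu x₀ x) (𝓝[{z : ℂ | z.im < 0}] (σ : ℂ)) (𝓝 (-plus (nu x₀ x) σ)) := by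
  have key : ∃ N : ℂ, N ≠ 0 ∧
      Tendsto (nu x₀ x) (𝓝[{z : ℂ | 0 < z.im}] (σ : ℂ)) (𝓝 N) ∧
      Tendsto (nu x₀ x) (𝓝[{z : ℂ | z.im < 0}] (σ : ℂ)) (𝓝 (-N)) := by
    rcases hσ with hσ | hσ
    · exact exists_tendsto_nuFactor_mul hA.disj hσ
    · rw [nu_eq_swap]
      exact exists_tendsto_nuFactor_mul hA.disj.symm hσ
  obtain ⟨N, hN, h1, h2⟩ := key
  rw [plus_eq_of_tendsto h1]
  exact ⟨hN, h1, h2⟩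

end ArcData

/-! ### The jump condition in terms of `W` -/

variable {F : ℂ → M2}

/-- The matrix `𝓕ᴹ` with `n` in place of `ν`. -/
noncomputable def minkMatrix (x₀ x : ℝ × ℝ) (τ n : ℂ) : M2 :=
  !![1, -Complex.I * (τ - zc x); 0, 1] * !![1, 0; 0, n] * !![1, Complex.I * (τ - zc x₀); 0, 1]

lemma continuous_minkMatrix (x₀ x : ℝ × ℝ) :
    Continuous fun p : ℂ × ℂ => minkMatrix x₀ x p.1 p.2 := by
  refine continuous_matrix fun i j => ?_
  fin_cases i <;> fin_cases j <;>
    simp only [minkMatrix, Matrix.mul_apply, Fin.sum_univ_two, Fin.zero_eta, Fin.mk_one,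
      Matrix.of_apply, Matrix.cons_val', Matrix.cons_val_zero, Matrix.cons_val_one,
      Matrix.cons_val_fin_one] <;>
    fun_prop

lemma inv_minkMatrix (x₀ x : ℝ × ℝ) (τ : ℂ) {n : ℂ} (hn : n ≠ 0) :
    (minkMatrix x₀ x τ n)⁻¹ = !![1, -Complex.I * (τ - zc x₀); 0, 1] *
      (!![1, 0; 0, n⁻¹] * !![1, Complex.I * (τ - zc x); 0, 1]) := by
  refine Matrix.inv_eq_right_inv ?_
  ext i j
  fin_cases i <;> fin_cases j <;>
    simp [minkMatrix, Matrix.mul_apply, Fin.sum_univ_two, hn]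
  field_simp
  ring

lemma FMink_eq (x₀ x : ℝ × ℝ) : FMink x₀ x = fun τ => minkMatrix x₀ x τ (nu x₀ x τ) := rfl

lemma tendsto_FMink {l : Filter ℂ} {σ n : ℂ} (hl : l ≤ 𝓝 σ) (h : Tendsto (nu x₀ x) l (𝓝 n)) :
    Tendsto (fun τ => minkMatrix x₀ x τ (nu x₀ x τ)) l (𝓝 (minkMatrix x₀ x σ n)) := by
  have h2 : Tendsto (fun τ : ℂ => (τ, nu x₀ x τ)) l (𝓝 (σ, n)) := by
    rw [nhds_prod_eq]
    exact Tendsto.prodMk hl h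
  have h3 := (continuous_minkMatrix x₀ x).tendsto (σ, n)
  exact Tendsto.comp (f := fun τ : ℂ => (τ, nu x₀ x τ)) h3 h2

/-- The two columns of `𝓕 v (𝓕ᴹ)⁻¹` in terms of those of `𝓕 W`. -/
lemma mul_inv_minkMatrix_apply (A V : M2) (x₀ x : ℝ × ℝ) (σ : ℝ) {n : ℂ} (hn : n ≠ 0) (j : Fin 2) :
    (A * V * (minkMatrix x₀ x σ n)⁻¹) j 0 =
      (A * (V * !![1, -Complex.I * ((σ : ℂ) - zc x₀); 0, 1])) j 0 ∧
    (A * V * (minkMatrix x₀ x σ n)⁻¹) j 1 =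
      Complex.I * (σ - zc x) * (A * (V * !![1, -Complex.I * ((σ : ℂ) - zc x₀); 0, 1])) j 0 +
      n⁻¹ * (A * (V * !![1, -Complex.I * ((σ : ℂ) - zc x₀); 0, 1])) j 1 := by
  rw [inv_minkMatrix x₀ x σ hn, ← Matrix.mul_assoc, Matrix.mul_assoc A V]
  generalize A * (V * !![1, -Complex.I * ((σ : ℂ) - zc x₀); 0, 1]) = Q
  constructor
  · simp [Matrix.mul_apply, Fin.sum_univ_two]
  · simp [Matrix.mul_apply, Fin.sum_univ_two]
    ring

lemma ArcData.YPlus_apply (hA : ArcData x₀ x v Y₁) {σ : ℝ} (hσ : σ ∈ arc x₀ x) (j : Fin 2) :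
    YPlus x₀ x v (FMink x₀ x) F σ j 0 = (plus F σ * WMat x₀ x v σ) j 0 ∧
    YPlus x₀ x v (FMink x₀ x) F σ j 1 =
      Complex.I * (σ - zc x) * (plus F σ * WMat x₀ x v σ) j 0 +
      (plus (nu x₀ x) σ)⁻¹ * (plus F σ * WMat x₀ x v σ) j 1 := by
  obtain ⟨hN, h1, -⟩ := hA.tendsto_nu hσ
  rw [YPlus, FMink_eq, plus_eq_of_tendsto (tendsto_FMink nhdsWithin_le_nhds h1)]
  exact mul_inv_minkMatrix_apply _ _ _ _ _ hN j

lemma ArcData.YMinus_apply (hA : ArcData x₀ x v Y₁) {σ : ℝ} (hσ : σ ∈ arc x₀ x) (j : Fin 2) :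
    YMinus x₀ x v (FMink x₀ x) F σ j 0 = (minus F σ * WMat x₀ x v σ) j 0 ∧
    YMinus x₀ x v (FMink x₀ x) F σ j 1 =
      Complex.I * (σ - zc x) * (minus F σ * WMat x₀ x v σ) j 0 -
      (plus (nu x₀ x) σ)⁻¹ * (minus F σ * WMat x₀ x v σ) j 1 := by
  obtain ⟨hN, -, h1⟩ := hA.tendsto_nu hσ
  rw [YMinus, FMink_eq, minus_eq_of_tendsto (tendsto_FMink nhdsWithin_le_nhds h1)]
  obtain ⟨h2, h3⟩ := mul_inv_minkMatrix_apply (minus F σ) (onArcs x₀ x v σ) x₀ x σ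
    (neg_ne_zero.2 hN) j
  refine ⟨h2, ?_⟩
  rw [h3, inv_neg, WMat]
  ring

/-- The jump condition says that `𝓕 W₁` is continuous across the arcs and `𝓕 W₂` changes sign. -/
lemma ArcData.jump_iff (hA : ArcData x₀ x v Y₁) {σ : ℝ} (hσ : σ ∈ arc x₀ x) :
    YPlus x₀ x v (FMink x₀ x) F σ = YMinus x₀ x v (FMink x₀ x) F σ ↔
      ∀ j, (plus F σ * WMat x₀ x v σ) j 0 = (minus F σ * WMat x₀ x v σ) j 0 ∧
        (plus F σ * WMat x₀ x v σ) j 1 = -(minus F σ * WMat x₀ x v σ) j 1 := by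
  have hN := (hA.tendsto_nu hσ).1
  constructor
  · intro h j
    obtain ⟨h1, h2⟩ := hA.YPlus_apply (F := F) hσ j
    obtain ⟨h3, h4⟩ := hA.YMinus_apply (F := F) hσ j
    rw [h] at h1 h2
    have h5 : (plus F σ * WMat x₀ x v σ) j 0 = (minus F σ * WMat x₀ x v σ) j 0 := h1.symm.trans h3
    refine ⟨h5, ?_⟩
    have h6 := h2.symm.trans h4
    rw [h5] at h6
    have h7 : (plus (nu x₀ x) σ)⁻¹ * ((plus F σ * WMat x₀ x v σ) j 1 +
        (minus F σ * WMat x₀ x v σ) j 1) = 0 := by linear_combination h6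
    exact eq_neg_of_add_eq_zero_left ((mul_eq_zero.1 h7).resolve_left (inv_ne_zero hN))
  · intro h
    ext j k
    obtain ⟨h1, h2⟩ := hA.YPlus_apply (F := F) hσ j
    obtain ⟨h3, h4⟩ := hA.YMinus_apply (F := F) hσ j
    obtain ⟨h5, h6⟩ := h j
    fin_cases k
    · exact h1.trans (h5.trans h3.symm)
    · refine h2.trans (Eq.trans ?_ h4.symm)
      rw [h5, h6]
      ring

/-- The associated column, entry by entry. -/
lemma associated_iff {A B W : M2} {y : Fin 2 → ℂ} :
    (1 / 2 : ℂ) • (A + B) * W = !![y 0, 0; y 1, 0] ↔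
      ∀ j, (A * W) j 0 + (B * W) j 0 = 2 * y j ∧ (A * W) j 1 + (B * W) j 1 = 0 := by
  have h : (1 / 2 : ℂ) • (A + B) * W = (1 / 2 : ℂ) • (A * W + B * W) := by
    rw [Matrix.smul_mul, Matrix.add_mul]
  rw [h, ← Matrix.ext_iff]
  constructor
  · intro h j
    have h0 := h j 0
    have h1 := h j 1
    rw [Matrix.smul_apply, Matrix.add_apply, smul_eq_mul] at h0 h1
    fin_cases j
    · simp at h0 h1
      exact ⟨by simpa using (by linear_combination 2 * h0 : _ = 2 * y 0), h1⟩
    · simp at h0 h1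
      exact ⟨by simpa using (by linear_combination 2 * h0 : _ = 2 * y 1), h1⟩
  · intro h j k
    rw [Matrix.smul_apply, Matrix.add_apply, smul_eq_mul]
    obtain ⟨h0, h1⟩ := h j
    fin_cases k
    · simp only [Fin.zero_eta, h0]
      fin_cases j <;> simp
    · simp only [Fin.mk_one, h1]
      fin_cases j <;> simp

/-! ### Boundedness at a pair of points -/

lemma boundedAt_pair {X : Type*} [TopologicalSpace X] {S : Set X} {p q : X} {f : X → M2}
    (h : ∀ e, e = p ∨ e = q → ∀ j k, ∃ C, ∀ᶠ t in 𝓝 e, t ∈ S → ‖f t j k‖ ≤ C) :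
    BoundedAt S {p, q} f := by
  choose C hC using h
  set Cp := ∑ j, ∑ k, |C p (Or.inl rfl) j k| with hCp
  set Cq := ∑ j, ∑ k, |C q (Or.inr rfl) j k| with hCq
  have hle : ∀ (g : Fin 2 → Fin 2 → ℝ) (j k : Fin 2), g j k ≤ ∑ j, ∑ k, |g j k| := by
    intro g j k
    refine (le_abs_self _).trans ?_
    refine (Finset.single_le_sum (f := fun k => |g j k|) (fun k _ => abs_nonneg _)
      (Finset.mem_univ k)).trans ?_
    exact Finset.single_le_sum (f := fun j => ∑ k, |g j k|)
      (fun j _ => Finset.sum_nonneg fun k _ => abs_nonneg _) (Finset.mem_univ j)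
  refine ⟨{t | t ∈ S → ∀ j k, ‖f t j k‖ ≤ max Cp Cq}, ?_, max Cp Cq, fun t ht => ht.1 ht.2⟩
  rw [mem_nhdsSet_iff_forall]
  rintro e (rfl | he)
  · have h1 : ∀ᶠ t in 𝓝 e, ∀ j k, t ∈ S → ‖f t j k‖ ≤ C e (Or.inl rfl) j k :=
      eventually_all.2 fun j => eventually_all.2 fun k => hC e (Or.inl rfl) j k
    filter_upwards [h1] with t ht htS j k
    exact ((ht j k htS).trans (hle _ j k)).trans (le_max_left _ _)
  · have he' : e = q := he
    subst he'
    have h1 : ∀ᶠ t in 𝓝 e, ∀ j k, t ∈ S → ‖f t j k‖ ≤ C e (Or.inr rfl) j k :=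
      eventually_all.2 fun j => eventually_all.2 fun k => hC e (Or.inr rfl) j k
    filter_upwards [h1] with t ht htS j k
    exact ((ht j k htS).trans (hle _ j k)).trans (le_max_right _ _)

lemma BoundedAt.exists_eventually {X : Type*} [TopologicalSpace X] {S : Set X} {p q : X}
    {f : X → M2} (h : BoundedAt S {p, q} f) {e : X} (he : e = p ∨ e = q) :
    ∃ C, ∀ᶠ t in 𝓝 e, t ∈ S → ∀ j k, ‖f t j k‖ ≤ C := by
  obtain ⟨U, hU, C, hC⟩ := h
  refine ⟨C, ?_⟩
  filter_upwards [mem_nhdsSet_iff_forall.1 hU e he] with t ht htS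
  exact hC t ⟨ht, htS⟩

lemma boundedAt_of_forall_le {X : Type*} [TopologicalSpace X] {S P : Set X} {f : X → M2} {C : ℝ}
    (h : ∀ t ∈ S, ∀ j k, ‖f t j k‖ ≤ C) : BoundedAt S P f :=
  ⟨Set.univ, Filter.univ_mem, C, fun t ht => h t ht.2⟩

/-! ### Principal values -/

lemma HasPVIntegral.unique {S : Set ℝ} {σ : ℝ} {f : ℝ → ℂ} {L L' : ℂ} (h : HasPVIntegral S σ f L)
    (h' : HasPVIntegral S σ f L') : L = L' := tendsto_nhds_unique h.2 h'.2

lemma HasPVIntegral.add {S : Set ℝ} {σ : ℝ} {f g : ℝ → ℂ} {L L' : ℂ} (h : HasPVIntegral S σ f L)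
    (h' : HasPVIntegral S σ g L') : HasPVIntegral S σ (fun t => f t + g t) (L + L') := by
  refine ⟨fun ε hε => (h.1 ε hε).add (h'.1 ε hε), (h.2.add h'.2).congr' ?_⟩
  filter_upwards [self_mem_nhdsWithin] with ε hε
  exact (integral_add (h.1 ε hε) (h'.1 ε hε)).symm

lemma HasPVIntegral.mul_const {S : Set ℝ} {σ : ℝ} {f : ℝ → ℂ} {L : ℂ} (h : HasPVIntegral S σ f L)
    (c : ℂ) : HasPVIntegral S σ (fun t => f t * c) (L * c) := by
  refine ⟨fun ε hε => (h.1 ε hε).mul_const c, (h.2.mul_const c).congr fun ε => ?_⟩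
  exact (integral_mul_const c _).symm

lemma HasPVIntegral.norm_le {S : Set ℝ} (hS : MeasurableSet S) {σ : ℝ} {f : ℝ → ℂ} {L : ℂ}
    (h : HasPVIntegral S σ f L) {g : ℝ → ℝ} (hg : IntegrableOn g S) (hg0 : ∀ t, 0 ≤ g t)
    (hfg : ∀ᵐ t ∂(volume.restrict S), t ≠ σ → ‖f t‖ ≤ g t) : ‖L‖ ≤ ∫ t in S, g t := by
  refine le_of_tendsto h.2.norm ?_
  filter_upwards [self_mem_nhdsWithin] with ε hε
  have hε' : 0 < ε := hε
  refine (norm_integral_le_of_norm_le (hg.mono_set Set.sdiff_subset) ?_).trans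
    (setIntegral_mono_set hg (Eventually.of_forall hg0)
      (Eventually.of_forall fun t ht => ht.1))
  filter_upwards [ae_restrict_of_ae_restrict_of_subset Set.sdiff_subset hfg,
    ae_restrict_mem (hS.diff Metric.isOpen_ball.measurableSet)] with t ht ht'
  refine ht ?_
  rintro rfl
  exact ht'.2 (Metric.mem_ball_self hε')

/-! ### Consequences of the Cauchy integral representation -/

/-- The Cauchy integral of the density over both arcs. -/
noncomputable def densityInt (x₀ x : ℝ × ℝ) (v : (ℝ → M2) × (ℝ → M2)) (Y₁ : ℝ → Fin 2 → ℂ)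
    (j k : Fin 2) : ℂ → ℂ :=
  cauchyInt (arcBar x₀ x) fun σ => density x₀ x v Y₁ σ j k

lemma ae_mem_arc (x₀ x : ℝ × ℝ) : ∀ᵐ t ∂(volume.restrict (arcBar x₀ x)), t ∈ arc x₀ x := by
  rw [arcBar_eq, ae_restrict_union_iff]
  exact ⟨(ae_mem_uIoo x₀.1 x.1).mono fun t ht => Or.inl ht,
    (ae_mem_uIoo x₀.2 x.2).mono fun t ht => Or.inr ht⟩

lemma mem_uIoo_of_mem_closedArc {a b σ : ℝ} (hσ : σ ∈ closedArc a b) (ha : σ ≠ a) (hb : σ ≠ b) :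
    σ ∈ Set.uIoo b a := by
  have h := closedArc_subset_uIcc _ _ hσ
  rcases le_total a b with hab | hab
  · rw [Set.uIcc_of_le hab] at h
    rw [Set.uIoo_of_ge hab]
    exact ⟨lt_of_le_of_ne h.1 ha.symm, lt_of_le_of_ne h.2 hb⟩
  · rw [Set.uIcc_of_ge hab] at h
    rw [Set.uIoo_of_le hab]
    exact ⟨lt_of_le_of_ne h.1 hb.symm, lt_of_le_of_ne h.2 ha⟩

lemma cut_compl (x₀ x : ℝ × ℝ) : (cut x₀ x)ᶜ = offCut (arcBar x₀ x) := rfl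

lemma pi_I_ne_zero : (Real.pi : ℂ) * Complex.I ≠ 0 :=
  mul_ne_zero (by exact_mod_cast Real.pi_ne_zero) Complex.I_ne_zero

lemma isCauchyIntegral_iff (hA : ArcData x₀ x v Y₁) :
    IsCauchyIntegral x₀ x v F Y₁ ↔ ∀ τ ∈ offCut (arcBar x₀ x), ∀ j k,
      (nu x₀ x τ)⁻¹ * F τ j k =
        (1 : M2) j k - (1 / (Real.pi * Complex.I)) * densityInt x₀ x v Y₁ j k τ :=
  ⟨fun h τ hτ j k => (h τ hτ j k).2, fun h τ hτ j k =>
    ⟨integrableOn_cauchy (isCompact_arcBar x₀ x) (hA.integrable_density j k) hτ, h τ hτ j k⟩⟩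

section Representation
variable (hA : ArcData x₀ x v Y₁) (hF : ∀ τ ∈ offCut (arcBar x₀ x), ∀ j k,
  (nu x₀ x τ)⁻¹ * F τ j k =
    (1 : M2) j k - (1 / (Real.pi * Complex.I)) * densityInt x₀ x v Y₁ j k τ)
include hF

lemma entry_eq {τ : ℂ} (hτ : τ ∈ offCut (arcBar x₀ x)) (j k : Fin 2) :
    F τ j k = nu x₀ x τ *
      ((1 : M2) j k - (1 / (Real.pi * Complex.I)) * densityInt x₀ x v Y₁ j k τ) := by
  rw [← hF τ hτ j k, mul_inv_cancel_left₀ (nu_ne_zero hτ)]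

include hA

/-- The boundary values of `𝓕`, by Plemelj's formulas. -/
lemma boundary_values {σ : ℝ} (hσ : σ ∈ arc x₀ x) {L : Fin 2 → Fin 2 → ℂ}
    (hL : ∀ j k, PlemeljAt (arcBar x₀ x) (fun σ => density x₀ x v Y₁ σ j k) σ
      (density x₀ x v Y₁ σ j k) (L j k)) :
    (HasPlus F σ ∧ ∀ j k, plus F σ j k = plus (nu x₀ x) σ * ((1 : M2) j k -
      (1 / (Real.pi * Complex.I)) * L j k - density x₀ x v Y₁ σ j k)) ∧
    (HasMinus F σ ∧ ∀ j k, minus F σ j k = -plus (nu x₀ x) σ * ((1 : M2) j k -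
      (1 / (Real.pi * Complex.I)) * L j k + density x₀ x v Y₁ σ j k)) := by
  obtain ⟨-, h1, h2⟩ := hA.tendsto_nu hσ
  have hpi := pi_I_ne_zero
  set N := plus (nu x₀ x) σ with hN
  constructor
  · have h3 : Tendsto F (𝓝[{z : ℂ | 0 < z.im}] (σ : ℂ)) (𝓝 (Matrix.of fun j k =>
        N * ((1 : M2) j k - (1 / (Real.pi * Complex.I)) * L j k - density x₀ x v Y₁ σ j k))) := by
      refine tendsto_pi_nhds.2 fun j => tendsto_pi_nhds.2 fun k => ?_
      have h4 := h1.mul (((hL j k).above.const_mul (1 / (Real.pi * Complex.I))).const_sub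
        ((1 : M2) j k))
      have h5 : (1 : M2) j k - (1 / (Real.pi * Complex.I)) *
          (L j k + Real.pi * Complex.I * density x₀ x v Y₁ σ j k) =
          (1 : M2) j k - (1 / (Real.pi * Complex.I)) * L j k - density x₀ x v Y₁ σ j k := by
        field_simp
        ring
      rw [h5] at h4
      refine h4.congr' ?_
      filter_upwards [self_mem_nhdsWithin] with τ hτ
      exact (entry_eq hF (offReal_subset_offCut _ (ne_of_gt hτ)) j k).symm
    refine ⟨hasPlus_of_tendsto h3, fun j k => ?_⟩
    rw [plus_eq_of_tendsto h3, Matrix.of_apply]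
  · have h3 : Tendsto F (𝓝[{z : ℂ | z.im < 0}] (σ : ℂ)) (𝓝 (Matrix.of fun j k =>
        -N * ((1 : M2) j k - (1 / (Real.pi * Complex.I)) * L j k + density x₀ x v Y₁ σ j k))) := by
      refine tendsto_pi_nhds.2 fun j => tendsto_pi_nhds.2 fun k => ?_
      have h4 := h2.mul (((hL j k).below.const_mul (1 / (Real.pi * Complex.I))).const_sub
        ((1 : M2) j k))
      have h5 : (1 : M2) j k - (1 / (Real.pi * Complex.I)) *
          (L j k - Real.pi * Complex.I * density x₀ x v Y₁ σ j k) =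
          (1 : M2) j k - (1 / (Real.pi * Complex.I)) * L j k + density x₀ x v Y₁ σ j k := by
        field_simp
        ring
      rw [h5] at h4
      refine h4.congr' ?_
      filter_upwards [self_mem_nhdsWithin] with τ hτ
      exact (entry_eq hF (offReal_subset_offCut _ (ne_of_lt hτ)) j k).symm
    refine ⟨hasMinus_of_tendsto h3, fun j k => ?_⟩
    rw [minus_eq_of_tendsto h3, Matrix.of_apply]

end Representation

/-- The principal value of the integral in the singular integral equation. -/
lemma hasPVIntegral_mulVec {σ : ℝ} {L : Fin 2 → Fin 2 → ℂ}
    (hL : ∀ j k, PlemeljAt (arcBar x₀ x) (fun σ => density x₀ x v Y₁ σ j k) σ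
      (density x₀ x v Y₁ σ j k) (L j k)) (w : Fin 2 → ℂ) (j : Fin 2) :
    HasPVIntegral (arcBar x₀ x) σ
      (fun t : ℝ => (density x₀ x v Y₁ t *ᵥ w) j / ((t : ℂ) - σ)) (L j 0 * w 0 + L j 1 * w 1) := by
  have h := ((hL j 0).pv.mul_const (w 0)).add ((hL j 1).pv.mul_const (w 1))
  have h2 : (fun t : ℝ => (density x₀ x v Y₁ t *ᵥ w) j / ((t : ℂ) - σ)) = fun t : ℝ =>
      density x₀ x v Y₁ t j 0 / ((t : ℂ) - σ) * w 0 +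
        density x₀ x v Y₁ t j 1 / ((t : ℂ) - σ) * w 1 := by
    funext t
    simp only [Matrix.mulVec, dotProduct, Fin.sum_univ_two]
    ring
  rw [h2]
  exact h

lemma mul_W_apply (A W : M2) (j k : Fin 2) : (A * W) j k = A j 0 * W 0 k + A j 1 * W 1 k := by
  rw [Matrix.mul_apply, Fin.sum_univ_two]

lemma one_mulVec_apply (w : Fin 2 → ℂ) (j : Fin 2) :
    (1 : M2) j 0 * w 0 + (1 : M2) j 1 * w 1 = w j := by
  have h := congrFun (Matrix.one_mulVec w) j
  rwa [Matrix.mulVec, dotProduct, Fin.sum_univ_two] at h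

/-! ### From the Hilbert problem to the integral equations -/

lemma tendsto_at_infinity (hF : IsHHPSolution x₀ x v (FMink x₀ x) F) (j k : Fin 2) :
    Tendsto (fun τ => F τ j k) (cocompact ℂ) (𝓝 ((1 : M2) j k)) := by
  have h1 := (hF.at_infinity j k).continuousAt.tendsto
  simp only [if_true] at h1
  rw [← Metric.cobounded_eq_cocompact]
  have h2 := h1.comp tendsto_inv₀_cobounded
  refine h2.congr' ?_
  have h3 : ∀ᶠ τ : ℂ in Bornology.cobounded ℂ, τ ≠ 0 := Bornology.eventually_ne_cobounded 0
  filter_upwards [h3] with τ hτ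
  simp [hτ]

lemma tendsto_densityInt_cocompact (hA : ArcData x₀ x v Y₁) (j k : Fin 2) :
    Tendsto (densityInt x₀ x v Y₁ j k) (cocompact ℂ) (𝓝 0) :=
  tendsto_cauchyInt_cocompact (isCompact_arcBar x₀ x) (hA.integrable_density j k)

lemma differentiableOn_densityInt (hA : ArcData x₀ x v Y₁) (j k : Fin 2) :
    DifferentiableOn ℂ (densityInt x₀ x v Y₁ j k) (offCut (arcBar x₀ x)) :=
  differentiableOn_cauchyInt (isCompact_arcBar x₀ x) (hA.integrable_density j k)

/-- With `A = 𝓕⁺` and `B = 𝓕⁻`: `½ (𝓕⁺ + 𝓕⁻) = -𝒴₁ W₂ᵀ J`, since `-W₂ᵀ J` is the first row of `W⁻¹`. -/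
lemma add_eq_of_associated {A B W : M2} {y : Fin 2 → ℂ}
    (hdet : W 0 0 * W 1 1 - W 0 1 * W 1 0 = 1)
    (h : ∀ j, (A * W) j 0 + (B * W) j 0 = 2 * y j ∧ (A * W) j 1 + (B * W) j 1 = 0) (j k : Fin 2) :
    A j k + B j k = -2 * (y j * (![-W 1 1, W 0 1] : Fin 2 → ℂ) k) := by
  obtain ⟨h0, h1⟩ := h j
  simp only [mul_W_apply] at h0 h1
  fin_cases k
  · simp only [Fin.zero_eta, Matrix.cons_val_zero]
    linear_combination (-(A j 0 + B j 0)) * hdet + W 1 1 * h0 - W 1 0 * h1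
  · simp only [Fin.mk_one, Matrix.cons_val_one, Matrix.cons_val_fin_one]
    linear_combination (-(A j 1 + B j 1)) * hdet - W 0 1 * h0 + W 0 0 * h1

/-- The Cauchy integral representation of a solution of the Hilbert problem: the difference of both
sides has no jump on the arcs, weak singularities at the end points, and vanishes at infinity. -/
lemma representation_of_solution (hA : ArcData x₀ x v Y₁)
    (hF : IsHHPSolution x₀ x v (FMink x₀ x) F) (hY : IsAssociatedColumn x₀ x v F Y₁) :
    ∀ τ ∈ offCut (arcBar x₀ x), ∀ j k, (nu x₀ x τ)⁻¹ * F τ j k =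
      (1 : M2) j k - (1 / (Real.pi * Complex.I)) * densityInt x₀ x v Y₁ j k τ := by
  intro τ₀ hτ₀ j k
  have hpi := pi_I_ne_zero
  set h : ℂ → ℂ := fun τ => (nu x₀ x τ)⁻¹ * F τ j k - (1 : M2) j k +
    (1 / (Real.pi * Complex.I)) * densityInt x₀ x v Y₁ j k τ with hh
  have hinv : DifferentiableOn ℂ (fun τ => (nu x₀ x τ)⁻¹) (offCut (arcBar x₀ x)) :=
    (differentiableOn_nu x₀ x).inv fun τ hτ => nu_ne_zero hτ
  have hd : DifferentiableOn ℂ h (offCut (arcBar x₀ x)) :=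
    ((hinv.mul (hF.holomorphic j k)).sub_const _).add
      ((differentiableOn_densityInt hA j k).const_mul _)
  -- Inside the arcs the jumps of both terms cancel; elsewhere on the line `h` is holomorphic.
  have hlim : ∀ σ : ℝ, σ ∉ ({x₀.1, x.1, x₀.2, x.2} : Finset ℝ) →
      ∃ L, Tendsto h (𝓝[offReal] (σ : ℂ)) (𝓝 L) := by
    intro σ hσE
    simp only [Finset.mem_insert, Finset.mem_singleton, not_or] at hσE
    by_cases hσ : σ ∈ arcBar x₀ x
    · have hσ' : σ ∈ arc x₀ x := by
        rcases hσ with hσ | hσ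
        · exact Or.inl (mem_uIoo_of_mem_closedArc (a := x₀.1) (b := x.1) hσ hσE.1 hσE.2.1)
        · exact Or.inr (mem_uIoo_of_mem_closedArc (a := x₀.2) (b := x.2) hσ hσE.2.2.1 hσE.2.2.2)
      obtain ⟨L, hL⟩ := hA.plemeljAt hσ' j k
      obtain ⟨hN, hν1, hν2⟩ := hA.tendsto_nu hσ'
      have hF1 := (tendsto_pi_nhds.1 (tendsto_pi_nhds.1 (hF.hasPlus σ hσ').tendsto j)) k
      have hF2 := (tendsto_pi_nhds.1 (tendsto_pi_nhds.1 (hF.hasMinus σ hσ').tendsto j)) k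
      have h1 := (((hν1.inv₀ hN).mul hF1).sub_const ((1 : M2) j k)).add
        (hL.above.const_mul (1 / (Real.pi * Complex.I)))
      have h2 := (((hν2.inv₀ (neg_ne_zero.2 hN)).mul hF2).sub_const ((1 : M2) j k)).add
        (hL.below.const_mul (1 / (Real.pi * Complex.I)))
      have hsum := add_eq_of_associated (hA.det σ hσ') (associated_iff.1 (hY σ hσ')) j k
      have heq : (-plus (nu x₀ x) σ)⁻¹ * minus F σ j k - (1 : M2) j k +
          1 / (Real.pi * Complex.I) *
            (L - Real.pi * Complex.I * density x₀ x v Y₁ σ j k) =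
          (plus (nu x₀ x) σ)⁻¹ * plus F σ j k - (1 : M2) j k +
          1 / (Real.pi * Complex.I) *
            (L + Real.pi * Complex.I * density x₀ x v Y₁ σ j k) := by
        have h3 : plus F σ j k + minus F σ j k = -2 * (Y₁ σ j * rowW2J x₀ x v σ k) := hsum
        have h4 : minus F σ j k = -2 * (Y₁ σ j * rowW2J x₀ x v σ k) - plus F σ j k := by
          linear_combination h3
        rw [density_apply, h4]
        field_simp
        ring
      rw [heq] at h2
      have h3 := h1.sup h2
      rw [← nhdsWithin_offReal_eq] at h3
      exact ⟨_, h3⟩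
    · exact ⟨_, (hd.continuousOn.continuousAt ((isOpen_offCut (isCompact_arcBar x₀ x)).mem_nhds
        (ofReal_mem_offCut.2 hσ))).tendsto.mono_left nhdsWithin_le_nhds⟩
  -- At a base point `ν⁻¹` is weakly singular and `𝓕` is bounded; at a tip `ν⁻¹ 𝓕` is bounded.
  have h0 : ∀ e ∈ ({x₀.1, x.1, x₀.2, x.2} : Finset ℝ),
      Tendsto (fun τ : ℂ => (τ - (e : ℂ)) * h τ) (𝓝[offReal] (e : ℂ)) (𝓝 0) := by
    intro e he
    simp only [Finset.mem_insert, Finset.mem_singleton] at he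
    have h1 : Tendsto (fun τ : ℂ => (τ - e) * densityInt x₀ x v Y₁ j k τ)
        (𝓝[offReal] (e : ℂ)) (𝓝 0) := hA.tendsto_sub_mul j k he
    have h2 : Tendsto (fun τ : ℂ => (τ - e) * (1 : M2) j k) (𝓝[offReal] (e : ℂ)) (𝓝 0) :=
      tendsto_sub_mul_of_bounded (C := ‖(1 : M2) j k‖) (Eventually.of_forall fun τ => le_rfl)
    have h3 : Tendsto (fun τ : ℂ => (τ - e) * ((nu x₀ x τ)⁻¹ * F τ j k))
        (𝓝[offReal] (e : ℂ)) (𝓝 0) := by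
      have hbase : e = x₀.1 ∨ e = x₀.2 → Tendsto (fun τ : ℂ => (τ - e) * ((nu x₀ x τ)⁻¹ * F τ j k))
          (𝓝[offReal] (e : ℂ)) (𝓝 0) := by
        intro he
        obtain ⟨C, hC⟩ := hF.bounded_base.exists_eventually (e := (e : ℂ))
          (by rcases he with rfl | rfl <;> simp)
        have h4 := (hA.tendsto_sub_mul_inv_nu he).norm.mul_const C
        rw [norm_zero, zero_mul] at h4
        refine squeeze_zero_norm' ?_ h4
        filter_upwards [self_mem_nhdsWithin, nhdsWithin_le_nhds hC] with τ hτ hτC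
        rw [← mul_assoc, norm_mul]
        exact mul_le_mul_of_nonneg_left (hτC (offReal_subset_offCut _ hτ) j k) (norm_nonneg _)
      have htip : e = x.1 ∨ e = x.2 → Tendsto (fun τ : ℂ => (τ - e) * ((nu x₀ x τ)⁻¹ * F τ j k))
          (𝓝[offReal] (e : ℂ)) (𝓝 0) := by
        intro he
        obtain ⟨C, hC⟩ := hF.bounded_point.exists_eventually (e := (e : ℂ))
          (by rcases he with rfl | rfl <;> simp)
        refine tendsto_sub_mul_of_bounded (C := C) ?_
        filter_upwards [self_mem_nhdsWithin, nhdsWithin_le_nhds hC] with τ hτ hτC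
        exact hτC (offReal_subset_offCut _ hτ) j k
      rcases he with he | he | he | he
      · exact hbase (Or.inl he)
      · exact htip (Or.inl he)
      · exact hbase (Or.inr he)
      · exact htip (Or.inr he)
    have h4 := (h3.sub h2).add (h1.const_mul (1 / (Real.pi * Complex.I)))
    rw [sub_zero, mul_zero, add_zero] at h4
    refine h4.congr fun τ => ?_
    simp only [hh]
    ring
  have hinf : Tendsto h (cocompact ℂ) (𝓝 0) := by
    have h1 := ((((tendsto_nu_cocompact x₀ x).inv₀ one_ne_zero).mul
      (tendsto_at_infinity hF j k)).sub_const ((1 : M2) j k)).add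
      ((tendsto_densityInt_cocompact hA j k).const_mul (1 / (Real.pi * Complex.I)))
    rw [inv_one, one_mul, sub_self, mul_zero, add_zero] at h1
    exact h1
  have hzero := eq_zero_of_tendsto_offReal _ (hd.mono (offReal_subset_offCut _)) hlim h0
    (hinf.mono_left inf_le_left)
  have h1 := norm_le_of_norm_le_offReal (isOpen_offCut (isCompact_arcBar x₀ x)) isOpen_univ
    hd.continuousOn (C := 0) (fun τ hτ => by rw [hzero τ hτ.2, norm_zero]) τ₀ ⟨trivial, hτ₀⟩
  have h2 : h τ₀ = 0 := norm_le_zero_iff.1 h1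
  simp only [hh] at h2
  linear_combination h2

/-- By Plemelj's formulas, `(𝓕⁺ - 𝓕⁻) W₁` is `2 ν⁺` times the right-hand side of the singular
integral equation, so that this equation expresses the continuity of `𝓕 W₁` across the arcs. -/
theorem alekseev_of_solution (hA : ArcData x₀ x v Y₁)
    (hF : IsHHPSolution x₀ x v (FMink x₀ x) F) (hY : IsAssociatedColumn x₀ x v F Y₁) :
    SolvesAlekseev x₀ x v Y₁ ∧ IsCauchyIntegral x₀ x v F Y₁ := by
  have hrep := representation_of_solution hA hF hY
  refine ⟨fun σ hσ => ?_, (isCauchyIntegral_iff hA).2 hrep⟩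
  choose L hL using hA.plemeljAt hσ
  obtain ⟨⟨-, hp⟩, ⟨-, hm⟩⟩ := boundary_values hA hrep hσ hL
  refine ⟨fun j => L j 0 * W1 x₀ x v σ 0 + L j 1 * W1 x₀ x v σ 1,
    hasPVIntegral_mulVec hL (W1 x₀ x v σ), ?_⟩
  have hN := (hA.tendsto_nu hσ).1
  have hjump := (hA.jump_iff hσ).1 (hF.jump σ hσ)
  funext j
  have h1 := (hjump j).1
  rw [mul_W_apply, mul_W_apply, hp, hp, hm, hm] at h1
  have h2 : 2 * plus (nu x₀ x) σ * (((1 : M2) j 0 * W1 x₀ x v σ 0 + (1 : M2) j 1 * W1 x₀ x v σ 1) -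
      (1 / (Real.pi * Complex.I)) * (L j 0 * W1 x₀ x v σ 0 + L j 1 * W1 x₀ x v σ 1)) = 0 := by
    simp only [W1]
    linear_combination h1
  have h3 := (mul_eq_zero.1 h2).resolve_left (mul_ne_zero two_ne_zero hN)
  rw [one_mulVec_apply] at h3
  simpa using h3.symm

/-! ### From the integral equations to the Hilbert problem -/

/-- The kernel `W₂(t)ᵀ J W₂(σ) / (t - σ)` is bounded, as `W₂` is Lipschitz and
`W₂ᵀ J W₂ = 0`. Hence so is the second column of the principal value integral. -/
lemma ArcData.exists_norm_pv_le (hA : ArcData x₀ x v Y₁) : ∃ C, 0 ≤ C ∧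
    ∀ σ ∈ arc x₀ x, ∀ L : Fin 2 → Fin 2 → ℂ,
      (∀ j k, PlemeljAt (arcBar x₀ x) (fun σ => density x₀ x v Y₁ σ j k) σ
        (density x₀ x v Y₁ σ j k) (L j k)) → ∀ j,
      ‖L j 0 * WMat x₀ x v σ 0 1 + L j 1 * WMat x₀ x v σ 1 1‖ ≤ C := by
  obtain ⟨B, hB0, hB⟩ := hA.bound
  obtain ⟨K, hK0, hK⟩ := hA.lip 0 1
  obtain ⟨K', hK0', hK'⟩ := hA.lip 1 1
  have hker : ∀ t ∈ arc x₀ x, ∀ σ ∈ arc x₀ x,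
      ‖rowW2J x₀ x v t 0 * WMat x₀ x v σ 0 1 + rowW2J x₀ x v t 1 * WMat x₀ x v σ 1 1‖ ≤
        (B * K + B * K') * |t - σ| := by
    intro t ht σ hσ
    have h1 : rowW2J x₀ x v t 0 * WMat x₀ x v σ 0 1 + rowW2J x₀ x v t 1 * WMat x₀ x v σ 1 1 =
        WMat x₀ x v σ 1 1 * (WMat x₀ x v t 0 1 - WMat x₀ x v σ 0 1) -
        WMat x₀ x v σ 0 1 * (WMat x₀ x v t 1 1 - WMat x₀ x v σ 1 1) := by
      simp only [rowW2J, Matrix.cons_val_zero, Matrix.cons_val_one, Matrix.cons_val_fin_one]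
      ring
    rw [h1]
    refine (norm_sub_le _ _).trans ?_
    rw [norm_mul, norm_mul, add_mul, mul_assoc, mul_assoc]
    exact add_le_add
      (mul_le_mul ((hB σ hσ 1).2 1) (hK t ht σ hσ) (norm_nonneg _) hB0)
      (mul_le_mul ((hB σ hσ 0).2 1) (hK' t ht σ hσ) (norm_nonneg _) hB0)
  set D := B * K + B * K' with hD
  have hD0 : 0 ≤ D := by positivity
  set I : Fin 2 → ℝ := fun j =>
    ∫ t in arcBar x₀ x, D * ‖(plus (nu x₀ x) t)⁻¹ * Y₁ t j‖ with hI
  have hI0 : ∀ j, 0 ≤ I j := fun j => integral_nonneg fun t => by positivity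
  refine ⟨I 0 + I 1, add_nonneg (hI0 0) (hI0 1), fun σ hσ L hL j => ?_⟩
  have h1 : ‖L j 0 * WMat x₀ x v σ 0 1 + L j 1 * WMat x₀ x v σ 1 1‖ ≤ I j := by
    refine (hasPVIntegral_mulVec hL (W2 x₀ x v σ) j).norm_le
      (isCompact_arcBar x₀ x).measurableSet ((hA.integrable j).norm.const_mul D)
      (fun t => by positivity) ?_
    filter_upwards [ae_mem_arc x₀ x] with t ht htσ
    have h2 : (density x₀ x v Y₁ t *ᵥ W2 x₀ x v σ) j = (plus (nu x₀ x) t)⁻¹ * Y₁ t j *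
        (rowW2J x₀ x v t 0 * WMat x₀ x v σ 0 1 + rowW2J x₀ x v t 1 * WMat x₀ x v σ 1 1) := by
      rw [Matrix.mulVec, dotProduct, Fin.sum_univ_two, density_apply, density_apply]
      simp only [W2]
      ring
    have h3 : 0 < |t - σ| := abs_pos.2 (sub_ne_zero.2 htσ)
    have h4 : ‖(t : ℂ) - σ‖ = |t - σ| := by
      rw [← Complex.ofReal_sub, Complex.norm_real, Real.norm_eq_abs]
    rw [norm_div, h2, h4, div_le_iff₀ h3, norm_mul]
    refine (mul_le_mul_of_nonneg_left (hker t ht σ hσ) (norm_nonneg _)).trans (le_of_eq ?_)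
    ring
  refine h1.trans ?_
  have h2 := hI0 0
  have h3 := hI0 1
  fin_cases j
  · exact le_add_of_nonneg_right h3
  · exact le_add_of_nonneg_left h2

section Backward
variable (hA : ArcData x₀ x v Y₁) (hF : ∀ τ ∈ offCut (arcBar x₀ x), ∀ j k,
  (nu x₀ x τ)⁻¹ * F τ j k =
    (1 : M2) j k - (1 / (Real.pi * Complex.I)) * densityInt x₀ x v Y₁ j k τ)
include hA hF

lemma differentiableOn_of_representation (j k : Fin 2) :
    DifferentiableOn ℂ (fun τ => F τ j k) (offCut (arcBar x₀ x)) := by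
  refine DifferentiableOn.congr ((differentiableOn_nu x₀ x).mul
    (((differentiableOn_densityInt hA j k).const_mul (1 / (Real.pi * Complex.I))).const_sub
      ((1 : M2) j k))) fun τ hτ => ?_
  exact entry_eq hF hτ j k

/-- By the removable singularity theorem it suffices that `𝓕` tends to `I` at infinity. -/
lemma analyticAt_infinity_of_representation (j k : Fin 2) :
    AnalyticAt ℂ (fun w : ℂ => if w = 0 then (1 : M2) j k else F w⁻¹ j k) 0 := by
  have hoff : ∀ᶠ τ in cocompact ℂ, τ ∈ offCut (arcBar x₀ x) :=
    ((isCompact_arcBar x₀ x).image Complex.continuous_ofReal).compl_mem_cocompact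
  have hinv : Tendsto (fun w : ℂ => w⁻¹) (𝓝[≠] 0) (cocompact ℂ) := by
    rw [← Metric.cobounded_eq_cocompact]
    exact tendsto_inv₀_nhdsNE_zero
  have hd := differentiableOn_of_representation hA hF j k
  refine Complex.analyticAt_of_differentiable_on_punctured_nhds_of_continuousAt ?_ ?_
  · filter_upwards [hinv.eventually hoff, self_mem_nhdsWithin] with w hw hw0
    have hw0' : w ≠ 0 := hw0
    have h1 : DifferentiableAt ℂ (fun w : ℂ => F w⁻¹ j k) w :=
      DifferentiableAt.comp (g := fun τ => F τ j k) w
        (hd.differentiableAt ((isOpen_offCut (isCompact_arcBar x₀ x)).mem_nhds hw))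
        (differentiableAt_inv hw0')
    refine h1.congr_of_eventuallyEq ?_
    filter_upwards [isOpen_ne.mem_nhds hw0'] with u hu
    exact if_neg hu
  · have h1 := (tendsto_nu_cocompact x₀ x).mul
      (((tendsto_densityInt_cocompact hA j k).const_mul (1 / (Real.pi * Complex.I))).const_sub
        ((1 : M2) j k))
    rw [mul_zero, sub_zero, one_mul] at h1
    have h2 : Tendsto (fun τ => F τ j k) (cocompact ℂ) (𝓝 ((1 : M2) j k)) :=
      h1.congr' (hoff.mono fun τ hτ => (entry_eq hF hτ j k).symm)
    refine continuousAt_iff_punctured_nhds.2 ?_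
    simp only [if_true]
    refine (h2.comp hinv).congr' ?_
    filter_upwards [self_mem_nhdsWithin] with w hw
    exact (if_neg hw).symm

lemma boundedAt_base_of_representation :
    BoundedAt (cut x₀ x)ᶜ {(x₀.1 : ℂ), (x₀.2 : ℂ)} F := by
  rw [cut_compl]
  refine boundedAt_pair fun e he j k => ?_
  obtain ⟨e', he', rfl⟩ : ∃ e' : ℝ, (e' = x₀.1 ∨ e' = x₀.2) ∧ e = (e' : ℂ) := by
    rcases he with rfl | rfl
    · exact ⟨_, Or.inl rfl, rfl⟩
    · exact ⟨_, Or.inr rfl, rfl⟩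
  obtain ⟨C, hC⟩ := hA.exists_norm_le_base j k he'
  refine ⟨C * ‖(1 : M2) j k‖ + ‖1 / (Real.pi * Complex.I)‖ * C, ?_⟩
  filter_upwards [hC] with τ h hτ
  obtain ⟨h1, h2⟩ := h hτ
  rw [entry_eq hF hτ, mul_sub, mul_left_comm]
  refine (norm_sub_le _ _).trans ?_
  rw [norm_mul, norm_mul]
  exact add_le_add (mul_le_mul_of_nonneg_right h1 (norm_nonneg _))
    (mul_le_mul_of_nonneg_left h2 (norm_nonneg _))

lemma boundedAt_point_of_representation :
    BoundedAt (cut x₀ x)ᶜ {(x.1 : ℂ), (x.2 : ℂ)} fun τ => (nu x₀ x τ)⁻¹ • F τ := by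
  rw [cut_compl]
  refine boundedAt_pair fun e he j k => ?_
  obtain ⟨e', he', rfl⟩ : ∃ e' : ℝ, (e' = x.1 ∨ e' = x.2) ∧ e = (e' : ℂ) := by
    rcases he with rfl | rfl
    · exact ⟨_, Or.inl rfl, rfl⟩
    · exact ⟨_, Or.inr rfl, rfl⟩
  obtain ⟨C, hC⟩ := hA.exists_norm_le_tip j k he'
  refine ⟨‖(1 : M2) j k‖ + ‖1 / (Real.pi * Complex.I)‖ * C, ?_⟩
  filter_upwards [hC] with τ h hτ
  rw [Matrix.smul_apply, smul_eq_mul, hF τ hτ]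
  refine (norm_sub_le _ _).trans ?_
  rw [norm_mul]
  exact add_le_add le_rfl (mul_le_mul_of_nonneg_left (h hτ) (norm_nonneg _))

section BoundaryAlgebra
variable (hS : SolvesAlekseev x₀ x v Y₁)
include hS

/-- On the arcs, the singular integral equation says that the first column of `𝓕⁺ W` and of
`𝓕⁻ W` is `𝒴₁`, while the second columns are opposite. -/
lemma columns_of_alekseev {σ : ℝ} (hσ : σ ∈ arc x₀ x) (j : Fin 2) :
    (plus F σ * WMat x₀ x v σ) j 0 = Y₁ σ j ∧ (minus F σ * WMat x₀ x v σ) j 0 = Y₁ σ j ∧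
      (plus F σ * WMat x₀ x v σ) j 1 = -(minus F σ * WMat x₀ x v σ) j 1 := by
  choose L hL using hA.plemeljAt hσ
  obtain ⟨⟨-, hp⟩, ⟨-, hm⟩⟩ := boundary_values hA hF hσ hL
  have hN := (hA.tendsto_nu hσ).1
  obtain ⟨L', hL', heq⟩ := hS σ hσ
  have h1 : L' j = L j 0 * W1 x₀ x v σ 0 + L j 1 * W1 x₀ x v σ 1 :=
    (hL' j).unique (hasPVIntegral_mulVec hL (W1 x₀ x v σ) j)
  have h2 := congrFun heq j
  simp only [Pi.zero_apply, Pi.sub_apply, Pi.smul_apply, smul_eq_mul] at h2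
  rw [h1, ← one_mulVec_apply (W1 x₀ x v σ) j] at h2
  simp only [W1] at h2
  have hdet := hA.det σ hσ
  have hd : ∀ k, density x₀ x v Y₁ σ j k = (plus (nu x₀ x) σ)⁻¹ * (Y₁ σ j * rowW2J x₀ x v σ k) :=
    density_apply x₀ x v Y₁ σ j
  set N := plus (nu x₀ x) σ with hNdef
  have hr0 : rowW2J x₀ x v σ 0 = -WMat x₀ x v σ 1 1 := rfl
  have hr1 : rowW2J x₀ x v σ 1 = WMat x₀ x v σ 0 1 := rfl
  have hNd : ∀ k, N * density x₀ x v Y₁ σ j k = Y₁ σ j * rowW2J x₀ x v σ k := fun k => by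
    rw [hd, mul_inv_cancel_left₀ hN]
  have hd0 := hNd 0
  have hd1 := hNd 1
  rw [hr0] at hd0
  rw [hr1] at hd1
  simp only [mul_W_apply, hp, hm]
  refine ⟨?_, ?_, ?_⟩
  · linear_combination (-N) * h2 - WMat x₀ x v σ 0 0 * hd0 - WMat x₀ x v σ 1 0 * hd1 +
      Y₁ σ j * hdet
  · linear_combination N * h2 - WMat x₀ x v σ 0 0 * hd0 - WMat x₀ x v σ 1 0 * hd1 +
      Y₁ σ j * hdet
  · linear_combination (-2) * WMat x₀ x v σ 0 1 * hd0 - 2 * WMat x₀ x v σ 1 1 * hd1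

/-- The first column of `Y` is `𝒴₁`. The second one is bounded although `1 / ν⁺` is singular at the
base points, since `𝓕⁺ W₂` is `ν⁺` times a bounded column. -/
lemma exists_norm_YPlus_le : ∃ C, ∀ σ ∈ arc x₀ x, ∀ j k,
    ‖YPlus x₀ x v (FMink x₀ x) F σ j k‖ ≤ C := by
  obtain ⟨B, hB0, hB⟩ := hA.bound
  obtain ⟨C, hC0, hC⟩ := hA.exists_norm_pv_le
  obtain ⟨R, hR⟩ := (isCompact_arcBar x₀ x).exists_bound_of_continuousOn
    (f := fun σ : ℝ => Complex.I * ((σ : ℂ) - zc x)) (by fun_prop)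
  have hR' : ∀ σ ∈ arc x₀ x, ‖Complex.I * ((σ : ℂ) - zc x)‖ ≤ |R| := fun σ hσ =>
    (hR σ (Set.union_subset_union subset_closure subset_closure hσ)).trans (le_abs_self R)
  set c : ℂ := 1 / (Real.pi * Complex.I) with hc
  refine ⟨|R| * B + (B + ‖c‖ * C) + B, fun σ hσ j k => ?_⟩
  have hp1 : 0 ≤ |R| * B := by positivity
  have hp2 : 0 ≤ ‖c‖ * C := by positivity
  obtain ⟨h0, h1⟩ := hA.YPlus_apply (F := F) hσ j
  obtain ⟨h2, -, -⟩ := columns_of_alekseev hA hF hS hσ j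
  rw [h2] at h0 h1
  have hY := (hB σ hσ j).1
  fin_cases k
  · rw [Fin.zero_eta, h0]
    linarith
  · rw [Fin.mk_one, h1]
    choose L hL using hA.plemeljAt hσ
    obtain ⟨⟨-, hp⟩, -⟩ := boundary_values hA hF hσ hL
    have hN := (hA.tendsto_nu hσ).1
    have h3 : (plus (nu x₀ x) σ)⁻¹ * (plus F σ * WMat x₀ x v σ) j 1 = WMat x₀ x v σ j 1 -
        c * (L j 0 * WMat x₀ x v σ 0 1 + L j 1 * WMat x₀ x v σ 1 1) := by
      rw [mul_W_apply, hp, hp, mul_assoc, mul_assoc, ← mul_add, inv_mul_cancel_left₀ hN,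
        density_apply, density_apply, ← hc, ← one_mulVec_apply (fun i => WMat x₀ x v σ i 1) j]
      simp only [rowW2J, Matrix.cons_val_zero, Matrix.cons_val_one, Matrix.cons_val_fin_one]
      ring
    rw [h3]
    have h4 := mul_le_mul (hR' σ hσ) hY (norm_nonneg _) (abs_nonneg R)
    have h5 := mul_le_mul_of_nonneg_left (hC σ hσ L hL j) (norm_nonneg c)
    have h6 := (hB σ hσ j).2 1
    refine (norm_add_le _ _).trans ?_
    have h7 := norm_sub_le (WMat x₀ x v σ j 1)
      (c * (L j 0 * WMat x₀ x v σ 0 1 + L j 1 * WMat x₀ x v σ 1 1))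
    rw [norm_mul] at h7 ⊢
    linarith

end BoundaryAlgebra

end Backward

/-- The analytic conditions on `𝓕` come from its integral representation alone; the jump condition
and the bound on `Y` use the singular integral equation. -/
theorem solution_of_alekseev (hA : ArcData x₀ x v Y₁) (hS : SolvesAlekseev x₀ x v Y₁)
    (hC : IsCauchyIntegral x₀ x v F Y₁) :
    IsHHPSolution x₀ x v (FMink x₀ x) F ∧ IsAssociatedColumn x₀ x v F Y₁ := by
  have hF := (isCauchyIntegral_iff hA).1 hC
  obtain ⟨C, hY⟩ := exists_norm_YPlus_le hA hF hS
  have hbv : ∀ σ ∈ arc x₀ x, HasPlus F σ ∧ HasMinus F σ := by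
    intro σ hσ
    choose L hL using hA.plemeljAt hσ
    obtain ⟨h1, h2⟩ := boundary_values hA hF hσ hL
    exact ⟨h1.1, h2.1⟩
  refine ⟨⟨differentiableOn_of_representation hA hF, analyticAt_infinity_of_representation hA hF,
    fun σ hσ => (hbv σ hσ).1, fun σ hσ => (hbv σ hσ).2, fun σ hσ => ?_,
    boundedAt_base_of_representation hA hF, boundedAt_point_of_representation hA hF,
    boundedAt_of_forall_le hY, boundedAt_of_forall_le hY⟩, fun σ hσ => ?_⟩
  · refine (hA.jump_iff hσ).2 fun j => ?_
    obtain ⟨h1, h2, h3⟩ := columns_of_alekseev hA hF hS hσ j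
    exact ⟨h1.trans h2.symm, h3⟩
  · refine associated_iff.2 fun j => ?_
    obtain ⟨h1, h2, h3⟩ := columns_of_alekseev hA hF hS hσ j
    rw [h1, h2, h3]
    exact ⟨by ring, by ring⟩

end GerochHHP

theorem mainTheorem5 (r₁ s₁ : EReal) (r₂ s₂ : ℝ) (x₀ : ℝ × ℝ)
    (hD : GerochHHP.IsDomainData r₁ s₁ r₂ s₂ x₀)
    (v : (ℝ → GerochHHP.M2) × (ℝ → GerochHHP.M2))
    (hv : GerochHHP.MemK1Plus r₁ s₁ r₂ s₂ x₀ v)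
    (x : ℝ × ℝ) (hx : x ∈ GerochHHP.nullDomain r₁ s₁ r₂ s₂)
    (F : ℂ → GerochHHP.M2) (Y₁ : ℝ → Fin 2 → ℂ)
    (hY₁ : ∀ j, GerochHHP.IsC0Plus (GerochHHP.arcBar x₀ x) (fun σ => Y₁ σ j)) :
    (GerochHHP.IsHHPSolution x₀ x v (GerochHHP.FMink x₀ x) F ∧
        GerochHHP.IsAssociatedColumn x₀ x v F Y₁) ↔
      (GerochHHP.SolvesAlekseev x₀ x v Y₁ ∧ GerochHHP.IsCauchyIntegral x₀ x v F Y₁) := by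
  have hA := GerochHHP.arcData hD hv hx hY₁
  exact ⟨fun h => GerochHHP.alekseev_of_solution hA h.1 h.2,
    fun h => GerochHHP.solution_of_alekseev hA h.1 h.2⟩
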